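/- Let $(\Sigma_1,g_1)$ and $(\Sigma_2,g_2)$ be smooth compact Riemannian surfaces with a mutual boundary $\partial\Sigma$: there is a smooth $1$-manifold $\partial\Sigma$ together with smooth embeddings $\iota_\beta:\partial\Sigma\to\Sigma_\beta$, $\beta=1,2$, whose images are the boundaries of $\Sigma_1$ and $\Sigma_2$, and by which these boundaries are identified. Let $q_\beta\in C^\infty(\Sigma_\beta)$ be real valued and let $L_\beta=\Delta_{g_\beta}+q_\beta$, where $\Delta_g=-|g|^{-1/2}\partial_a(|g|^{1/2}g^{ab}\partial_b)$ is the Laplace--Beltrami operator. Assume that the Dirichlet-to-Neumann maps of $L_1$ and $L_2$ are defined, that is, for every $f\in C^\infty(\partial\Sigma)$ the problem $L_\beta U_\beta=0$ in $\Sigma_\beta$, $U_\beta|_{\partial\Sigma}=f$, has a unique solution $U_\beta\in C^\infty(\Sigma_\beta)$, and that they are equal: $\Lambda_{L_1}f=\Lambda_{L_2}f$ for all $f\in C^\infty(\partial\Sigma)$, where $\Lambda_{L_\beta}f=\partial_{\nu_\beta}U_\beta|_{\partial\Sigma}$ and $\nu_\beta$ is the exterior unit normal of $(\Sigma_\beta,g_\beta)$.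 Let $F:\Sigma_1\to\Sigma_2$ be a smooth map that is a morphism of solutions, in the sense that $$F^*U_2=U_2\circ F=U_1$$ whenever $L_\beta U_\beta=0$ in $\Sigma_\beta$ and $U_\beta|_{\partial\Sigma}=f$, $\beta=1,2$, for some $f\in C^\infty(\partial\Sigma)$. For local coordinates $x^1$ on an open set $\Gamma\subset\partial\Sigma$, the associated $g_\beta$-boundary normal coordinates $(x^1,x_n)$, $n=2$, $x_n\ge 0$, are the coordinates of $\Sigma_\beta$ near $\Gamma$ in which $\Gamma=\{x_n=0\}$, $x^1$ restricts to the given coordinate of $\Gamma$, the domain contains with each point $(x^1,x_n)$ the segment $\{(x^1,t):0\le t\le x_n\}$, and $g_\beta=dx_n^2+h_\beta(x^1,x_n)\,(dx^1)^2$. Assume that, for all choices of $\Gamma$ and $x^1$, the Taylor series at all points of $\{x_n=0\}$ of the coefficients of $g_1$ and of $q_1$ in $g_1$-boundary normal coordinates agree with those of $g_2$ and $q_2$ in $g_2$-boundary normal coordinates associated to the same coordinate $x^1$. Then $F|_{\partial\Sigma}=\mathrm{Id}$, and in boundary normal coordinates $F$ is the identity to infinite order on the boundary: for every $\Gamma$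 and $x^1$, the coordinate representation of $F$ in the associated $g_1$-boundary normal coordinates on $\Sigma_1$ and $g_2$-boundary normal coordinates on $\Sigma_2$ satisfies $$F(x^1,x_n)=(x^1,x_n)+O(x_n^\infty),$$ that is, at each point of $\{x_n=0\}$ all its derivatives, of every order, equal those of the identity map, and near each such point $F(x^1,x_n)-(x^1,x_n)=O(x_n^N)$ for every $N$. -/

import Mathlib

open Set Filter
open scoped Manifold ContDiff Topology

noncomputable section

namespace SurfaceBVP

/-- The coordinate plane. A chart of a surface with boundary takes values in the closed half plane
`{y | 0 ≤ y 0}`, so the coordinate `y 0` is the normal one (called `x_n` in the classical notation)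
and `y 1` is the tangential one. -/
abbrev Plane : Type := EuclideanSpace ℝ (Fin 2)

/-- The closed half plane `{y | 0 ≤ y 0}`, as a subset of the coordinate plane. -/
abbrev halfPlane : Set Plane := range (𝓡∂ 2)

/-- The `i`-th coordinate vector. -/
abbrev e (i : Fin 2) : Plane := EuclideanSpace.single i 1

/-- The partial derivative `∂ h / ∂ y i` of a function on the closed half plane
(one-sided where necessary). -/
def partialDeriv (i : Fin 2) (h : Plane → ℝ) (y : Plane) : ℝ :=
  fderivWithin ℝ h halfPlane y (e i)

section Surface

variable {M : Type*} [TopologicalSpace M] [ChartedSpace (EuclideanHalfSpace 2) M]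
  [IsManifold (𝓡∂ 2) ∞ M]

/-- Smooth Riemannian metrics on a surface with boundary, smooth up to the boundary. -/
abbrev Metric (M : Type*) [TopologicalSpace M] [ChartedSpace (EuclideanHalfSpace 2) M]
    [IsManifold (𝓡∂ 2) ∞ M] : Type _ :=
  Bundle.ContMDiffRiemannianMetric (𝓡∂ 2) ∞ Plane (fun p : M ↦ TangentSpace (𝓡∂ 2) p)

/-- The coordinate vector field `∂ / ∂ y i` of the chart `φ`, at the point with coordinates `y`. -/
def coordVec (φ : OpenPartialHomeomorph M (EuclideanHalfSpace 2)) (i : Fin 2) (y : Plane) :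
    TangentSpace (𝓡∂ 2) ((φ.extend (𝓡∂ 2)).symm y) :=
  mfderivWithin 𝓘(ℝ, Plane) (𝓡∂ 2) (φ.extend (𝓡∂ 2)).symm halfPlane y (e i)

/-- The matrix `g_ij = g(∂_i, ∂_j)` of the metric in the chart `φ`, as a function of the
coordinates. -/
def metricCoeff (g : Metric M) (φ : OpenPartialHomeomorph M (EuclideanHalfSpace 2)) (y : Plane) :
    Matrix (Fin 2) (Fin 2) ℝ :=
  Matrix.of fun i j ↦ g.inner ((φ.extend (𝓡∂ 2)).symm y) (coordVec φ i y) (coordVec φ j y)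

/-- The coordinate representation of a function in the chart `φ`. -/
def localRep (φ : OpenPartialHomeomorph M (EuclideanHalfSpace 2)) (u : M → ℝ) : Plane → ℝ :=
  u ∘ (φ.extend (𝓡∂ 2)).symm

/-- The Laplace-Beltrami operator in the chart `φ`, with the geometric sign (a nonnegative operator):
`Δ_g u = - |g|^(-1/2) ∂_i (|g|^(1/2) g^ij ∂_j u)`. -/
def laplacianInChart (g : Metric M) (φ : OpenPartialHomeomorph M (EuclideanHalfSpace 2))
    (u : M → ℝ) (y : Plane) : ℝ :=
  -(√(metricCoeff g φ y).det)⁻¹ *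
    ∑ i : Fin 2, partialDeriv i
      (fun z ↦ √(metricCoeff g φ z).det *
        ∑ j : Fin 2, (metricCoeff g φ z)⁻¹ i j * partialDeriv j (localRep φ u) z) y

/-- `u` solves `(Δ_g + q) u = 0` on the surface: the equation holds in all smooth charts. -/
def Solves (g : Metric M) (q u : C^∞⟮𝓡∂ 2, M; ℝ⟯) : Prop :=
  ∀ φ ∈ IsManifold.maximalAtlas (𝓡∂ 2) ∞ M, ∀ p ∈ φ.source,
    laplacianInChart g φ u (φ.extend (𝓡∂ 2) p) + q p * u p = 0

variable {B : Type*} [TopologicalSpace B] [ChartedSpace (EuclideanSpace ℝ (Fin 1)) B]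

/-- `ι` identifies the curve `B` (a one-dimensional manifold without boundary) with the boundary of
the surface `M`. -/
structure IsBoundaryInclusion (ι : B → M) : Prop where
  isSmoothEmbedding : Manifold.IsSmoothEmbedding (𝓡 1) (𝓡∂ 2) ∞ ι
  range_eq : range ι = (𝓡∂ 2).boundary M

/-- `u` solves the Dirichlet problem `(Δ_g + q) u = 0` on `M`, `u = f` on the boundary. -/
def IsDirichletSolution (g : Metric M) (q : C^∞⟮𝓡∂ 2, M; ℝ⟯) (ι : B → M)
    (f : C^∞⟮𝓡 1, B; ℝ⟯) (u : C^∞⟮𝓡∂ 2, M; ℝ⟯) : Prop :=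
  Solves g q u ∧ ∀ b, u (ι b) = f b

/-- The Dirichlet-to-Neumann map of `Δ_g + q` is defined: the Dirichlet problem has exactly one
solution for every smooth boundary value. -/
def DNMapDefined (g : Metric M) (q : C^∞⟮𝓡∂ 2, M; ℝ⟯) (ι : B → M) : Prop :=
  ∀ f : C^∞⟮𝓡 1, B; ℝ⟯, ∃! u, IsDirichletSolution g q ι f u

/-- The component of the tangent vector `v` along the normal coordinate `y 0` of the preferred chart
at `p`. For a boundary point `p`, it is negative if and only if `v` points out of the surface. -/
def normalComponent (p : M) (v : TangentSpace (𝓡∂ 2) p) : ℝ :=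
  let w : Plane := mfderiv (𝓡∂ 2) 𝓘(ℝ, Plane) (extChartAt (𝓡∂ 2) p) p v
  w 0

/-- `ν` is the exterior unit normal at the boundary point `ι b`: it has length one, is orthogonal
to the boundary, and points out of the surface. -/
structure IsExteriorUnitNormal (g : Metric M) (ι : B → M) (b : B)
    (ν : TangentSpace (𝓡∂ 2) (ι b)) : Prop where
  norm_one : g.inner (ι b) ν ν = 1
  orthogonal : ∀ τ : TangentSpace (𝓡 1) b, g.inner (ι b) ν (mfderiv (𝓡 1) (𝓡∂ 2) ι b τ) = 0
  exterior : normalComponent (ι b) ν < 0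

/-- The exterior unit normal. -/
def exteriorUnitNormal (g : Metric M) (ι : B → M) (b : B) : TangentSpace (𝓡∂ 2) (ι b) :=
  Classical.epsilon (IsExteriorUnitNormal g ι b)

/-- The solution of the Dirichlet problem with boundary value `f`. -/
def dirichletSolution (g : Metric M) (q : C^∞⟮𝓡∂ 2, M; ℝ⟯) (ι : B → M) (f : C^∞⟮𝓡 1, B; ℝ⟯) :
    C^∞⟮𝓡∂ 2, M; ℝ⟯ :=
  Classical.epsilon (IsDirichletSolution g q ι f)

/-- The Dirichlet-to-Neumann map of `Δ_g + q`: it sends `f` to the exterior normal derivative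
`∂_ν u` on the boundary of the solution `u` with boundary value `f`. It is meaningful under
`DNMapDefined g q ι`. -/
def dnMap (g : Metric M) (q : C^∞⟮𝓡∂ 2, M; ℝ⟯) (ι : B → M) (f : C^∞⟮𝓡 1, B; ℝ⟯) (b : B) : ℝ :=
  mfderiv (𝓡∂ 2) 𝓘(ℝ, ℝ) (dirichletSolution g q ι f) (ι b) (exteriorUnitNormal g ι b)

/-- The chart `φ` of the surface consists of the `g`-boundary normal coordinates associated to the
chart `χ` of the boundary. The coordinate `y 0` vanishes on the boundary and `y 1` restricts there
to the given coordinate of the boundary. In these coordinates the metric is `dy₀² + h(y) dy₁²`, which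
says that the coordinate curves of `y 0`, all of which start at the boundary, are the unit speed
geodesics normal to the boundary, and that `∂ / ∂ y 0` is the gradient of `y 0`, the distance to
the boundary along these curves. -/
structure IsBoundaryNormalChart (g : Metric M) (ι : B → M)
    (χ : OpenPartialHomeomorph B (EuclideanSpace ℝ (Fin 1)))
    (φ : OpenPartialHomeomorph M (EuclideanHalfSpace 2)) : Prop where
  boundary_mem_maximalAtlas : χ ∈ IsManifold.maximalAtlas (𝓡 1) ∞ B
  mem_maximalAtlas : φ ∈ IsManifold.maximalAtlas (𝓡∂ 2) ∞ M
  preimage_source : ι ⁻¹' φ.source = χ.source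
  apply_boundary : ∀ b ∈ χ.source, φ.extend (𝓡∂ 2) (ι b) = !₂[0, χ b 0]
  normal_segment : ∀ y ∈ (φ.extend (𝓡∂ 2)).target, ∀ t ∈ Icc 0 (y 0),
    !₂[t, y 1] ∈ (φ.extend (𝓡∂ 2)).target
  metric_normal : ∀ y ∈ (φ.extend (𝓡∂ 2)).target, metricCoeff g φ y 0 0 = 1
  metric_mixed : ∀ y ∈ (φ.extend (𝓡∂ 2)).target, metricCoeff g φ y 0 1 = 0

end Surface

/-- Two functions on the closed half plane have the same (formal) Taylor series at `y`. -/
def SameTaylorSeriesAt {V : Type*} [NormedAddCommGroup V] [NormedSpace ℝ V]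
    (G₁ G₂ : Plane → V) (y : Plane) : Prop :=
  ∀ k : ℕ, iteratedFDerivWithin ℝ k G₁ halfPlane y = iteratedFDerivWithin ℝ k G₂ halfPlane y

section TwoSurfaces

variable {M₁ : Type*} [TopologicalSpace M₁] [ChartedSpace (EuclideanHalfSpace 2) M₁]
  [IsManifold (𝓡∂ 2) ∞ M₁]
  {M₂ : Type*} [TopologicalSpace M₂] [ChartedSpace (EuclideanHalfSpace 2) M₂]
  [IsManifold (𝓡∂ 2) ∞ M₂]
  {B : Type*} [TopologicalSpace B] [ChartedSpace (EuclideanSpace ℝ (Fin 1)) B]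

/-- The Taylor series of the metrics `g₁`, `g₂` and of the potentials `q₁`, `q₂` at the boundary
agree in boundary normal coordinates that are associated to the same coordinate of the common
boundary. -/
def CoefficientsAgree (g₁ : Metric M₁) (q₁ : C^∞⟮𝓡∂ 2, M₁; ℝ⟯) (ι₁ : B → M₁)
    (g₂ : Metric M₂) (q₂ : C^∞⟮𝓡∂ 2, M₂; ℝ⟯) (ι₂ : B → M₂) : Prop :=
  ∀ (χ : OpenPartialHomeomorph B (EuclideanSpace ℝ (Fin 1)))
    (φ₁ : OpenPartialHomeomorph M₁ (EuclideanHalfSpace 2))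
    (φ₂ : OpenPartialHomeomorph M₂ (EuclideanHalfSpace 2)),
    IsBoundaryNormalChart g₁ ι₁ χ φ₁ → IsBoundaryNormalChart g₂ ι₂ χ φ₂ →
    ∀ b ∈ χ.source,
      (∀ i j, SameTaylorSeriesAt (fun y ↦ metricCoeff g₁ φ₁ y i j)
        (fun y ↦ metricCoeff g₂ φ₂ y i j) !₂[0, χ b 0]) ∧
      SameTaylorSeriesAt (localRep φ₁ q₁) (localRep φ₂ q₂) !₂[0, χ b 0]

/-- The coordinate representation of a map between surfaces. -/
def mapInCharts (φ₁ : OpenPartialHomeomorph M₁ (EuclideanHalfSpace 2))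
    (φ₂ : OpenPartialHomeomorph M₂ (EuclideanHalfSpace 2)) (F : M₁ → M₂) : Plane → Plane :=
  φ₂.extend (𝓡∂ 2) ∘ F ∘ (φ₁.extend (𝓡∂ 2)).symm

/-- `F` is the identity on the common boundary and is the identity to infinite order there in
boundary normal coordinates: the Taylor series of its coordinate representation at a boundary point
is that of the identity, and `F y = y + O((y 0)^N)` near that point for every `N`. -/
def IsIdToInfiniteOrder (g₁ : Metric M₁) (ι₁ : B → M₁) (g₂ : Metric M₂) (ι₂ : B → M₂)
    (F : M₁ → M₂) : Prop :=
  (∀ b, F (ι₁ b) = ι₂ b) ∧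
  ∀ (χ : OpenPartialHomeomorph B (EuclideanSpace ℝ (Fin 1)))
    (φ₁ : OpenPartialHomeomorph M₁ (EuclideanHalfSpace 2))
    (φ₂ : OpenPartialHomeomorph M₂ (EuclideanHalfSpace 2)),
    IsBoundaryNormalChart g₁ ι₁ χ φ₁ → IsBoundaryNormalChart g₂ ι₂ χ φ₂ →
    ∀ b ∈ χ.source,
      SameTaylorSeriesAt (mapInCharts φ₁ φ₂ F) id !₂[0, χ b 0] ∧
      ∀ N : ℕ, (fun y ↦ mapInCharts φ₁ φ₂ F y - y)
        =O[𝓝[halfPlane] !₂[0, χ b 0]] fun y ↦ (y 0) ^ N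

end TwoSurfaces

end SurfaceBVP

end

/-! `F` fixes the boundary because solutions are far more rigid inside a surface than on its
boundary. Suppose `F` sent a boundary point to an interior point of the second surface. Since u₂ ∘ F
= u₁ has arbitrary boundary values, every smooth function on the curve would be the pullback of a
solution u₂ along `F ∘ ι₁`. Interior estimates (`SolvesSystem.interior_estimate`: Bernstein's
method, iterated by differentiating the system) bound the m-th derivative of such a pullback at the
given point by Kₘ sup |u₂|, where Kₘ does not depend on the solution. But some smooth function has
derivatives that exceed Kₘ S for some m, whatever S is (`exists_contDiff_lt_norm_iteratedFDeriv`).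
So the boundary goes to the boundary, and boundary values that separate points identify the image
point (`apply_boundary_of_morphism`).

In boundary normal coordinates the metric is dy₀² + h dy₁² and the equation can be solved for ∂₀²u.
Equal Cauchy data and equal Taylor series of the coefficients therefore make u₁ and u₂ agree to
infinite order at the boundary (`agree_of_normalFormEq`), and u₁ = u₂ ∘ F says that u₂ ∘ F and u₂
agree there to infinite order, for every choice of boundary values.

Now let F = id + r, where r vanishes to order k ≥ 2, and let s = ∂₀ᵏ r. By linearization r · ∇u₂
vanishes to order k + 2, which gives on the boundary s · ∇u₂ = 0 and ∂₀s · ∇u₂ + (k + 1) s · ∂₀∇u₂ =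
0. Only the boundary values of u₂ can be chosen; ∂₀u₂ cannot. Choose them with value 0, slope 0 and
second derivative 1 at a point. If s₀ ≠ 0 there, the first relation forces ∇u₂ = 0, its tangential
derivative gives s₁ = -s₀ ∂₀∂₁u₂, and the second relation gives ∂₀²u₂ = (∂₀∂₁u₂)² ≥ 0. The equation,
however, says h ∂₀²u₂ = -1 with h > 0. Hence s₀ = 0, and boundary values of slope 1 give s₁ = 0
(`agree_succ_of_solutionPairs`). The first derivatives of F require a nonlinear version of this
argument, in which ∂₀F₀ ≥ 0 excludes a reflection (`agree_two_of_solutionPairs`). -/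

namespace SurfaceBVP

/-! ### Partial derivatives in the plane and the maximum principle -/

/-- The two-sided partial derivative of a function on the plane. -/
noncomputable def pd (i : Fin 2) (f : Plane → ℝ) (y : Plane) : ℝ := fderiv ℝ f y (e i)

theorem pd_congr {i : Fin 2} {f g : Plane → ℝ} {y : Plane} (h : f =ᶠ[𝓝 y] g) :
    pd i f y = pd i g y := by
  rw [pd, h.fderiv_eq, pd]

theorem pd_add {i : Fin 2} {f g : Plane → ℝ} {y : Plane} (hf : DifferentiableAt ℝ f y)
    (hg : DifferentiableAt ℝ g y) : pd i (fun z ↦ f z + g z) y = pd i f y + pd i g y := by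
  simp [pd, fderiv_fun_add hf hg]

theorem pd_sum {κ : Type*} {u : Finset κ} {i : Fin 2} {f : κ → Plane → ℝ} {y : Plane}
    (hf : ∀ s ∈ u, DifferentiableAt ℝ (f s) y) :
    pd i (fun z ↦ ∑ s ∈ u, f s z) y = ∑ s ∈ u, pd i (f s) y := by
  simp [pd, fderiv_fun_sum hf]

theorem pd_mul {i : Fin 2} {f g : Plane → ℝ} {y : Plane} (hf : DifferentiableAt ℝ f y)
    (hg : DifferentiableAt ℝ g y) :
    pd i (fun z ↦ f z * g z) y = f y * pd i g y + g y * pd i f y := by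
  simp [pd, fderiv_fun_mul hf hg]

theorem pd_const_mul {i : Fin 2} {f : Plane → ℝ} {y : Plane} (c : ℝ)
    (hf : DifferentiableAt ℝ f y) : pd i (fun z ↦ c * f z) y = c * pd i f y := by
  simp [pd, fderiv_const_mul hf]

theorem contDiffAt_pd {i : Fin 2} {f : Plane → ℝ} {y : Plane} {m n : WithTop ℕ∞}
    (hf : ContDiffAt ℝ n f y) (hmn : m + 1 ≤ n) : ContDiffAt ℝ m (pd i f) y := by
  have : ContDiffAt ℝ m (fderiv ℝ f) y := hf.fderiv_right hmn
  exact this.clm_apply contDiffAt_const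

theorem differentiableAt_pd {i : Fin 2} {f : Plane → ℝ} {y : Plane} (hf : ContDiffAt ℝ 2 f y) :
    DifferentiableAt ℝ (pd i f) y :=
  (contDiffAt_pd (m := 1) hf (by norm_num)).differentiableAt (by simp)

theorem contDiffOn_pd {i : Fin 2} {f : Plane → ℝ} {Ω : Set Plane} (hΩ : IsOpen Ω)
    (hf : ContDiffOn ℝ ∞ f Ω) : ContDiffOn ℝ ∞ (pd i f) Ω :=
  fun _ hy ↦ (contDiffAt_pd (hf.contDiffAt (hΩ.mem_nhds hy)) (by simp)).contDiffWithinAt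

theorem pd_comm {i j : Fin 2} {f : Plane → ℝ} {y : Plane} (hf : ContDiffAt ℝ 2 f y) :
    pd i (pd j f) y = pd j (pd i f) y := by
  have hs : IsSymmSndFDerivAt ℝ f y := hf.isSymmSndFDerivAt (by simp)
  have hd : DifferentiableAt ℝ (fderiv ℝ f) y :=
    (hf.fderiv_right (m := 1) (by norm_num)).differentiableAt (by simp)
  have key : ∀ k l : Fin 2, pd k (pd l f) y = fderiv ℝ (fderiv ℝ f) y (e k) (e l) := by
    intro k l
    have : pd l f = fun z ↦ fderiv ℝ f z (e l) := rfl
    rw [pd, this, fderiv_clm_apply hd (differentiableAt_const _)]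
    simp
  rw [key, key, hs.eq]

/-- The principal part `∑ a_ij ∂_i ∂_j` of a second order operator. -/
noncomputable def principal (a : Fin 2 → Fin 2 → Plane → ℝ) (f : Plane → ℝ) (y : Plane) : ℝ :=
  ∑ i, ∑ j, a i j y * pd i (pd j f) y

theorem pd_pd_mul {i j : Fin 2} {f g : Plane → ℝ} {y : Plane} (hf : ContDiffAt ℝ 2 f y)
    (hg : ContDiffAt ℝ 2 g y) :
    pd i (pd j (fun z ↦ f z * g z)) y = f y * pd i (pd j g) y + g y * pd i (pd j f) y +
      pd i f y * pd j g y + pd j f y * pd i g y := by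
  have hev : pd j (fun z ↦ f z * g z) =ᶠ[𝓝 y] fun z ↦ f z * pd j g z + g z * pd j f z := by
    filter_upwards [hf.eventually (by simp), hg.eventually (by simp)] with z h1 h2
    exact pd_mul (h1.differentiableAt (by simp)) (h2.differentiableAt (by simp))
  have df := hf.differentiableAt (by simp)
  have dg := hg.differentiableAt (by simp)
  rw [pd_congr hev, pd_add (df.fun_mul (differentiableAt_pd hg))
      (dg.fun_mul (differentiableAt_pd hf)),
    pd_mul df (differentiableAt_pd hg), pd_mul dg (differentiableAt_pd hf)]
  ring

theorem principal_mul {a : Fin 2 → Fin 2 → Plane → ℝ} {f g : Plane → ℝ} {y : Plane}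
    (ha : a 0 1 y = a 1 0 y) (hf : ContDiffAt ℝ 2 f y) (hg : ContDiffAt ℝ 2 g y) :
    principal a (fun z ↦ f z * g z) y = f y * principal a g y + g y * principal a f y +
      2 * ∑ i, ∑ j, a i j y * (pd i f y * pd j g y) := by
  simp only [principal, pd_pd_mul hf hg, Fin.sum_univ_two, ← ha]
  ring

theorem principal_sum {a : Fin 2 → Fin 2 → Plane → ℝ} {κ : Type*} {u : Finset κ}
    {f : κ → Plane → ℝ} {y : Plane} (hf : ∀ s ∈ u, ContDiffAt ℝ 2 (f s) y) :
    principal a (fun z ↦ ∑ s ∈ u, f s z) y = ∑ s ∈ u, principal a (f s) y := by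
  have key : ∀ i j, pd i (pd j (fun z ↦ ∑ s ∈ u, f s z)) y = ∑ s ∈ u, pd i (pd j (f s)) y := by
    intro i j
    have hev : pd j (fun z ↦ ∑ s ∈ u, f s z) =ᶠ[𝓝 y] fun z ↦ ∑ s ∈ u, pd j (f s) z := by
      have : ∀ᶠ z in 𝓝 y, ∀ s ∈ u, ContDiffAt ℝ 2 (f s) z := by
        rw [Filter.eventually_all_finset]
        exact fun s hs ↦ (hf s hs).eventually (by simp)
      filter_upwards [this] with z hz
      exact pd_sum fun s hs ↦ (hz s hs).differentiableAt (by simp)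
    rw [pd_congr hev, pd_sum fun s hs ↦ differentiableAt_pd (hf s hs)]
  simp only [principal, key, Finset.mul_sum, Fin.sum_univ_two, Finset.sum_add_distrib]

theorem principal_const_mul {a : Fin 2 → Fin 2 → Plane → ℝ} {f : Plane → ℝ} {y : Plane} (c : ℝ)
    (hf : ContDiffAt ℝ 2 f y) : principal a (fun z ↦ c * f z) y = c * principal a f y := by
  have key : ∀ i j, pd i (pd j (fun z ↦ c * f z)) y = c * pd i (pd j f) y := by
    intro i j
    have hev : pd j (fun z ↦ c * f z) =ᶠ[𝓝 y] fun z ↦ c * pd j f z := by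
      filter_upwards [hf.eventually (by simp)] with z hz
      exact pd_const_mul c (hz.differentiableAt (by simp))
    rw [pd_congr hev, pd_const_mul c (differentiableAt_pd hf)]
  simp only [principal, key, Finset.mul_sum]
  exact Finset.sum_congr rfl fun i _ ↦ Finset.sum_congr rfl fun j _ ↦ by ring

theorem principal_add {a : Fin 2 → Fin 2 → Plane → ℝ} {f g : Plane → ℝ} {y : Plane}
    (hf : ContDiffAt ℝ 2 f y) (hg : ContDiffAt ℝ 2 g y) :
    principal a (fun z ↦ f z + g z) y = principal a f y + principal a g y := by
  have key : ∀ i j, pd i (pd j (fun z ↦ f z + g z)) y = pd i (pd j f) y + pd i (pd j g) y := by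
    intro i j
    have hev : pd j (fun z ↦ f z + g z) =ᶠ[𝓝 y] fun z ↦ pd j f z + pd j g z := by
      filter_upwards [hf.eventually (by simp), hg.eventually (by simp)] with z hz hz'
      exact pd_add (hz.differentiableAt (by simp)) (hz'.differentiableAt (by simp))
    rw [pd_congr hev, pd_add (differentiableAt_pd hf)
      (differentiableAt_pd hg)]
  simp only [principal, key, mul_add, Finset.sum_add_distrib]

/-- The second derivative test on the line. -/
theorem deriv_deriv_nonpos_of_isLocalMax {φ : ℝ → ℝ} {t : ℝ} (hφ : ContDiffAt ℝ 2 φ t)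
    (h : IsLocalMax φ t) : deriv (deriv φ) t ≤ 0 := by
  by_contra! hpos
  -- With a positive second derivative t would be a local minimum as well as a local maximum, so φ
  -- would be locally constant.
  have hmin : IsLocalMin φ t :=
    isLocalMin_of_deriv_deriv_pos hpos h.deriv_eq_zero hφ.continuousAt
  have hc : φ =ᶠ[𝓝 t] fun _ ↦ φ t := by
    filter_upwards [h, hmin] with z h1 h2 using le_antisymm h1 h2
  have h1 : deriv φ =ᶠ[𝓝 t] deriv (fun _ ↦ φ t) := hc.deriv
  rw [h1.deriv_eq] at hpos
  simp at hpos

theorem fderiv_apply_eq_sum_pd (f : Plane → ℝ) (y v : Plane) :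
    fderiv ℝ f y v = v 0 * pd 0 f y + v 1 * pd 1 f y := by
  have : v = v 0 • e 0 + v 1 • e 1 := by
    ext i; fin_cases i <;> simp
  conv_lhs => rw [this]
  simp [pd]

/-- The second derivative test in the plane. -/
theorem hessian_nonpos_of_isLocalMax {Φ : Plane → ℝ} {y : Plane} (hΦ : ContDiffAt ℝ 2 Φ y)
    (h : IsLocalMax Φ y) (c d : ℝ) :
    c * (c * pd 0 (pd 0 Φ) y + d * pd 0 (pd 1 Φ) y) +
      d * (c * pd 1 (pd 0 Φ) y + d * pd 1 (pd 1 Φ) y) ≤ 0 := by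
  set v : Plane := c • e 0 + d • e 1 with hv
  have v0 : v 0 = c := by simp [hv]
  have v1 : v 1 = d := by simp [hv]
  set l : ℝ → Plane := fun t ↦ y + t • v with hl
  have hl0 : l 0 = y := by simp [hl]
  have hlc : Continuous l := by fun_prop
  have hld : ∀ t, HasDerivAt l v t := fun t ↦ by
    have := ((hasDerivAt_id t).smul_const v).const_add y
    rwa [one_smul] at this
  have hlsm : ContDiff ℝ 2 l := by fun_prop
  have hcomp : ∀ {f : Plane → ℝ} {t}, DifferentiableAt ℝ f (l t) →
      deriv (f ∘ l) t = fderiv ℝ f (l t) v := fun hf ↦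
    ((hf.hasFDerivAt).comp_hasDerivAt _ (hld _)).deriv
  have hmax : IsLocalMax (Φ ∘ l) 0 := by
    have : Tendsto l (𝓝 0) (𝓝 y) := by simpa [hl0] using hlc.tendsto 0
    have h' : ∀ᶠ z in 𝓝 y, Φ z ≤ Φ y := h
    have := this.eventually h'
    simpa [IsLocalMax, IsMaxFilter, hl0] using this
  have hsm : ContDiffAt ℝ 2 (Φ ∘ l) 0 := by
    refine ContDiffAt.comp 0 ?_ hlsm.contDiffAt
    rwa [hl0]
  have h2 := deriv_deriv_nonpos_of_isLocalMax hsm hmax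
  have hev : deriv (Φ ∘ l) =ᶠ[𝓝 0] (fun z ↦ c * pd 0 Φ z + d * pd 1 Φ z) ∘ l := by
    have : ∀ᶠ t in 𝓝 (0:ℝ), ContDiffAt ℝ 2 Φ (l t) := by
      have ht : Tendsto l (𝓝 0) (𝓝 y) := by simpa [hl0] using hlc.tendsto 0
      exact ht.eventually (hΦ.eventually (by simp))
    filter_upwards [this] with t ht
    rw [hcomp (ht.differentiableAt (by simp)), fderiv_apply_eq_sum_pd, v0, v1]
    rfl
  have dd : ∀ k, DifferentiableAt ℝ (pd k Φ) y := fun k ↦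
    differentiableAt_pd hΦ
  have dd' : ∀ k (c : ℝ), DifferentiableAt ℝ (fun z ↦ c * pd k Φ z) y := fun k c ↦
    (dd k).const_mul c
  rw [hev.deriv_eq, hcomp (by rw [hl0]; exact (dd' 0 c).add (dd' 1 d)), hl0,
    fderiv_apply_eq_sum_pd, v0, v1, pd_add (dd' _ _) (dd' _ _), pd_add (dd' _ _) (dd' _ _),
    pd_const_mul _ (dd _), pd_const_mul _ (dd _), pd_const_mul _ (dd _),
    pd_const_mul _ (dd _)] at h2
  exact h2

/-- A maximum principle: an elliptic operator without lower order terms is nonpositive at a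
maximum. -/
theorem principal_nonpos_of_isLocalMax {a : Fin 2 → Fin 2 → Plane → ℝ} {Φ : Plane → ℝ} {y : Plane}
    (hsymm : a 0 1 y = a 1 0 y) (hpos : 0 < a 0 0 y)
    (hdet : 0 < a 0 0 y * a 1 1 y - a 0 1 y * a 0 1 y)
    (hΦ : ContDiffAt ℝ 2 Φ y) (h : IsLocalMax Φ y) : principal a Φ y ≤ 0 := by
  have h1 := hessian_nonpos_of_isLocalMax hΦ h (a 0 0 y) (a 0 1 y)
  have h2 := hessian_nonpos_of_isLocalMax hΦ h 0 1
  simp only [principal, Fin.sum_univ_two, ← hsymm]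
  refine nonpos_of_mul_nonpos_right ?_ hpos
  -- Completing the square: a₀₀ tr(aH) is the Hessian form at the vector (a₀₀, a₀₁) plus det a times
  -- ∂₁∂₁Φ.
  nlinarith [mul_nonneg hdet.le (neg_nonneg.2 h2)]

/-- Cayley–Hamilton for the symmetric matrix A with entries a, b, b, d gives tr A · ⟨Aξ, ξ⟩ = |Aξ|²
+ det A · |ξ|², so det A / tr A is a lower bound of the quadratic form. Unlike the lowest eigenvalue
it is a rational function of the entries. -/
theorem ellipticity {a b d ξ₀ ξ₁ θ : ℝ} (ha : 0 < a) (hdet : 0 < a * d - b * b)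
    (hθ : θ * (a + d) ≤ a * d - b * b) :
    θ * (ξ₀ ^ 2 + ξ₁ ^ 2) ≤ a * (ξ₀ * ξ₀) + b * (ξ₀ * ξ₁) + (b * (ξ₁ * ξ₀) + d * (ξ₁ * ξ₁)) := by
  have hd : 0 < d := by
    by_contra! hd
    nlinarith [mul_nonneg ha.le (neg_nonneg.2 hd), mul_self_nonneg b]
  have ht : 0 < a + d := by linarith
  refine le_of_mul_le_mul_left ?_ ht
  nlinarith [sq_nonneg (a * ξ₀ + b * ξ₁), sq_nonneg (b * ξ₀ + d * ξ₁),
    mul_le_mul_of_nonneg_right hθ (add_nonneg (sq_nonneg ξ₀) (sq_nonneg ξ₁))]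


/-! ### Bernstein's gradient estimate -/

/-- A polynomial cut-off function, positive inside the ball of radius `ρ` about `p`. -/
noncomputable def ballCutoff (p : Plane) (ρ : ℝ) (y : Plane) : ℝ :=
  ρ ^ 2 - ((y 0 - p 0) ^ 2 + (y 1 - p 1) ^ 2)

theorem contDiff_coord (i : Fin 2) : ContDiff ℝ ∞ fun y : Plane ↦ y i :=
  (EuclideanSpace.proj (𝕜 := ℝ) i).contDiff

theorem contDiff_ballCutoff (p : Plane) (ρ : ℝ) : ContDiff ℝ ∞ (ballCutoff p ρ) :=
  contDiff_const.sub ((((contDiff_coord 0).sub contDiff_const).pow 2).add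
    (((contDiff_coord 1).sub contDiff_const).pow 2))

theorem ballCutoff_eq (p : Plane) (ρ : ℝ) (y : Plane) :
    ballCutoff p ρ y = ρ ^ 2 - dist y p ^ 2 := by
  rw [ballCutoff, EuclideanSpace.dist_eq, Real.sq_sqrt (by positivity)]
  simp [Real.dist_eq]

theorem pd_ballCutoff (p : Plane) (ρ : ℝ) (k : Fin 2) :
    pd k (ballCutoff p ρ) = fun y ↦ -2 * (y k - p k) := by
  funext y
  have hc : ∀ i : Fin 2, HasFDerivAt (fun y : Plane ↦ y i) (EuclideanSpace.proj (𝕜 := ℝ) i) y :=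
    fun i ↦ (EuclideanSpace.proj (𝕜 := ℝ) i).hasFDerivAt
  have h := ((((hc 0).sub_const (p 0)).pow 2).add (((hc 1).sub_const (p 1)).pow 2)).const_sub
    (ρ ^ 2)
  have h' : fderiv ℝ (ballCutoff p ρ) y = _ := h.fderiv
  rw [pd, h']
  fin_cases k <;> simp

theorem pd_pd_ballCutoff (p : Plane) (ρ : ℝ) (j k : Fin 2) (y : Plane) :
    pd j (pd k (ballCutoff p ρ)) y = if j = k then -2 else 0 := by
  have hc : HasFDerivAt (fun y : Plane ↦ y k) (EuclideanSpace.proj (𝕜 := ℝ) k) y :=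
    (EuclideanSpace.proj (𝕜 := ℝ) k).hasFDerivAt
  have h : fderiv ℝ (fun y : Plane ↦ -2 * (y k - p k)) y = _ :=
    ((hc.sub_const (p k)).const_mul (-2 : ℝ)).fderiv
  rw [pd_ballCutoff, pd, h]
  fin_cases k <;> fin_cases j <;> simp

/-- The pointwise inequality behind Bernstein's estimate of the gradient of solutions. -/
theorem bernstein_pointwise {a b d θ ε M η η₀ η₁ w w₀ w₁ Lw : ℝ} (hε : 0 < ε) (hθ : 0 < θ)
    (ha : |a| ≤ M) (hb : |b| ≤ M) (hd : |d| ≤ M)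
    (hell : ∀ ξ₀ ξ₁ : ℝ, θ * (ξ₀ ^ 2 + ξ₁ ^ 2) ≤
      a * (ξ₀ * ξ₀) + b * (ξ₀ * ξ₁) + (b * (ξ₁ * ξ₀) + d * (ξ₁ * ξ₁)))
    (hη : 0 ≤ η) (hη' : η ≤ M) (h₀ : |η₀| ≤ M) (h₁ : |η₁| ≤ M) :
    (θ - ε) * (η ^ 2 * (w₀ ^ 2 + w₁ ^ 2)) - ε * (η ^ 2 * Lw ^ 2) -
        (4 * θ * M ^ 2 + 32 * M ^ 4 / ε + 8 * M ^ 2 + M ^ 2 / ε) * w ^ 2 ≤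
      2 * (η * w) * (η * Lw + w * (a * -2 + d * -2) +
          2 * (a * (η₀ * w₀) + b * (η₀ * w₁) + (b * (η₁ * w₀) + d * (η₁ * w₁)))) +
        2 * (a * ((η * w₀ + w * η₀) * (η * w₀ + w * η₀)) +
          b * ((η * w₀ + w * η₀) * (η * w₁ + w * η₁)) +
          (b * ((η * w₁ + w * η₁) * (η * w₀ + w * η₀)) +
          d * ((η * w₁ + w * η₁) * (η * w₁ + w * η₁)))) := by
  have hM : 0 ≤ M := (abs_nonneg a).trans ha
  -- Young's inequality with weight ε: a factor containing ∇w or Lw is kept with a small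
  -- coefficient, at the price of a large multiple of w².
  have young : ∀ x y c : ℝ, |x| ≤ c → -(c ^ 2 / ε) - ε * y ^ 2 ≤ 2 * x * y := by
    intro x y c hx
    have h1 : x ^ 2 ≤ c ^ 2 := sq_le_sq' (by linarith [neg_le_of_abs_le hx]) (le_of_abs_le hx)
    have h2 : 0 ≤ (x + ε * y) ^ 2 / ε := by positivity
    have h3 : (x + ε * y) ^ 2 / ε = x ^ 2 / ε + 2 * x * y + ε * y ^ 2 := by field_simp; ring
    have h4 : x ^ 2 / ε ≤ c ^ 2 / ε := by gcongr
    linarith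
  have e1 := hell (η * w₀ + w * η₀) (η * w₁ + w * η₁)
  have sqb : ∀ x, |x| ≤ M → x ^ 2 ≤ M ^ 2 := fun x hx ↦
    sq_le_sq' (by linarith [neg_le_of_abs_le hx]) (le_of_abs_le hx)
  -- Half of η²|∇w|² survives in |∇(ηw)|²; the factor 2 in front of the quadratic form brings the
  -- coefficient back to θ.
  have half : ∀ u z, |z| ≤ M → η ^ 2 * u ^ 2 / 2 - w ^ 2 * M ^ 2 ≤ (η * u + w * z) ^ 2 := by
    intro u z hz
    nlinarith [sq_nonneg (η * u + 2 * (w * z)), mul_le_mul_of_nonneg_left (sqb z hz) (sq_nonneg w)]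
  have e2 : θ * (η ^ 2 * (w₀ ^ 2 + w₁ ^ 2) / 2 - 2 * (w ^ 2 * M ^ 2)) ≤
      θ * ((η * w₀ + w * η₀) ^ 2 + (η * w₁ + w * η₁) ^ 2) :=
    mul_le_mul_of_nonneg_left (by linarith [half w₀ η₀ h₀, half w₁ η₁ h₁]) hθ.le
  have bdM : ∀ x y, |x| ≤ M → |y| ≤ M → |x * y| ≤ M ^ 2 := by
    intro x y hx hy
    rw [abs_mul, sq]
    exact mul_le_mul hx hy (abs_nonneg _) hM
  -- Applied once for each derivative of w. Together the two uses cost ε η²|∇w|², the loss from θ to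
  -- θ - ε, and 2 · 16 M⁴/ε times w².
  have cross : ∀ x y z t u, |x| ≤ M → |y| ≤ M → |z| ≤ M → |t| ≤ M →
      -(16 * M ^ 4 / ε * w ^ 2) - ε * (η * u) ^ 2 ≤ 2 * (2 * w * (x * y + z * t)) * (η * u) := by
    intro x y z t u hx hy hz ht
    have := young (2 * w * (x * y + z * t)) (η * u) (4 * M ^ 2 * |w|) (by
      rw [abs_mul, abs_mul, abs_two]
      have h1 : |x * y + z * t| ≤ 2 * M ^ 2 :=
        (abs_add_le _ _).trans (by linarith [bdM x y hx hy, bdM z t hz ht])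
      nlinarith [mul_le_mul_of_nonneg_left h1 (abs_nonneg w)])
    have h2 : (4 * M ^ 2 * |w|) ^ 2 / ε = 16 * M ^ 4 / ε * w ^ 2 := by
      rw [mul_pow, sq_abs]; ring
    linarith
  have c0 := cross a η₀ b η₁ w₀ ha h₀ hb h₁
  have c1 := cross b η₀ d η₁ w₁ hb h₀ hd h₁
  have l0 := young (η * w) (η * Lw) (M * |w|) (by
    rw [abs_mul, abs_of_nonneg hη]
    exact mul_le_mul_of_nonneg_right hη' (abs_nonneg _))
  have l1 : (M * |w|) ^ 2 / ε = M ^ 2 / ε * w ^ 2 := by rw [mul_pow, sq_abs]; ring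
  have m0 : -(8 * M ^ 2) * w ^ 2 ≤ 2 * (η * w) * (w * (a * -2 + d * -2)) := by
    have k1 : η * (a + d) ≤ M * (2 * M) :=
      (mul_le_mul_of_nonneg_left (by linarith [le_of_abs_le ha, le_of_abs_le hd]) hη).trans
        (mul_le_mul_of_nonneg_right hη' (by linarith))
    nlinarith [mul_le_mul_of_nonneg_right k1 (sq_nonneg w)]
  rw [l1] at l0
  have f1 : 32 * M ^ 4 / ε = 2 * (16 * M ^ 4 / ε) := by ring
  rw [f1]
  linarith

/-- Expands L((ηw)²) by the product rule. As η is an explicit polynomial, Lη = -2 tr a, and ρ² ≤ M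
and 2ρ ≤ M bound η and its first derivatives on the ball. -/
theorem principal_cutoff_sq_ge {a : Fin 2 → Fin 2 → Plane → ℝ} {p y : Plane} {ρ θ ε M : ℝ}
    {w : Plane → ℝ} (hε : 0 < ε) (hθ : 0 < θ) (ha : ∀ i j, |a i j y| ≤ M)
    (hsymm : a 0 1 y = a 1 0 y)
    (hell : ∀ ξ₀ ξ₁ : ℝ, θ * (ξ₀ ^ 2 + ξ₁ ^ 2) ≤ a 0 0 y * (ξ₀ * ξ₀) + a 0 1 y * (ξ₀ * ξ₁) +
      (a 0 1 y * (ξ₁ * ξ₀) + a 1 1 y * (ξ₁ * ξ₁)))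
    (hρ : 0 ≤ ρ) (hM : ρ ^ 2 ≤ M) (hM' : 2 * ρ ≤ M) (hy : y ∈ Metric.closedBall p ρ)
    (hw : ContDiffAt ℝ ∞ w y) :
    (θ - ε) * (ballCutoff p ρ y ^ 2 * (∑ l, pd l w y ^ 2)) -
        ε * (ballCutoff p ρ y ^ 2 * principal a w y ^ 2) -
        (4 * θ * M ^ 2 + 32 * M ^ 4 / ε + 8 * M ^ 2 + M ^ 2 / ε) * w y ^ 2 ≤
      principal a (fun z ↦ (ballCutoff p ρ z * w z) * (ballCutoff p ρ z * w z)) y := by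
  have hw2 : ContDiffAt ℝ 2 w y := hw.of_le (by norm_cast)
  have hη2 : ContDiffAt ℝ 2 (ballCutoff p ρ) y :=
    (contDiff_ballCutoff p ρ).contDiffAt.of_le (by norm_cast)
  have hz2 : ContDiffAt ℝ 2 (fun z ↦ ballCutoff p ρ z * w z) y := hη2.mul hw2
  have hpd : ∀ i, pd i (fun z ↦ ballCutoff p ρ z * w z) y =
      ballCutoff p ρ y * pd i w y + w y * pd i (ballCutoff p ρ) y := fun i ↦
    pd_mul (hη2.differentiableAt (by simp)) (hw2.differentiableAt (by simp))
  have hLη : principal a (ballCutoff p ρ) y = a 0 0 y * -2 + a 1 1 y * -2 := by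
    simp [principal, pd_pd_ballCutoff]
    ring
  have hdist : dist y p ≤ ρ := hy
  have hη0 : 0 ≤ ballCutoff p ρ y := by
    rw [ballCutoff_eq]
    nlinarith [dist_nonneg (x := y) (y := p)]
  have hη1 : ballCutoff p ρ y ≤ M := by
    rw [ballCutoff_eq]
    nlinarith [dist_nonneg (x := y) (y := p)]
  have hη' : ∀ k, |pd k (ballCutoff p ρ) y| ≤ M := by
    intro k
    rw [pd_ballCutoff, abs_mul]
    have h1 : |y k - p k| ≤ dist y p := by
      rw [EuclideanSpace.dist_eq]
      refine Real.abs_le_sqrt ?_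
      rw [← sq_abs, ← Real.dist_eq]
      exact Finset.single_le_sum (f := fun i ↦ dist (y i) (p i) ^ 2)
        (fun i _ ↦ sq_nonneg _) (Finset.mem_univ k)
    norm_num
    linarith
  have key := bernstein_pointwise (w := w y) (w₀ := pd 0 w y) (w₁ := pd 1 w y)
    (Lw := principal a w y) hε hθ (ha 0 0) (ha 0 1) (ha 1 1) hell hη0 hη1 (hη' 0) (hη' 1)
  rw [principal_mul hsymm hz2 hz2, principal_mul hsymm hη2 hw2, hLη]
  simp only [hpd, Fin.sum_univ_two, ← hsymm]
  linarith

/-- The balance of terms at an interior maximum, where Nᵢ is the squared size of the i-th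
derivatives, H = η², and X, Y are the contributions of η²|∇v|² and |v|². The choice ε(K + 1) = θ
makes (θ - ε) H N₂ absorb exactly the second derivatives hidden in ε H P₂. Then A is so large that A
θ N₁ outweighs the remaining first derivatives, with one N₁ to spare. -/
theorem bernstein_absorb {ε K θ D A M H N₀ N₁ N₂ P₁ P₂ X Y : ℝ} (hε : 0 < ε) (hK : 0 ≤ K)
    (hD : 0 ≤ D) (hA : 0 < A) (hεK : ε * (K + 1) = θ) (hN₁ : 0 ≤ N₁) (hN₀ : 0 ≤ N₀) (hH : 0 ≤ H)
    (hHM : H ≤ M ^ 2) (hAθ : A * θ = ε * K * M ^ 2 + D + 1) (hP₁ : P₁ ≤ K * (N₁ + N₀))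
    (hP₂ : P₂ ≤ K * (N₂ + N₁ + N₀)) (hX : (θ - ε) * (H * N₂) - ε * (H * P₂) - D * N₁ ≤ X)
    (hY : 2 * θ * N₁ - ε * P₁ - 1 / ε * N₀ ≤ Y) (hXY : X + A * Y ≤ 0) :
    N₁ ≤ (ε * K * M ^ 2 + D + A * (ε * K + 1 / ε)) * N₀ := by
  have q1 : ε * (H * P₂) ≤ ε * (H * (K * (N₂ + N₁ + N₀))) := by gcongr
  have q2 : ε * P₁ ≤ ε * (K * (N₁ + N₀)) := by gcongr
  have q3 : ε * K * (H * (N₁ + N₀)) ≤ ε * K * (M ^ 2 * (N₁ + N₀)) := by gcongr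
  have q4 : (θ - ε) * (H * N₂) = ε * K * (H * N₂) := by
    rw [← hεK]; ring
  have b3 : -((ε * K * M ^ 2 + D) * N₁) - (ε * K * M ^ 2 + D) * N₀ ≤ X := by
    have : 0 ≤ D * N₀ := by positivity
    linarith
  have b4 : θ * N₁ - (ε * K + 1 / ε) * N₀ ≤ Y := by
    have : ε * K * N₁ ≤ θ * N₁ := by
      rw [← hεK]
      nlinarith [mul_nonneg hε.le hN₁]
    linarith
  have b5 := mul_le_mul_of_nonneg_left b4 hA.le
  have b6 : A * (θ * N₁ - (ε * K + 1 / ε) * N₀) =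
      (ε * K * M ^ 2 + D + 1) * N₁ - A * (ε * K + 1 / ε) * N₀ := by rw [← hAθ]; ring
  linarith

set_option maxHeartbeats 600000 in
/-- **Bernstein's gradient estimate** for families of functions that satisfy elliptic differential
inequalities together with their first derivatives. -/
theorem gradient_estimate {ι : Type*} [Fintype ι] {p : Plane} {r ρ θ M K : ℝ} (hr : 0 ≤ r)
    (hrρ : r < ρ) (hθ : 0 < θ) (hK : 0 ≤ K) (hM : ρ ^ 2 ≤ M) (hM' : 2 * ρ ≤ M) :
    ∃ C, 0 ≤ C ∧ ∀ (a : Fin 2 → Fin 2 → Plane → ℝ) (v : ι → Plane → ℝ) (S : ℝ),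
      (∀ y ∈ Metric.closedBall p ρ, (∀ i j, |a i j y| ≤ M) ∧ a 0 1 y = a 1 0 y ∧ 0 < a 0 0 y ∧
        0 < a 0 0 y * a 1 1 y - a 0 1 y * a 0 1 y ∧
        θ * (a 0 0 y + a 1 1 y) ≤ a 0 0 y * a 1 1 y - a 0 1 y * a 0 1 y) →
      (∀ s, ∀ y ∈ Metric.closedBall p ρ, ContDiffAt ℝ ∞ (v s) y) →
      (∀ y ∈ Metric.closedBall p ρ, ∑ s, principal a (v s) y ^ 2 ≤
        K * (∑ s, ∑ k, pd k (v s) y ^ 2 + ∑ s, v s y ^ 2)) →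
      (∀ y ∈ Metric.closedBall p ρ, ∑ s, ∑ k, principal a (pd k (v s)) y ^ 2 ≤
        K * (∑ s, ∑ k, ∑ l, pd l (pd k (v s)) y ^ 2 +
          ∑ s, ∑ k, pd k (v s) y ^ 2 + ∑ s, v s y ^ 2)) →
      (∀ y ∈ Metric.closedBall p ρ, ∑ s, v s y ^ 2 ≤ S) →
      ∀ y ∈ Metric.closedBall p r, ∑ s, ∑ k, pd k (v s) y ^ 2 ≤ C * S := by
  have hρ : 0 < ρ := hr.trans_lt hrρ
  set ε : ℝ := θ / (K + 1) with hε
  have hε0 : 0 < ε := by positivity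
  have hεK : ε * (K + 1) = θ := by rw [hε]; field_simp
  set D : ℝ := 4 * θ * M ^ 2 + 32 * M ^ 4 / ε + 8 * M ^ 2 + M ^ 2 / ε with hD
  have hD0 : 0 ≤ D := by positivity
  set C₁ : ℝ := ε * K * M ^ 2 + D with hC₁
  have hC₁0 : 0 ≤ C₁ := by positivity
  set A : ℝ := (C₁ + 1) / θ with hA
  have hA0 : 0 < A := by positivity
  have hAθ : A * θ = C₁ + 1 := by rw [hA]; field_simp
  set C₂ : ℝ := ε * K + 1 / ε with hC₂
  have hC₂0 : 0 ≤ C₂ := by positivity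
  set C₃ : ℝ := C₁ + A * C₂ with hC₃
  have hC₃0 : 0 ≤ C₃ := by positivity
  -- The numerator bounds the maximum of Φ relative to S; the denominator comes from η ≥ ρ² - r² on
  -- the smaller ball.
  refine ⟨(M ^ 2 * C₃ + A) / (ρ ^ 2 - r ^ 2) ^ 2, by positivity, ?_⟩
  intro a v S ha hv h1 h2 hS y hy
  set η := ballCutoff p ρ with hη
  -- Bernstein's auxiliary function η²|∇v|² + A|v|². At a maximum in the open ball the maximum
  -- principle bounds |∇v|² by |v|²; on the bounding sphere η = 0 and only A|v|² is left.
  set Φ : Plane → ℝ := fun z ↦ ∑ s, ∑ k, (η z * pd k (v s) z) * (η z * pd k (v s) z) +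
    A * ∑ s, v s z * v s z with hΦ
  have hΦval : ∀ z, Φ z = η z ^ 2 * (∑ s, ∑ k, pd k (v s) z ^ 2) + A * ∑ s, v s z ^ 2 := by
    intro z
    simp only [hΦ, Finset.mul_sum]
    congr 1
    · exact Finset.sum_congr rfl fun s _ ↦ Finset.sum_congr rfl fun k _ ↦ by ring
    · exact Finset.sum_congr rfl fun s _ ↦ by ring
  have hηs : ∀ z, ContDiffAt ℝ ∞ η z := fun z ↦ (contDiff_ballCutoff p ρ).contDiffAt
  have hvk : ∀ s k, ∀ z ∈ Metric.closedBall p ρ, ContDiffAt ℝ ∞ (pd k (v s)) z :=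
    fun s k z hz ↦ contDiffAt_pd (hv s z hz) (by simp)
  have hz1 : ∀ s k, ∀ z ∈ Metric.closedBall p ρ,
      ContDiffAt ℝ ∞ (fun z ↦ (η z * pd k (v s) z) * (η z * pd k (v s) z)) z :=
    fun s k z hz ↦ ((hηs z).mul (hvk s k z hz)).mul ((hηs z).mul (hvk s k z hz))
  have hz2 : ∀ s, ∀ z ∈ Metric.closedBall p ρ, ContDiffAt ℝ ∞ (fun z ↦ v s z * v s z) z :=
    fun s z hz ↦ (hv s z hz).mul (hv s z hz)
  have hz1' : ∀ s, ∀ z ∈ Metric.closedBall p ρ,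
      ContDiffAt ℝ ∞ (fun z ↦ ∑ k, (η z * pd k (v s) z) * (η z * pd k (v s) z)) z :=
    fun s z hz ↦ ContDiffAt.sum fun k _ ↦ hz1 s k z hz
  have hΦs : ∀ z ∈ Metric.closedBall p ρ, ContDiffAt ℝ ∞ Φ z := fun z hz ↦
    (ContDiffAt.sum fun s _ ↦ hz1' s z hz).add
      (contDiffAt_const.mul (ContDiffAt.sum fun s _ ↦ hz2 s z hz))
  have hS0 : 0 ≤ S := (Finset.sum_nonneg fun s _ ↦ sq_nonneg (v s p)).trans
    (hS p (Metric.mem_closedBall_self hρ.le))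
  obtain ⟨x, hx, hmax⟩ := (isCompact_closedBall p ρ).exists_isMaxOn
    ⟨p, Metric.mem_closedBall_self hρ.le⟩
    (fun z hz ↦ (hΦs z hz).continuousAt.continuousWithinAt : ContinuousOn Φ _)
  have le2 : (2 : WithTop ℕ∞) ≤ ∞ := by norm_cast
  have hηb : ∀ z ∈ Metric.closedBall p ρ, 0 ≤ η z ∧ η z ≤ M := by
    intro z hz
    have hdist : dist z p ≤ ρ := hz
    rw [hη, ballCutoff_eq]
    constructor <;> nlinarith [dist_nonneg (x := z) (y := p)]
  have hΦx : Φ x ≤ (M ^ 2 * C₃ + A) * S := by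
    have hN0 := hS x hx
    set N0 := ∑ s, v s x ^ 2 with hN0d
    set N1 := ∑ s, ∑ k, pd k (v s) x ^ 2 with hN1d
    have hN0n : 0 ≤ N0 := Finset.sum_nonneg fun s _ ↦ sq_nonneg _
    have hN1n : 0 ≤ N1 := Finset.sum_nonneg fun s _ ↦ Finset.sum_nonneg fun s _ ↦ sq_nonneg _
    have hη2 : η x ^ 2 ≤ M ^ 2 := pow_le_pow_left₀ (hηb x hx).1 (hηb x hx).2 2
    rw [hΦval]
    rcases (show dist x p ≤ ρ from hx).lt_or_eq with hlt | heq
    · have hloc : IsLocalMax Φ x :=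
        hmax.isLocalMax (Metric.closedBall_mem_nhds_of_mem (show x ∈ Metric.ball p ρ from hlt))
      obtain ⟨haM, hsymm, hpos, hdet, hel⟩ := ha x hx
      have hell : ∀ ξ₀ ξ₁ : ℝ, _ := fun ξ₀ ξ₁ ↦ ellipticity (ξ₀ := ξ₀) (ξ₁ := ξ₁) hpos hdet hel
      have hL := principal_nonpos_of_isLocalMax hsymm hpos hdet ((hΦs x hx).of_le le2) hloc
      have hLe : principal a Φ x =
          ∑ s, ∑ k, principal a (fun z ↦ (η z * pd k (v s) z) * (η z * pd k (v s) z)) x +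
          A * ∑ s, principal a (fun z ↦ v s z * v s z) x := by
        rw [hΦ, principal_add ((ContDiffAt.sum fun s _ ↦ hz1' s x hx).of_le le2)
          ((contDiffAt_const.mul (ContDiffAt.sum fun s _ ↦ hz2 s x hx)).of_le le2),
          principal_const_mul _ ((ContDiffAt.sum fun s _ ↦ hz2 s x hx).of_le le2),
          principal_sum fun s _ ↦ (hz1' s x hx).of_le le2,
          principal_sum fun s _ ↦ (hz2 s x hx).of_le le2]
        congr 1
        exact Finset.sum_congr rfl fun s _ ↦ principal_sum fun k _ ↦ (hz1 s k x hx).of_le le2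
      have b1 : ∑ s, ∑ k, ((θ - ε) * (η x ^ 2 * (∑ l, pd l (pd k (v s)) x ^ 2)) -
            ε * (η x ^ 2 * principal a (pd k (v s)) x ^ 2) - D * pd k (v s) x ^ 2) ≤
          ∑ s, ∑ k, principal a (fun z ↦ (η z * pd k (v s) z) * (η z * pd k (v s) z)) x :=
        Finset.sum_le_sum fun s _ ↦ Finset.sum_le_sum fun k _ ↦
          principal_cutoff_sq_ge hε0 hθ haM hsymm hell hρ.le hM hM' hx (hvk s k x hx)
      have b2 : ∑ s, (2 * θ * (∑ k, pd k (v s) x ^ 2) - ε * principal a (v s) x ^ 2 -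
            1 / ε * v s x ^ 2) ≤ ∑ s, principal a (fun z ↦ v s z * v s z) x := by
        refine Finset.sum_le_sum fun s _ ↦ ?_
        rw [principal_mul hsymm ((hv s x hx).of_le le2) ((hv s x hx).of_le le2)]
        have e1 := hell (pd 0 (v s) x) (pd 1 (v s) x)
        have e2 : 0 ≤ (ε * principal a (v s) x + v s x) ^ 2 / ε := by positivity
        have e3 : (ε * principal a (v s) x + v s x) ^ 2 / ε = ε * principal a (v s) x ^ 2 +
          2 * (v s x * principal a (v s) x) + 1 / ε * v s x ^ 2 := by
          field_simp
          ring
        simp only [Fin.sum_univ_two, ← hsymm]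
        linarith
      simp only [Finset.sum_sub_distrib, ← Finset.mul_sum] at b1 b2
      have h1x := h1 x hx
      have h2x := h2 x hx
      set N2 := ∑ s, ∑ k, ∑ l, pd l (pd k (v s)) x ^ 2 with hN2d
      have hN1 : N1 ≤ C₃ * N0 :=
        bernstein_absorb hε0 hK hD0 hA0 hεK hN1n hN0n (sq_nonneg _) hη2 hAθ h1x h2x b1 b2
          (hLe.symm.trans_le hL)
      calc η x ^ 2 * N1 + A * N0 ≤ M ^ 2 * (C₃ * N0) + A * N0 := by gcongr
        _ = (M ^ 2 * C₃ + A) * N0 := by ring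
        _ ≤ _ := by gcongr
    · have : η x = 0 := by rw [hη, ballCutoff_eq, heq, sub_self]
      rw [this]
      have : A * N0 ≤ A * S := by gcongr
      have : 0 ≤ M ^ 2 * C₃ * S := by positivity
      linarith
  have hyρ : y ∈ Metric.closedBall p ρ := Metric.closedBall_subset_closedBall hrρ.le hy
  have hΦy : Φ y ≤ (M ^ 2 * C₃ + A) * S := (hmax hyρ).trans hΦx
  rw [hΦval] at hΦy
  have hpos : 0 < ρ ^ 2 - r ^ 2 := by nlinarith
  have hηy : ρ ^ 2 - r ^ 2 ≤ η y := by
    have hdist : dist y p ≤ r := hy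
    rw [hη, ballCutoff_eq]
    nlinarith [dist_nonneg (x := y) (y := p)]
  have hN1n : 0 ≤ ∑ s, ∑ k, pd k (v s) y ^ 2 :=
    Finset.sum_nonneg fun s _ ↦ Finset.sum_nonneg fun s _ ↦ sq_nonneg _
  have hN0n : 0 ≤ A * ∑ s, v s y ^ 2 :=
    mul_nonneg hA0.le (Finset.sum_nonneg fun s _ ↦ sq_nonneg _)
  rw [div_mul_eq_mul_div, le_div_iff₀ (by positivity), mul_comm]
  calc (ρ ^ 2 - r ^ 2) ^ 2 * ∑ s, ∑ k, pd k (v s) y ^ 2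
      ≤ η y ^ 2 * ∑ s, ∑ k, pd k (v s) y ^ 2 :=
        mul_le_mul_of_nonneg_right (pow_le_pow_left₀ hpos.le hηy 2) hN1n
    _ ≤ _ := by linarith


/-! ### Prolongation of elliptic systems and interior estimates -/

/-- A linear second order system with scalar principal part `a`, whose unknowns are the functions
`v s`. -/
def SolvesSystem {ι : Type} [Fintype ι] (Ω : Set Plane) (a : Fin 2 → Fin 2 → Plane → ℝ)
    (b : Fin 2 → ι → ι → Plane → ℝ) (c : ι → ι → Plane → ℝ) (v : ι → Plane → ℝ) : Prop :=
  ∀ s, ∀ y ∈ Ω, principal a (v s) y =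
    ∑ t, (∑ k, b k s t y * pd k (v t) y + c s t y * v t y)

/-- The functions `v s` together with their first derivatives. -/
noncomputable def prolong {ι : Type} (v : ι → Plane → ℝ) : Option (Fin 2) × ι → Plane → ℝ
  | (none, s) => v s
  | (some k, s) => pd k (v s)

/-- First order coefficients of the system that is satisfied by the functions `prolong v`. -/
noncomputable def prolongFirst {ι : Type} [DecidableEq ι] (a : Fin 2 → Fin 2 → Plane → ℝ)
    (b : Fin 2 → ι → ι → Plane → ℝ) (i : Fin 2) :
    Option (Fin 2) × ι → Option (Fin 2) × ι → Plane → ℝ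
  -- The term -∂ₘaᵢⱼ ∂ᵢ∂ⱼv, due to commuting ∂ₘ with the principal part, is of first order in the
  -- unknown ∂ⱼv.
  | (some m, s), (some j, t) => fun y ↦
      (if m = j then b i s t y else 0) - (if s = t then pd m (a i j) y else 0)
  | _, _ => 0

/-- Zeroth order coefficients of the system that is satisfied by the functions `prolong v`. -/
noncomputable def prolongZeroth {ι : Type} (b : Fin 2 → ι → ι → Plane → ℝ)
    (c : ι → ι → Plane → ℝ) : Option (Fin 2) × ι → Option (Fin 2) × ι → Plane → ℝ
  | (none, s), (some k, t) => b k s t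
  | (none, s), (none, t) => c s t
  | (some m, s), (some k, t) => fun y ↦ pd m (b k s t) y + if m = k then c s t y else 0
  | (some m, s), (none, t) => pd m (c s t)

variable {ι : Type} {Ω : Set Plane}

theorem contDiffOn_prolong (hΩ : IsOpen Ω) {v : ι → Plane → ℝ}
    (hv : ∀ s, ContDiffOn ℝ ∞ (v s) Ω) : ∀ s, ContDiffOn ℝ ∞ (prolong v s) Ω
  | (none, s) => hv s
  | (some _, s) => contDiffOn_pd hΩ (hv s)

theorem contDiffOn_prolongFirst [DecidableEq ι] (hΩ : IsOpen Ω) {a : Fin 2 → Fin 2 → Plane → ℝ}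
    {b : Fin 2 → ι → ι → Plane → ℝ} (ha : ∀ i j, ContDiffOn ℝ ∞ (a i j) Ω)
    (hb : ∀ k s t, ContDiffOn ℝ ∞ (b k s t) Ω) (i : Fin 2) :
    ∀ s t, ContDiffOn ℝ ∞ (prolongFirst a b i s t) Ω
  | (some m, s), (some j, t) => by
      unfold prolongFirst
      refine ContDiffOn.sub ?_ ?_
      · split_ifs
        exacts [hb i s t, contDiffOn_const]
      · split_ifs
        exacts [contDiffOn_pd hΩ (ha i j), contDiffOn_const]
  | (none, _), _ => contDiffOn_const
  | (some _, _), (none, _) => contDiffOn_const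

theorem contDiffOn_prolongZeroth (hΩ : IsOpen Ω) {b : Fin 2 → ι → ι → Plane → ℝ}
    {c : ι → ι → Plane → ℝ} (hb : ∀ k s t, ContDiffOn ℝ ∞ (b k s t) Ω)
    (hc : ∀ s t, ContDiffOn ℝ ∞ (c s t) Ω) :
    ∀ s t, ContDiffOn ℝ ∞ (prolongZeroth b c s t) Ω
  | (none, s), (some k, t) => hb k s t
  | (none, s), (none, t) => hc s t
  | (some m, s), (some k, t) => by
      unfold prolongZeroth
      refine ContDiffOn.add (contDiffOn_pd hΩ (hb k s t)) ?_
      split_ifs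
      exacts [hc s t, contDiffOn_const]
  | (some m, s), (none, t) => contDiffOn_pd hΩ (hc s t)

theorem principal_pd (hΩ : IsOpen Ω) {a : Fin 2 → Fin 2 → Plane → ℝ} {f : Plane → ℝ}
    (ha : ∀ i j, ContDiffOn ℝ ∞ (a i j) Ω) (hf : ContDiffOn ℝ ∞ f Ω) (m : Fin 2) {y : Plane}
    (hy : y ∈ Ω) : principal a (pd m f) y =
      pd m (principal a f) y - ∑ i, ∑ j, pd m (a i j) y * pd i (pd j f) y := by
  have hn := hΩ.mem_nhds hy
  have le2 : (2 : WithTop ℕ∞) ≤ ∞ := by norm_cast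
  have d : ∀ {g : Plane → ℝ}, ContDiffOn ℝ ∞ g Ω → DifferentiableAt ℝ g y := fun hg ↦
    (hg.contDiffAt hn).differentiableAt (by simp)
  have hff : ∀ i j, ContDiffOn ℝ ∞ (pd i (pd j f)) Ω := fun i j ↦
    contDiffOn_pd hΩ (contDiffOn_pd hΩ hf)
  have h1 : pd m (principal a f) y = ∑ i, ∑ j, (a i j y * pd m (pd i (pd j f)) y +
      pd i (pd j f) y * pd m (a i j) y) := by
    have : principal a f = fun y ↦ ∑ i, ∑ j, a i j y * pd i (pd j f) y := rfl
    rw [this, pd_sum fun i _ ↦ d (ContDiffOn.sum fun j _ ↦ (ha i j).mul (hff i j))]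
    refine Finset.sum_congr rfl fun i _ ↦ ?_
    rw [pd_sum fun j _ ↦ d ((ha i j).mul (hff i j))]
    exact Finset.sum_congr rfl fun j _ ↦ pd_mul (d (ha i j)) (d (hff i j))
  have h2 : ∀ i j, pd i (pd j (pd m f)) y = pd m (pd i (pd j f)) y := by
    intro i j
    have hev : pd j (pd m f) =ᶠ[𝓝 y] pd m (pd j f) := by
      filter_upwards [hn] with z hz
      exact pd_comm ((hf.contDiffAt (hΩ.mem_nhds hz)).of_le le2)
    rw [pd_congr hev, pd_comm (((contDiffOn_pd hΩ hf).contDiffAt hn).of_le le2)]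
  rw [h1]
  simp only [principal, h2, Fin.sum_univ_two]
  ring

/-- Differentiating the system produces second derivatives of v in the lower order part. Once ∂ⱼv
counts as an unknown they are first derivatives, so systems with a common scalar principal part are
closed under differentiation, and the gradient estimate can be iterated. -/
theorem SolvesSystem.prolong [Fintype ι] [DecidableEq ι] (hΩ : IsOpen Ω) {a : Fin 2 → Fin 2 → Plane → ℝ}
    {b : Fin 2 → ι → ι → Plane → ℝ} {c : ι → ι → Plane → ℝ} {v : ι → Plane → ℝ}
    (ha : ∀ i j, ContDiffOn ℝ ∞ (a i j) Ω) (hb : ∀ k s t, ContDiffOn ℝ ∞ (b k s t) Ω)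
    (hc : ∀ s t, ContDiffOn ℝ ∞ (c s t) Ω) (hv : ∀ s, ContDiffOn ℝ ∞ (v s) Ω)
    (h : SolvesSystem Ω a b c v) :
    SolvesSystem Ω a (prolongFirst a b) (prolongZeroth b c) (prolong v) := by
  rintro ⟨_ | m, s⟩ y hy
  · have := h s y hy
    simp only [SurfaceBVP.prolong, this, Fintype.sum_prod_type, Fintype.sum_option, prolongFirst,
      prolongZeroth, Fin.sum_univ_two, Finset.sum_add_distrib, Pi.zero_apply, zero_mul,
      Finset.sum_const_zero]
    ring
  · have hn := hΩ.mem_nhds hy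
    have d : ∀ {g : Plane → ℝ}, ContDiffOn ℝ ∞ g Ω → DifferentiableAt ℝ g y := fun hg ↦
      (hg.contDiffAt hn).differentiableAt (by simp)
    have le2 : (2 : WithTop ℕ∞) ≤ ∞ := by norm_cast
    have hbk : ∀ k t, ContDiffOn ℝ ∞ (fun y ↦ b k s t y * pd k (v t) y) Ω := fun k t ↦
      (hb k s t).mul (contDiffOn_pd hΩ (hv t))
    have hct : ∀ t, ContDiffOn ℝ ∞ (fun y ↦ c s t y * v t y) Ω := fun t ↦ (hc s t).mul (hv t)
    have hbs : ∀ t, ContDiffOn ℝ ∞ (fun y ↦ ∑ k, b k s t y * pd k (v t) y) Ω := fun t ↦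
      ContDiffOn.sum fun k _ ↦ hbk k t
    have h1 : pd m (principal a (v s)) y = ∑ t, (∑ k, (b k s t y * pd k (pd m (v t)) y +
        pd k (v t) y * pd m (b k s t) y) + (c s t y * pd m (v t) y + v t y * pd m (c s t) y)) := by
      have hev : principal a (v s) =ᶠ[𝓝 y] fun y ↦
          ∑ t, (∑ k, b k s t y * pd k (v t) y + c s t y * v t y) := by
        filter_upwards [hn] with z hz using h s z hz
      rw [pd_congr hev, pd_sum fun t _ ↦ d ((hbs t).add (hct t))]
      refine Finset.sum_congr rfl fun t _ ↦ ?_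
      rw [pd_add (d (hbs t)) (d (hct t)), pd_sum fun k _ ↦ d (hbk k t),
        pd_mul (d (hc s t)) (d (hv t))]
      congr 1
      refine Finset.sum_congr rfl fun k _ ↦ ?_
      rw [pd_mul (d (hb k s t)) (d (contDiffOn_pd hΩ (hv t))),
        pd_comm (((hv t).contDiffAt hn).of_le le2)]
    have hcomm : ∀ i j t, pd i (pd j (v t)) y = pd j (pd i (v t)) y := fun i j t ↦
      pd_comm (((hv t).contDiffAt hn).of_le le2)
    have h2 := principal_pd hΩ ha (hv s) m hy
    change principal a (pd m (v s)) y = _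
    rw [h2, h1]
    simp only [SurfaceBVP.prolong, Fintype.sum_prod_type, Fintype.sum_option, prolongFirst,
      prolongZeroth, Fin.sum_univ_two, Finset.sum_add_distrib, Pi.zero_apply, zero_mul,
      Finset.sum_const_zero, sub_mul, add_mul, ite_mul, Finset.sum_sub_distrib,
      Finset.sum_ite_eq, Finset.mem_univ, if_true]
    fin_cases m <;> simp [mul_comm] <;> ring

/-- Cauchy–Schwarz, over the unknowns and over the three terms (two derivatives and the function
itself) of each. This is the form in which the system enters Bernstein's method. -/
theorem sum_principal_sq_le [Fintype ι] {a : Fin 2 → Fin 2 → Plane → ℝ}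
    {b : Fin 2 → ι → ι → Plane → ℝ} {c : ι → ι → Plane → ℝ} {v : ι → Plane → ℝ} {M : ℝ}
    {y : Plane} (hy : y ∈ Ω) (hb : ∀ k s t, |b k s t y| ≤ M) (hc : ∀ s t, |c s t y| ≤ M)
    (h : SolvesSystem Ω a b c v) : ∑ s, principal a (v s) y ^ 2 ≤
      (3 * Fintype.card ι ^ 2 * M ^ 2) * (∑ s, ∑ k, pd k (v s) y ^ 2 + ∑ s, v s y ^ 2) := by
  have sqb : ∀ x z : ℝ, |x| ≤ M → (x * z) ^ 2 ≤ M ^ 2 * z ^ 2 := by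
    intro x z hx
    rw [mul_pow]
    exact mul_le_mul_of_nonneg_right
      (sq_le_sq' (by linarith [neg_le_of_abs_le hx]) (le_of_abs_le hx)) (sq_nonneg z)
  have key : ∀ s ∈ (Finset.univ : Finset ι), principal a (v s) y ^ 2 ≤
      (Fintype.card ι : ℝ) * (3 * M ^ 2 *
        (∑ s, ∑ k, pd k (v s) y ^ 2 + ∑ s, v s y ^ 2)) := by
    intro s _
    rw [h s y hy]
    refine (sq_sum_le_card_mul_sum_sq).trans ?_
    rw [Finset.card_univ, ← Finset.sum_add_distrib]
    refine mul_le_mul_of_nonneg_left ?_ (Nat.cast_nonneg (α := ℝ) _)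
    rw [Finset.mul_sum]
    refine Finset.sum_le_sum fun t _ ↦ ?_
    rw [Fin.sum_univ_two, Fin.sum_univ_two]
    have h0 := sqb _ (pd 0 (v t) y) (hb 0 s t)
    have h1 := sqb _ (pd 1 (v t) y) (hb 1 s t)
    have h2 := sqb _ (v t y) (hc s t)
    generalize b 0 s t y * pd 0 (v t) y = x₀ at *
    generalize b 1 s t y * pd 1 (v t) y = x₁ at *
    generalize c s t y * v t y = x₂ at *
    nlinarith [sq_nonneg (x₀ - x₁), sq_nonneg (x₀ - x₂), sq_nonneg (x₁ - x₂)]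
  refine (Finset.sum_le_sum key).trans (le_of_eq ?_)
  rw [Finset.sum_const, Finset.card_univ, nsmul_eq_mul]
  ring

theorem exists_bound_of_continuousOn {κ : Type*} [Finite κ] {f : κ → Plane → ℝ} {K : Set Plane}
    (hK : IsCompact K) (hf : ∀ k, ContinuousOn (f k) K) : ∃ M, ∀ k, ∀ y ∈ K, |f k y| ≤ M := by
  choose B hB using fun k ↦ hK.exists_bound_of_continuousOn (hf k)
  obtain ⟨M, hM⟩ := Finite.exists_le B
  exact ⟨M, fun k y hy ↦ (hB k y hy).trans (hM k)⟩

theorem SolvesSystem.mono [Fintype ι] {Ω' : Set Plane} {a : Fin 2 → Fin 2 → Plane → ℝ}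
    {b : Fin 2 → ι → ι → Plane → ℝ} {c : ι → ι → Plane → ℝ} {v : ι → Plane → ℝ}
    (h : SolvesSystem Ω a b c v) (hΩ : Ω' ⊆ Ω) : SolvesSystem Ω' a b c v :=
  fun s y hy ↦ h s y (hΩ hy)

/-- The matrix `a` is symmetric and positive definite. -/
structure IsEllipticAt (a : Fin 2 → Fin 2 → Plane → ℝ) (y : Plane) : Prop where
  symm : a 0 1 y = a 1 0 y
  pos : 0 < a 0 0 y
  det_pos : 0 < a 0 0 y * a 1 1 y - a 0 1 y * a 0 1 y

theorem IsEllipticAt.trace_pos {a : Fin 2 → Fin 2 → Plane → ℝ} {y : Plane}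
    (h : IsEllipticAt a y) : 0 < a 0 0 y + a 1 1 y := by
  have h0 := h.pos
  have h1 := h.det_pos
  by_contra! hd
  nlinarith [mul_nonneg h0.le (neg_nonneg.2 (by linarith : a 1 1 y ≤ 0)),
    mul_self_nonneg (a 0 1 y)]

/-- The system controls Lv and the prolonged system controls L∂ₖv, which is all that Bernstein's
method needs. Coefficient bounds and the ellipticity constant exist by compactness of an
intermediate ball, so the constant is independent of v. -/
theorem SolvesSystem.gradient_estimate [Fintype ι] [DecidableEq ι] {p : Plane} {r R : ℝ}
    (hr : 0 ≤ r) (hrR : r < R) {a : Fin 2 → Fin 2 → Plane → ℝ} {b : Fin 2 → ι → ι → Plane → ℝ}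
    {c : ι → ι → Plane → ℝ} (ha : ∀ i j, ContDiffOn ℝ ∞ (a i j) (Metric.ball p R))
    (hb : ∀ k s t, ContDiffOn ℝ ∞ (b k s t) (Metric.ball p R))
    (hc : ∀ s t, ContDiffOn ℝ ∞ (c s t) (Metric.ball p R))
    (hell : ∀ y ∈ Metric.ball p R, IsEllipticAt a y) :
    ∃ C, 0 ≤ C ∧ ∀ (v : ι → Plane → ℝ) (S : ℝ), 0 ≤ S →
      (∀ s, ContDiffOn ℝ ∞ (v s) (Metric.ball p R)) →
      SolvesSystem (Metric.ball p R) a b c v → (∀ s, ∀ y ∈ Metric.ball p R, |v s y| ≤ S) →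
      ∀ s k, ∀ y ∈ Metric.closedBall p r, |pd k (v s) y| ≤ C * S := by
  set ρ := (r + R) / 2 with hρd
  have hrρ : r < ρ := by linarith
  have hρR : ρ < R := by linarith
  have hsub : Metric.closedBall p ρ ⊆ Metric.ball p R := Metric.closedBall_subset_ball hρR
  have hK := isCompact_closedBall p ρ
  have hO : IsOpen (Metric.ball p R) := Metric.isOpen_ball
  have hb' := contDiffOn_prolongFirst hO ha hb
  have hc' := contDiffOn_prolongZeroth hO hb hc
  have cont : ∀ {f : Plane → ℝ}, ContDiffOn ℝ ∞ f (Metric.ball p R) →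
      ContinuousOn f (Metric.closedBall p ρ) := fun hf ↦ hf.continuousOn.mono hsub
  obtain ⟨M₁, hM₁⟩ := exists_bound_of_continuousOn (f := fun x : Fin 2 × Fin 2 ↦ a x.1 x.2) hK
    fun x ↦ cont (ha _ _)
  obtain ⟨M₂, hM₂⟩ := exists_bound_of_continuousOn (f := fun x : Fin 2 × ι × ι ↦ b x.1 x.2.1 x.2.2)
    hK fun x ↦ cont (hb _ _ _)
  obtain ⟨M₃, hM₃⟩ := exists_bound_of_continuousOn (f := fun x : ι × ι ↦ c x.1 x.2) hK
    fun x ↦ cont (hc _ _)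
  obtain ⟨M₄, hM₄⟩ := exists_bound_of_continuousOn
    (f := fun x : Fin 2 × (Option (Fin 2) × ι) × (Option (Fin 2) × ι) ↦
      prolongFirst a b x.1 x.2.1 x.2.2) hK fun x ↦ cont (hb' _ _ _)
  obtain ⟨M₅, hM₅⟩ := exists_bound_of_continuousOn
    (f := fun x : (Option (Fin 2) × ι) × (Option (Fin 2) × ι) ↦
      prolongZeroth b c x.1 x.2) hK fun x ↦ cont (hc' _ _)
  obtain ⟨x₀, hx₀, hmin⟩ := hK.exists_isMinOn ⟨p, Metric.mem_closedBall_self (by linarith)⟩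
    (f := fun y ↦ (a 0 0 y * a 1 1 y - a 0 1 y * a 0 1 y) / (a 0 0 y + a 1 1 y))
    ((((cont (ha 0 0)).mul (cont (ha 1 1))).sub ((cont (ha 0 1)).mul (cont (ha 0 1)))).div
      ((cont (ha 0 0)).add (cont (ha 1 1))) fun y hy ↦ (hell y (hsub hy)).trace_pos.ne')
  set θ := (a 0 0 x₀ * a 1 1 x₀ - a 0 1 x₀ * a 0 1 x₀) / (a 0 0 x₀ + a 1 1 x₀) with hθd
  have hθ : 0 < θ := div_pos (hell x₀ (hsub hx₀)).det_pos (hell x₀ (hsub hx₀)).trace_pos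
  set K₁ : ℝ := 3 * Fintype.card ι ^ 2 * (|M₂| + |M₃|) ^ 2 with hK₁
  set K₂ : ℝ := 3 * Fintype.card (Option (Fin 2) × ι) ^ 2 * (|M₄| + |M₅|) ^ 2 with hK₂
  have hK₁0 : 0 ≤ K₁ := by positivity
  have hK₂0 : 0 ≤ K₂ := by positivity
  set M : ℝ := |M₁| + ρ ^ 2 + 2 * ρ with hM
  have hρ0 : 0 ≤ ρ := hr.trans hrρ.le
  -- The factor 2: first derivatives of v enter the bound for the prolonged system twice, as
  -- gradients of v and as unknowns.
  obtain ⟨C, hC0, hC⟩ := SurfaceBVP.gradient_estimate (ι := ι) (p := p) (M := M)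
    (K := K₁ + 2 * K₂) hr hrρ hθ (by positivity) (by rw [hM]; linarith [abs_nonneg M₁])
    (by rw [hM]; nlinarith [abs_nonneg M₁])
  refine ⟨√(C * Fintype.card ι), Real.sqrt_nonneg _, ?_⟩
  intro v S hS0 hv hsol hvS s k y hy
  have key := hC a v (Fintype.card ι * S ^ 2) ?_ ?_ ?_ ?_ ?_ y hy
  · have h1 : pd k (v s) y ^ 2 ≤ C * (Fintype.card ι * S ^ 2) := by
      refine le_trans ?_ key
      refine le_trans ?_ (Finset.single_le_sum (f := fun s ↦ ∑ k, pd k (v s) y ^ 2)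
        (fun i _ ↦ Finset.sum_nonneg fun _ _ ↦ sq_nonneg _) (Finset.mem_univ s))
      exact Finset.single_le_sum (f := fun k ↦ pd k (v s) y ^ 2)
        (fun i _ ↦ sq_nonneg _) (Finset.mem_univ k)
    refine (Real.abs_le_sqrt h1).trans (le_of_eq ?_)
    rw [← mul_assoc, Real.sqrt_mul' _ (sq_nonneg S), Real.sqrt_sq hS0]
  · intro z hz
    have he := hell z (hsub hz)
    refine ⟨fun i j ↦ ?_, he.symm, he.pos, he.det_pos, ?_⟩
    · refine (hM₁ (i, j) z hz).trans ?_
      rw [hM]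
      linarith [le_abs_self M₁, sq_nonneg ρ]
    · rw [← le_div_iff₀ he.trace_pos]
      exact hmin hz
  · exact fun s z hz ↦ (hv s).contDiffAt (hO.mem_nhds (hsub hz))
  · intro z hz
    refine (sum_principal_sq_le (M := |M₂| + |M₃|) (hsub hz) (fun k s t ↦ ?_) (fun s t ↦ ?_)
      hsol).trans ?_
    · exact (hM₂ (k, s, t) z hz).trans (by linarith [le_abs_self M₂, abs_nonneg M₃])
    · exact (hM₃ (s, t) z hz).trans (by linarith [le_abs_self M₃, abs_nonneg M₂])
    · rw [← hK₁]
      refine mul_le_mul_of_nonneg_right (by linarith) (add_nonneg ?_ ?_)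
      · exact Finset.sum_nonneg fun _ _ ↦ Finset.sum_nonneg fun _ _ ↦ sq_nonneg _
      · exact Finset.sum_nonneg fun _ _ ↦ sq_nonneg _
  · intro z hz
    have := sum_principal_sq_le (M := |M₄| + |M₅|) (hsub hz) (fun k s t ↦ ?_) (fun s t ↦ ?_)
      (hsol.prolong hO ha hb hc hv)
    · rw [← hK₂] at this
      have hN0 : 0 ≤ ∑ s, v s z ^ 2 := Finset.sum_nonneg fun _ _ ↦ sq_nonneg _
      have hN1 : 0 ≤ ∑ s, ∑ k, pd k (v s) z ^ 2 :=
        Finset.sum_nonneg fun _ _ ↦ Finset.sum_nonneg fun _ _ ↦ sq_nonneg _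
      have hN2 : 0 ≤ ∑ s, ∑ k, ∑ l, pd l (pd k (v s)) z ^ 2 :=
        Finset.sum_nonneg fun _ _ ↦ Finset.sum_nonneg fun _ _ ↦ Finset.sum_nonneg
          fun _ _ ↦ sq_nonneg _
      have hP : 0 ≤ ∑ s, principal a (v s) z ^ 2 := Finset.sum_nonneg fun _ _ ↦ sq_nonneg _
      have e : ∀ x y z : ℝ, 0 ≤ x → 0 ≤ y → 0 ≤ z →
          K₂ * (y + z + (x + y)) ≤ (K₁ + 2 * K₂) * (z + y + x) := fun x y z _ _ _ ↦ by
        nlinarith [mul_nonneg hK₁0 (by positivity : 0 ≤ x + y + z), mul_nonneg hK₂0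
          (by positivity : 0 ≤ x + z)]
      have e' := e _ _ _ hN0 hN1 hN2
      simp only [Fintype.sum_prod_type, Fintype.sum_option, SurfaceBVP.prolong,
        Fin.sum_univ_two, Finset.sum_add_distrib] at this hP e' ⊢
      linarith
    · exact (hM₄ (k, s, t) z hz).trans (by linarith [le_abs_self M₄, abs_nonneg M₅])
    · exact (hM₅ (s, t) z hz).trans (by linarith [le_abs_self M₅, abs_nonneg M₄])
  · intro z hz
    refine (Finset.sum_le_sum (g := fun _ ↦ S ^ 2) fun s _ ↦ ?_).trans (by simp)
    exact sq_le_sq' (by linarith [neg_le_of_abs_le (hvS s z (hsub hz))])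
      (le_of_abs_le (hvS s z (hsub hz)))

theorem fderiv_eq_sum_pd (f : Plane → ℝ) : fderiv ℝ f = fun y ↦
    ContinuousLinearMap.smulRight (1 : ℝ →L[ℝ] ℝ) (EuclideanSpace.proj (𝕜 := ℝ) (0 : Fin 2) :
      Plane →L[ℝ] ℝ) (pd 0 f y) +
    ContinuousLinearMap.smulRight (1 : ℝ →L[ℝ] ℝ) (EuclideanSpace.proj (𝕜 := ℝ) (1 : Fin 2) :
      Plane →L[ℝ] ℝ) (pd 1 f y) := by
  funext y
  ext v
  rw [fderiv_apply_eq_sum_pd]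
  simp [mul_comm]

/-- **Interior estimates**: all derivatives of solutions of an elliptic system with smooth
coefficients are controlled by the supremum of the solution. -/
theorem SolvesSystem.interior_estimate (n : ℕ) : ∀ (ι : Type) [Fintype ι] [DecidableEq ι]
    {p : Plane} {r R : ℝ} (_ : 0 ≤ r) (_ : r < R) {a : Fin 2 → Fin 2 → Plane → ℝ}
    {b : Fin 2 → ι → ι → Plane → ℝ} {c : ι → ι → Plane → ℝ}
    (_ : ∀ i j, ContDiffOn ℝ ∞ (a i j) (Metric.ball p R))
    (_ : ∀ k s t, ContDiffOn ℝ ∞ (b k s t) (Metric.ball p R))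
    (_ : ∀ s t, ContDiffOn ℝ ∞ (c s t) (Metric.ball p R))
    (_ : ∀ y ∈ Metric.ball p R, IsEllipticAt a y),
    ∃ C, 0 ≤ C ∧ ∀ (v : ι → Plane → ℝ) (S : ℝ), 0 ≤ S →
      (∀ s, ContDiffOn ℝ ∞ (v s) (Metric.ball p R)) →
      SolvesSystem (Metric.ball p R) a b c v → (∀ s, ∀ y ∈ Metric.ball p R, |v s y| ≤ S) →
      ∀ s, ∀ y ∈ Metric.closedBall p r, ‖iteratedFDeriv ℝ n (v s) y‖ ≤ C * S := by
  induction n with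
  | zero =>
    intro ι _ _ p r R hr hrR a b c ha hb hc hell
    refine ⟨1, zero_le_one, fun v S _ _ _ hvS s y hy ↦ ?_⟩
    rw [norm_iteratedFDeriv_zero, one_mul]
    exact hvS s y (Metric.closedBall_subset_ball hrR hy)
  | succ n ih =>
    intro ι _ _ p r R hr hrR a b c ha hb hc hell
    set r₁ := (r + R) / 2 with hr₁
    have h1 : r < r₁ := by linarith
    have h2 : r₁ < R := by linarith
    have hsub : Metric.ball p r₁ ⊆ Metric.ball p R := Metric.ball_subset_ball h2.le
    have hO : IsOpen (Metric.ball p R) := Metric.isOpen_ball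
    obtain ⟨C₁, hC₁0, hC₁⟩ := SolvesSystem.gradient_estimate (hr.trans h1.le) h2 ha hb hc hell
    -- The induction hypothesis is used for v together with its first derivatives, so the index type
    -- of the unknowns has to vary in the statement.
    obtain ⟨C₂, hC₂0, hC₂⟩ := ih (Option (Fin 2) × ι) hr h1
      (fun i j ↦ (ha i j).mono hsub)
      (fun k s t ↦ (contDiffOn_prolongFirst hO ha hb k s t).mono hsub)
      (fun s t ↦ (contDiffOn_prolongZeroth hO hb hc s t).mono hsub)
      (fun y hy ↦ hell y (hsub hy))
    set T : Fin 2 → ℝ →L[ℝ] Plane →L[ℝ] ℝ := fun k ↦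
      ContinuousLinearMap.smulRight (1 : ℝ →L[ℝ] ℝ) (EuclideanSpace.proj (𝕜 := ℝ) k :
      Plane →L[ℝ] ℝ) with hT
    refine ⟨(‖T 0‖ + ‖T 1‖) * (C₂ * (1 + C₁)), by positivity, ?_⟩
    intro v S hS0 hv hsol hvS s y hy
    have hW := hC₂ (SurfaceBVP.prolong v) ((1 + C₁) * S) (by positivity)
      (fun s ↦ (contDiffOn_prolong hO hv s).mono hsub) ((hsol.prolong hO ha hb hc hv).mono hsub)
      (by
        rintro ⟨_ | k, t⟩ z hz
        · have : 0 ≤ C₁ * S := by positivity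
          exact (hvS t z (hsub hz)).trans (by linarith)
        · refine (hC₁ v S hS0 hv hsol hvS t k z (Metric.ball_subset_closedBall hz)).trans ?_
          linarith)
    have hyR : y ∈ Metric.ball p R := Metric.closedBall_subset_ball hrR hy
    have hk : ∀ k, ContDiffAt ℝ n (pd k (v s)) y := fun k ↦
      ((contDiffOn_pd hO (hv s)).contDiffAt (hO.mem_nhds hyR)).of_le (by exact_mod_cast le_top)
    have hTk : ∀ k, ‖iteratedFDeriv ℝ n (T k ∘ pd k (v s)) y‖ ≤
        ‖T k‖ * (C₂ * ((1 + C₁) * S)) := fun k ↦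
      ((T k).norm_iteratedFDeriv_comp_left (hk k) le_rfl).trans
        (mul_le_mul_of_nonneg_left (hW (some k, s) y hy) (norm_nonneg _))
    rw [← norm_iteratedFDeriv_fderiv, fderiv_eq_sum_pd]
    change ‖iteratedFDeriv ℝ n ((T 0 ∘ pd 0 (v s)) + (T 1 ∘ pd 1 (v s))) y‖ ≤ _
    rw [iteratedFDeriv_add_apply ((T 0).contDiff.contDiffAt.comp y (hk 0))
      ((T 1).contDiff.contDiffAt.comp y (hk 1))]
    refine (norm_add_le _ _).trans ?_
    linarith [hTk 0, hTk 1]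


/-! ### Smooth functions that are not restrictions of solutions -/

theorem iteratedDeriv_const_mul_cos (c l : ℝ) (k : ℕ) :
    iteratedDeriv k (fun x ↦ c * Real.cos (l * x)) =
      fun x ↦ c * (l ^ k * iteratedDeriv k Real.cos (l * x)) := by
  funext x
  have h1 : ContDiff ℝ k fun x ↦ Real.cos (l * x) :=
    Real.contDiff_cos.comp (contDiff_const.mul contDiff_id)
  rw [iteratedDeriv_const_mul c h1.contDiffAt, iteratedDeriv_comp_const_mul Real.contDiff_cos l]

theorem abs_iteratedDeriv_cos_le_one (k : ℕ) (x : ℝ) : |iteratedDeriv k Real.cos x| ≤ 1 := by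
  rcases Nat.even_or_odd' k with ⟨n, rfl | rfl⟩
  · simpa [abs_mul] using Real.abs_cos_le_one x
  · simpa [abs_mul] using Real.abs_sin_le_one x

/-- There are smooth functions whose derivatives at a point grow faster than any prescribed
sequence. -/
theorem exists_contDiff_lt_norm_iteratedFDeriv (C : ℕ → ℝ) (x₀ : ℝ) :
    ∃ h : ℝ → ℝ, ContDiff ℝ ∞ h ∧ ∀ S : ℝ, ∃ m, C m * S < ‖iteratedFDeriv ℝ m h x₀‖ := by
  suffices H : ∃ h : ℝ → ℝ, ContDiff ℝ ∞ h ∧ ∀ S : ℝ, ∃ m, C m * S < ‖iteratedFDeriv ℝ m h 0‖ by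
    obtain ⟨h, hh, hS⟩ := H
    refine ⟨fun x ↦ h (x - x₀), hh.comp (contDiff_id.sub contDiff_const), fun S ↦ ?_⟩
    obtain ⟨m, hm⟩ := hS S
    refine ⟨m, ?_⟩
    rwa [iteratedFDeriv_comp_sub, sub_self]
  -- Frequencies of the series Σ lⱼ⁻ʲ cos(lⱼ x). The bound lⱼ ≥ 2 makes every differentiated series
  -- converge, and lⱼ > j |C(2j)| produces the growth.
  set l : ℕ → ℝ := fun j ↦ 2 + j * |C (2 * j)| with hl
  have hl2 : ∀ j, 2 ≤ l j := fun j ↦ by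
    have : 0 ≤ j * |C (2 * j)| := by positivity
    simp only [hl]
    linarith
  have hl0 : ∀ j, 0 < l j := fun j ↦ by linarith [hl2 j]
  set f : ℕ → ℝ → ℝ := fun j x ↦ (l j ^ j)⁻¹ * Real.cos (l j * x) with hf
  set v : ℕ → ℕ → ℝ := fun k j ↦ (l j ^ j)⁻¹ * l j ^ k with hv
  have hfs : ∀ j, ContDiff ℝ ∞ (f j) := fun j ↦
    contDiff_const.mul (Real.contDiff_cos.comp (contDiff_const.mul contDiff_id))
  have hfv : ∀ (k j : ℕ) (x : ℝ), ‖iteratedFDeriv ℝ k (f j) x‖ ≤ v k j := by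
    intro k j x
    rw [norm_iteratedFDeriv_eq_norm_iteratedDeriv, hf, iteratedDeriv_const_mul_cos,
      Real.norm_eq_abs, abs_mul, abs_mul, abs_of_pos (inv_pos.2 (pow_pos (hl0 j) j)),
      abs_of_pos (pow_pos (hl0 j) k)]
    refine mul_le_mul_of_nonneg_left ?_ (inv_pos.2 (pow_pos (hl0 j) j)).le
    exact mul_le_of_le_one_right (pow_pos (hl0 j) k).le (abs_iteratedDeriv_cos_le_one _ _)
  have hvs : ∀ k, Summable (v k) := by
    intro k
    refine Summable.of_norm_bounded_eventually_nat (g := fun j ↦ 2 ^ k * (1 / 2) ^ j)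
      (summable_geometric_two.mul_left _) ?_
    filter_upwards [eventually_ge_atTop k] with j hj
    obtain ⟨i, rfl⟩ := Nat.exists_eq_add_of_le hj
    have hp := pow_pos (hl0 (k + i)) k
    rw [Real.norm_eq_abs, abs_of_nonneg (by have := hl0 (k + i); positivity)]
    have h1 : v k (k + i) = 1 / l (k + i) ^ i := by
      simp only [hv, pow_add]
      field_simp
    have h2 : (2 : ℝ) ^ k * (1 / 2) ^ (k + i) = 1 / 2 ^ i := by
      rw [pow_add, ← mul_assoc, ← mul_pow]
      simp
    rw [h1, h2]
    exact one_div_le_one_div_of_le (by positivity) (pow_le_pow_left₀ (by norm_num) (hl2 _) i)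
  refine ⟨fun x ↦ ∑' j, f j x, contDiff_tsum (N := ⊤) hfs (fun k _ ↦ hvs k)
    (fun k j x _ ↦ hfv k j x), fun S ↦ ?_⟩
  obtain ⟨m, hm⟩ := exists_nat_ge (max |S| 1)
  have hmS : |S| ≤ m := (le_max_left _ _).trans hm
  have hm1 : (1 : ℝ) ≤ m := (le_max_right _ _).trans hm
  have hm0 : m ≠ 0 := by
    rintro rfl
    norm_num at hm1
  refine ⟨2 * m, ?_⟩
  -- At 0 the derivatives of order 2m of all cosines have the same sign. Nothing cancels, and the
  -- single term j = m, of size lₘᵐ, bounds the sum from below.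
  have hval : iteratedDeriv (2 * m) (fun x ↦ ∑' j, f j x) 0 = (-1) ^ m * ∑' j, v (2 * m) j := by
    have hsum : Summable fun j ↦ iteratedFDeriv ℝ (2 * m) (f j) 0 :=
      Summable.of_norm_bounded (hvs _) fun j ↦ hfv _ j 0
    rw [iteratedDeriv_eq_iteratedFDeriv, iteratedFDeriv_tsum_apply (N := ⊤) hfs
      (fun k _ ↦ hvs k) (fun k j x _ ↦ hfv k j x) le_top, ContinuousMultilinearMap.tsum_eval hsum,
      ← tsum_mul_left]
    refine tsum_congr fun j ↦ ?_
    rw [← iteratedDeriv_eq_iteratedFDeriv, hf, iteratedDeriv_const_mul_cos]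
    simp [hv]
    ring
  rw [norm_iteratedFDeriv_eq_norm_iteratedDeriv, hval, norm_mul, norm_pow, norm_neg, norm_one,
    one_pow, one_mul, Real.norm_eq_abs]
  have hvn : ∀ j, 0 ≤ v (2 * m) j := fun j ↦ by
    have := hl0 j
    simp only [hv]
    positivity
  have h1 : v (2 * m) m ≤ ∑' j, v (2 * m) j := (hvs _).le_tsum m fun j _ ↦ hvn j
  have h2 : v (2 * m) m = l m ^ m := by
    have := hl0 m
    simp only [hv, two_mul, pow_add]
    field_simp
  have h3 : l m ≤ l m ^ m := le_self_pow₀ (by linarith [hl2 m]) hm0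
  have h4 : m * |C (2 * m)| < l m := by
    simp only [hl]
    linarith
  have h5 : C (2 * m) * S ≤ m * |C (2 * m)| := by
    calc C (2 * m) * S ≤ |C (2 * m) * S| := le_abs_self _
      _ = |C (2 * m)| * |S| := abs_mul _ _
      _ ≤ |C (2 * m)| * m := mul_le_mul_of_nonneg_left hmS (abs_nonneg _)
      _ = _ := mul_comm _ _
  have h6 := le_abs_self (∑' j, v (2 * m) j)
  linarith

/-- Solutions of an elliptic equation with smooth coefficients can not have arbitrary smooth
restrictions to a curve. -/
theorem exists_contDiff_ne_solution_comp {p : Plane} {R : ℝ} (hR : 0 < R)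
    {a : Fin 2 → Fin 2 → Plane → ℝ} {b : Fin 2 → Plane → ℝ} {c : Plane → ℝ}
    (ha : ∀ i j, ContDiffOn ℝ ∞ (a i j) (Metric.ball p R))
    (hb : ∀ k, ContDiffOn ℝ ∞ (b k) (Metric.ball p R))
    (hc : ContDiffOn ℝ ∞ c (Metric.ball p R))
    (hell : ∀ y ∈ Metric.ball p R, IsEllipticAt a y)
    {γ : ℝ → Plane} {V : Set ℝ} {s₀ : ℝ} (hV : IsOpen V) (hs₀ : s₀ ∈ V)
    (hγ : ContDiffOn ℝ ∞ γ V) (hγ₀ : γ s₀ = p) :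
    ∃ h : ℝ → ℝ, ContDiff ℝ ∞ h ∧ ∀ u : Plane → ℝ, ContDiffOn ℝ ∞ u (Metric.ball p R) →
      (∀ y ∈ Metric.ball p R, principal a u y = ∑ k, b k y * pd k u y + c y * u y) →
      (∃ S, ∀ y ∈ Metric.ball p R, |u y| ≤ S) → ¬ u ∘ γ =ᶠ[𝓝 s₀] h := by
  choose C hC0 hC using fun n ↦ SolvesSystem.interior_estimate n Unit (p := p) (r := 0) le_rfl hR
    (b := fun k _ _ ↦ b k) (c := fun _ _ ↦ c) ha (fun k _ _ ↦ hb k) (fun _ _ ↦ hc) hell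
  set W := V ∩ γ ⁻¹' Metric.ball p R with hW
  have hWo : IsOpen W := hγ.continuousOn.isOpen_inter_preimage hV Metric.isOpen_ball
  have hsW : s₀ ∈ W := ⟨hs₀, by simp [hγ₀, hR]⟩
  -- The summand 1 ensures D n ≥ 1, hence D n ≤ (D n)ⁱ for i ≥ 1, the form required by the estimate
  -- of derivatives of a composition.
  set D : ℕ → ℝ := fun n ↦ 1 + ∑ i ∈ Finset.range (n + 1), ‖iteratedFDerivWithin ℝ i γ W s₀‖
    with hD
  set E : ℕ → ℝ := fun n ↦ ∑ i ∈ Finset.range (n + 1), C i with hE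
  -- The sequence n! E(n) D(n)ⁿ is the Faà di Bruno bound for the n-th derivative of u ∘ γ when |u|
  -- ≤ 1. It depends on the equation and the curve only, so h is fixed before u.
  obtain ⟨h, hh, hS⟩ := exists_contDiff_lt_norm_iteratedFDeriv
    (fun n ↦ n.factorial * E n * D n ^ n) s₀
  refine ⟨h, hh, fun u hu hsol ⟨S, hSu⟩ heq ↦ ?_⟩
  have hp : p ∈ Metric.ball p R := Metric.mem_ball_self hR
  have hS0 : 0 ≤ S := (abs_nonneg _).trans (hSu p hp)
  obtain ⟨m, hm⟩ := hS S
  have hb1 : ∀ i ≤ m, ‖iteratedFDerivWithin ℝ i u (Metric.ball p R) (γ s₀)‖ ≤ E m * S := by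
    intro i hi
    rw [hγ₀, iteratedFDerivWithin_of_isOpen i Metric.isOpen_ball hp]
    refine (hC i (fun _ ↦ u) S hS0 (fun _ ↦ hu) (fun _ y hy ↦ ?_) (fun _ ↦ hSu) ()
      p (by simp)).trans (mul_le_mul_of_nonneg_right ?_ hS0)
    · simpa using hsol y hy
    · exact Finset.single_le_sum (fun j _ ↦ hC0 j) (Finset.mem_range.2 (by omega))
  have hb2 : ∀ i, 1 ≤ i → i ≤ m → ‖iteratedFDerivWithin ℝ i γ W s₀‖ ≤ D m ^ i := by
    intro i hi1 hi
    have h1 : ‖iteratedFDerivWithin ℝ i γ W s₀‖ ≤ D m := by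
      have := Finset.single_le_sum (f := fun i ↦ ‖iteratedFDerivWithin ℝ i γ W s₀‖)
        (fun j _ ↦ norm_nonneg _) (Finset.mem_range.2 (by omega : i < m + 1))
      simp only [hD]
      linarith
    refine h1.trans (le_self_pow₀ ?_ (by omega))
    simp only [hD]
    linarith [Finset.sum_nonneg (s := Finset.range (m + 1))
      (f := fun i ↦ ‖iteratedFDerivWithin ℝ i γ W s₀‖) fun j _ ↦ norm_nonneg _]
  have key := norm_iteratedFDerivWithin_comp_le (n := m) hu (hγ.mono inter_subset_left)
    (by exact_mod_cast le_top) Metric.isOpen_ball.uniqueDiffOn hWo.uniqueDiffOn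
    (fun s hs ↦ hs.2) hsW hb1 hb2
  rw [iteratedFDerivWithin_of_isOpen m hWo hsW, (Filter.EventuallyEq.iteratedFDeriv ℝ heq m).eq_of_nhds] at key
  linarith


/-! ### Calculus on the closed half plane -/

theorem mem_halfPlane {y : Plane} : y ∈ halfPlane ↔ 0 ≤ y 0 := by
  rw [halfPlane, range_modelWithCornersEuclideanHalfSpace]; rfl

theorem uniqueDiffOn_halfPlane : UniqueDiffOn ℝ halfPlane := (𝓡∂ 2).uniqueDiffOn

/-- Relatively open subsets of the closed half plane. -/
structure RelOpen (T : Set Plane) : Prop where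
  subset : T ⊆ halfPlane
  mem_nhdsWithin : ∀ y ∈ T, T ∈ 𝓝[halfPlane] y

/-- Functions on the half plane that are smooth (up to the boundary) at the points of `T`. -/
def Sm {V : Type*} [NormedAddCommGroup V] [NormedSpace ℝ V] (T : Set Plane) (f : Plane → V) : Prop :=
  ∀ y ∈ T, ContDiffWithinAt ℝ ∞ f halfPlane y

section

variable {T : Set Plane} {f g : Plane → ℝ}

theorem Sm.const (c : ℝ) : Sm T fun _ ↦ c := fun _ _ ↦ contDiffWithinAt_const

theorem Sm.coord (i : Fin 2) : Sm T fun y : Plane ↦ y i :=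
  fun _ _ ↦ (contDiff_coord i).contDiffWithinAt

theorem Sm.add (hf : Sm T f) (hg : Sm T g) : Sm T fun y ↦ f y + g y :=
  fun y hy ↦ (hf y hy).add (hg y hy)

theorem Sm.sub (hf : Sm T f) (hg : Sm T g) : Sm T fun y ↦ f y - g y :=
  fun y hy ↦ (hf y hy).sub (hg y hy)

theorem Sm.mul (hf : Sm T f) (hg : Sm T g) : Sm T fun y ↦ f y * g y :=
  fun y hy ↦ (hf y hy).mul (hg y hy)

theorem Sm.neg (hf : Sm T f) : Sm T fun y ↦ - f y :=
  fun y hy ↦ (hf y hy).neg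

theorem Sm.inv (hf : Sm T f) (h0 : ∀ y ∈ T, f y ≠ 0) : Sm T fun y ↦ (f y)⁻¹ :=
  fun y hy ↦ (hf y hy).inv (h0 y hy)

theorem Sm.mono {V : Type*} [NormedAddCommGroup V] [NormedSpace ℝ V] {f : Plane → V}
    {T' : Set Plane} (hf : Sm T f) (h : T' ⊆ T) : Sm T' f :=
  fun y hy ↦ hf y (h hy)

theorem Sm.differentiableWithinAt {V : Type*} [NormedAddCommGroup V] [NormedSpace ℝ V]
    {f : Plane → V} (hf : Sm T f) {y : Plane} (hy : y ∈ T) :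
    DifferentiableWithinAt ℝ f halfPlane y := (hf y hy).differentiableWithinAt (by simp)


theorem Sm.partialDeriv (hT : RelOpen T) (hf : Sm T f) (i : Fin 2) :
    Sm T (fun y ↦ SurfaceBVP.partialDeriv i f y) := fun y hy ↦
  ((hf y hy).fderivWithin_right uniqueDiffOn_halfPlane (m := ∞) (by simp) (hT.subset hy)).clm_apply
    contDiffWithinAt_const

theorem partialDeriv_congr (hT : RelOpen T) (h : ∀ y ∈ T, f y = g y) (i : Fin 2) :
    ∀ y ∈ T, partialDeriv i f y = partialDeriv i g y := by
  intro y hy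
  have : f =ᶠ[𝓝[halfPlane] y] g := by
    filter_upwards [hT.mem_nhdsWithin y hy] with z hz using h z hz
  rw [partialDeriv, partialDeriv, this.fderivWithin_eq (h y hy)]

theorem uniqueDiffWithinAt_halfPlane (hT : RelOpen T) {y : Plane} (hy : y ∈ T) :
    UniqueDiffWithinAt ℝ halfPlane y := uniqueDiffOn_halfPlane y (hT.subset hy)

theorem partialDeriv_add (hT : RelOpen T) (hf : Sm T f) (hg : Sm T g) (i : Fin 2) {y : Plane}
    (hy : y ∈ T) :
    partialDeriv i (fun y ↦ f y + g y) y = partialDeriv i f y + partialDeriv i g y := by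
  simp [partialDeriv, fderivWithin_fun_add (uniqueDiffWithinAt_halfPlane hT hy)
    (hf.differentiableWithinAt hy) (hg.differentiableWithinAt hy)]

theorem partialDeriv_sub (hT : RelOpen T) (hf : Sm T f) (hg : Sm T g) (i : Fin 2) {y : Plane}
    (hy : y ∈ T) :
    partialDeriv i (fun y ↦ f y - g y) y = partialDeriv i f y - partialDeriv i g y := by
  simp [partialDeriv, fderivWithin_fun_sub (uniqueDiffWithinAt_halfPlane hT hy)
    (hf.differentiableWithinAt hy) (hg.differentiableWithinAt hy)]

theorem partialDeriv_mul (hT : RelOpen T) (hf : Sm T f) (hg : Sm T g) (i : Fin 2) {y : Plane}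
    (hy : y ∈ T) :
    partialDeriv i (fun y ↦ f y * g y) y = f y * partialDeriv i g y + g y * partialDeriv i f y := by
  simp [partialDeriv, fderivWithin_fun_mul (uniqueDiffWithinAt_halfPlane hT hy)
    (hf.differentiableWithinAt hy) (hg.differentiableWithinAt hy)]

@[simp]
theorem partialDeriv_const (c : ℝ) (i : Fin 2) (y : Plane) :
    partialDeriv i (fun _ ↦ c) y = 0 := by
  simp [partialDeriv]

theorem partialDeriv_coord (hT : RelOpen T) (i j : Fin 2) {y : Plane} (hy : y ∈ T) :
    partialDeriv i (fun y ↦ y j) y = if j = i then 1 else 0 := by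
  have h : HasFDerivWithinAt (fun y : Plane ↦ y j) (EuclideanSpace.proj (𝕜 := ℝ) j) halfPlane y :=
    (EuclideanSpace.proj (𝕜 := ℝ) j).hasFDerivWithinAt
  rw [partialDeriv, h.fderivWithin (uniqueDiffWithinAt_halfPlane hT hy)]
  simp

theorem fderivWithin_apply_eq (f : Plane → ℝ) (y v : Plane) :
    fderivWithin ℝ f halfPlane y v = v 0 * partialDeriv 0 f y + v 1 * partialDeriv 1 f y := by
  have : v = v 0 • e 0 + v 1 • e 1 := by
    ext i; fin_cases i <;> simp
  conv_lhs => rw [this]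
  simp [partialDeriv]

theorem halfPlane_subset_closure_interior : halfPlane ⊆ closure (interior halfPlane) :=
  (𝓡∂ 2).range_subset_closure_interior

theorem partialDeriv_comm (hT : RelOpen T) (hf : Sm T f) (i j : Fin 2) {y : Plane} (hy : y ∈ T) :
    partialDeriv i (partialDeriv j f) y = partialDeriv j (partialDeriv i f) y := by
  have hyH := hT.subset hy
  have hs : IsSymmSndFDerivWithinAt ℝ f halfPlane y :=
    (hf y hy).isSymmSndFDerivWithinAt (by simp; norm_cast) uniqueDiffOn_halfPlane
      (halfPlane_subset_closure_interior hyH) hyH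
  have hd : DifferentiableWithinAt ℝ (fderivWithin ℝ f halfPlane) halfPlane y :=
    ((hf y hy).fderivWithin_right uniqueDiffOn_halfPlane (m := ∞) (by simp)
      hyH).differentiableWithinAt (by simp)
  have key : ∀ k l : Fin 2, partialDeriv k (partialDeriv l f) y =
      fderivWithin ℝ (fderivWithin ℝ f halfPlane) halfPlane y (e k) (e l) := by
    intro k l
    have : partialDeriv l f = fun z ↦ fderivWithin ℝ f halfPlane z (e l) := rfl
    rw [partialDeriv, this, fderivWithin_clm_apply (uniqueDiffWithinAt_halfPlane hT hy) hd
      (differentiableWithinAt_const _)]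
    simp
  rw [key, key, hs.eq]

/-- Composition with a map of the half plane. -/
theorem Sm.comp {T' : Set Plane} (hT : RelOpen T) {U : Plane → ℝ} {F : Plane → Plane}
    (hT' : T' ⊆ halfPlane) (hU : Sm T' U) (hF : Sm T F) (hm : MapsTo F T T') :
    Sm T fun y ↦ U (F y) := fun y hy ↦ by
  have h1 : ContDiffWithinAt ℝ ∞ F T y := (hF y hy).mono hT.subset
  exact ((hU (F y) (hm hy)).comp y h1 fun z hz ↦ hT' (hm hz)).mono_of_mem_nhdsWithin
    (hT.mem_nhdsWithin y hy)

theorem Sm.apply {F : Plane → Plane} (hF : Sm T F) (j : Fin 2) : Sm T fun y ↦ F y j := fun y hy ↦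
  (EuclideanSpace.proj (𝕜 := ℝ) j : Plane →L[ℝ] ℝ).contDiff.contDiffAt.comp_contDiffWithinAt y
    (hF y hy)

/-- The chain rule. -/
theorem partialDeriv_comp {T' : Set Plane} (hT : RelOpen T) {U : Plane → ℝ} {F : Plane → Plane}
    (hT' : T' ⊆ halfPlane) (hU : Sm T' U) (hF : Sm T F) (hm : MapsTo F T T') (i : Fin 2)
    {y : Plane} (hy : y ∈ T) : partialDeriv i (fun y ↦ U (F y)) y =
      partialDeriv 0 U (F y) * partialDeriv i (fun y ↦ F y 0) y +
        partialDeriv 1 U (F y) * partialDeriv i (fun y ↦ F y 1) y := by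
  have h1 : HasFDerivWithinAt F (fderivWithin ℝ F halfPlane y) halfPlane y :=
    (hF.differentiableWithinAt hy).hasFDerivWithinAt
  have h2 : HasFDerivWithinAt U (fderivWithin ℝ U halfPlane (F y)) halfPlane (F y) :=
    (hU.differentiableWithinAt (hm hy)).hasFDerivWithinAt
  have h3 := (h2.comp y (h1.mono hT.subset) fun z hz ↦ hT' (hm hz)).mono_of_mem_nhdsWithin
    (hT.mem_nhdsWithin y hy)
  have hu := uniqueDiffWithinAt_halfPlane hT hy
  have h4 : ∀ j, partialDeriv i (fun y ↦ F y j) y = fderivWithin ℝ F halfPlane y (e i) j := by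
    intro j
    have : HasFDerivWithinAt (fun y ↦ F y j) _ halfPlane y :=
      (EuclideanSpace.proj (𝕜 := ℝ) j : Plane →L[ℝ] ℝ).hasFDerivAt.comp_hasFDerivWithinAt y h1
    rw [partialDeriv, this.fderivWithin hu]
    rfl
  have h5 : partialDeriv i (fun y ↦ U (F y)) y =
      fderivWithin ℝ U halfPlane (F y) (fderivWithin ℝ F halfPlane y (e i)) := by
    rw [partialDeriv]
    change fderivWithin ℝ (U ∘ F) halfPlane y (e i) = _
    rw [h3.fderivWithin hu]
    rfl
  rw [h5, fderivWithin_apply_eq, h4, h4]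
  ring

/-- Functions that coincide on the boundary have the same tangential derivatives there. -/
theorem partialDeriv_one_congr (hT : RelOpen T) (hf : Sm T f) (hg : Sm T g)
    (h : ∀ y ∈ T, y 0 = 0 → f y = g y) {y : Plane} (hy : y ∈ T) (hy0 : y 0 = 0) :
    partialDeriv 1 f y = partialDeriv 1 g y := by
  set l : ℝ → Plane := fun t ↦ y + t • e 1 with hl
  have hl0 : l 0 = y := by simp [hl]
  have hl00 : ∀ t, l t 0 = 0 := fun t ↦ by simp [hl, hy0]
  have hlH : ∀ t, l t ∈ halfPlane := fun t ↦ mem_halfPlane.2 (hl00 t).ge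
  have hld : HasDerivAt l (e 1) 0 := by
    have := ((hasDerivAt_id (0 : ℝ)).smul_const (e 1)).const_add y
    rwa [one_smul] at this
  have key : ∀ {k : Plane → ℝ}, Sm T k → HasDerivAt (k ∘ l) (partialDeriv 1 k y) 0 := by
    intro k hk
    have h1 : HasFDerivWithinAt k (fderivWithin ℝ k halfPlane y) halfPlane (l 0) := by
      rw [hl0]
      exact (hk.differentiableWithinAt hy).hasFDerivWithinAt
    exact h1.comp_hasDerivAt 0 hld (Eventually.of_forall hlH)
  have hev : f ∘ l =ᶠ[𝓝 0] g ∘ l := by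
    have ht : Tendsto l (𝓝 0) (𝓝[halfPlane] y) := by
      refine tendsto_nhdsWithin_iff.2 ⟨?_, Eventually.of_forall hlH⟩
      simpa [hl0] using hld.continuousAt.tendsto
    filter_upwards [ht.eventually (hT.mem_nhdsWithin y hy)] with t ht using h _ ht (hl00 t)
  exact (key hf).unique ((key hg).congr_of_eventuallyEq hev)

theorem partialDeriv_zero_nonneg (hT : RelOpen T) (hf : Sm T f) (h0 : ∀ y ∈ T, 0 ≤ f y)
    {y : Plane} (hy : y ∈ T) (hfy : f y = 0) : 0 ≤ partialDeriv 0 f y := by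
  have hmin : IsLocalMinOn f halfPlane y := by
    filter_upwards [hT.mem_nhdsWithin y hy] with z hz
    rw [hfy]
    exact h0 z hz
  refine hmin.hasFDerivWithinAt_nonneg (hf.differentiableWithinAt hy).hasFDerivWithinAt ?_
  refine mem_posTangentConeAt_of_segment_subset ?_
  intro z hz
  rw [segment_eq_image'] at hz
  obtain ⟨t, ht, rfl⟩ := hz
  have := mem_halfPlane.1 (hT.subset hy)
  rw [mem_halfPlane]
  simp
  linarith [ht.1]

end

/-! ### Order of agreement at the boundary -/

/-- The functions `f` and `g` and their normal derivatives of order less than `k` coincide at the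
boundary points in `T`. -/
def Agree (T : Set Plane) : ℕ → (Plane → ℝ) → (Plane → ℝ) → Prop
  | 0, _, _ => True
  | k + 1, f, g => (∀ y ∈ T, y 0 = 0 → f y = g y) ∧
      Agree T k (partialDeriv 0 f) (partialDeriv 0 g)

section

variable {T : Set Plane} {f g f' g' : Plane → ℝ} {k : ℕ}

theorem Agree.refl (T : Set Plane) : ∀ (k : ℕ) (f : Plane → ℝ), Agree T k f f
  | 0, _ => trivial
  | k + 1, _ => ⟨fun _ _ _ ↦ rfl, Agree.refl T k _⟩

theorem Agree.symm : ∀ {k : ℕ} {f g : Plane → ℝ}, Agree T k f g → Agree T k g f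
  | 0, _, _, _ => trivial
  | _ + 1, _, _, h => ⟨fun y hy h0 ↦ (h.1 y hy h0).symm, h.2.symm⟩

theorem Agree.trans : ∀ {k : ℕ} {f g h : Plane → ℝ}, Agree T k f g → Agree T k g h → Agree T k f h
  | 0, _, _, _, _, _ => trivial
  | _ + 1, _, _, _, h, h' => ⟨fun y hy h0 ↦ (h.1 y hy h0).trans (h'.1 y hy h0), h.2.trans h'.2⟩

theorem Agree.of_succ : ∀ {k : ℕ} {f g : Plane → ℝ}, Agree T (k + 1) f g → Agree T k f g
  | 0, _, _, _ => trivial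
  | _ + 1, _, _, h => ⟨h.1, h.2.of_succ⟩

theorem Agree.of_le {k m : ℕ} (hmk : m ≤ k) (h : Agree T k f g) : Agree T m f g := by
  induction hmk with
  | refl => exact h
  | step _ ih => exact ih h.of_succ

theorem Agree.of_eq (hT : RelOpen T) : ∀ (k : ℕ) {f g : Plane → ℝ}, (∀ y ∈ T, f y = g y) →
    Agree T k f g
  | 0, _, _, _ => trivial
  | k + 1, _, _, h => ⟨fun y hy _ ↦ h y hy, Agree.of_eq hT k (partialDeriv_congr hT h 0)⟩

theorem Agree.congr (hT : RelOpen T) (h : Agree T k f g) (hf : ∀ y ∈ T, f y = f' y)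
    (hg : ∀ y ∈ T, g y = g' y) : Agree T k f' g' :=
  ((Agree.of_eq hT k hf).symm.trans h).trans (Agree.of_eq hT k hg)

theorem Agree.add (hT : RelOpen T) : ∀ {k : ℕ} {f g f' g' : Plane → ℝ},
    Sm T f → Sm T g → Sm T f' → Sm T g' → Agree T k f f' → Agree T k g g' →
    Agree T k (fun y ↦ f y + g y) fun y ↦ f' y + g' y
  | 0, _, _, _, _, _, _, _, _, _, _ => trivial
  | _ + 1, _, _, _, _, hf, hg, hf', hg', h, h' =>
    ⟨fun y hy h0 ↦ by simp only [h.1 y hy h0, h'.1 y hy h0],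
      (Agree.add hT (hf.partialDeriv hT 0) (hg.partialDeriv hT 0) (hf'.partialDeriv hT 0)
        (hg'.partialDeriv hT 0) h.2 h'.2).congr hT
        (fun _ hy ↦ (partialDeriv_add hT hf hg 0 hy).symm)
        fun _ hy ↦ (partialDeriv_add hT hf' hg' 0 hy).symm⟩

theorem Agree.mul (hT : RelOpen T) : ∀ {k : ℕ} {f g f' g' : Plane → ℝ},
    Sm T f → Sm T g → Sm T f' → Sm T g' → Agree T k f f' → Agree T k g g' →
    Agree T k (fun y ↦ f y * g y) fun y ↦ f' y * g' y
  | 0, _, _, _, _, _, _, _, _, _, _ => trivial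
  | _ + 1, _, _, _, _, hf, hg, hf', hg', h, h' =>
    ⟨fun y hy h0 ↦ by simp only [h.1 y hy h0, h'.1 y hy h0],
      (Agree.add hT (hf.mul (hg.partialDeriv hT 0)) (hg.mul (hf.partialDeriv hT 0))
        (hf'.mul (hg'.partialDeriv hT 0)) (hg'.mul (hf'.partialDeriv hT 0))
        (Agree.mul hT hf (hg.partialDeriv hT 0) hf' (hg'.partialDeriv hT 0) h.of_succ h'.2)
        (Agree.mul hT hg (hf.partialDeriv hT 0) hg' (hf'.partialDeriv hT 0) h'.of_succ h.2)).congr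
        hT (fun _ hy ↦ (partialDeriv_mul hT hf hg 0 hy).symm)
        fun _ hy ↦ (partialDeriv_mul hT hf' hg' 0 hy).symm⟩

theorem Agree.sub (hT : RelOpen T) (hf : Sm T f) (hg : Sm T g) (hf' : Sm T f') (hg' : Sm T g')
    (h : Agree T k f f') (h' : Agree T k g g') :
    Agree T k (fun y ↦ f y - g y) fun y ↦ f' y - g' y :=
  (Agree.add hT hf ((Sm.const (-1)).mul hg) hf' ((Sm.const (-1)).mul hg') h
    (Agree.mul hT (Sm.const (-1)) hg (Sm.const (-1)) hg' (Agree.refl T k _) h')).congr hT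
    (fun _ _ ↦ by ring) fun _ _ ↦ by ring

theorem Agree.sub_zero (hT : RelOpen T) (hf : Sm T f) (hg : Sm T g) (h : Agree T k f g) :
    Agree T k (fun y ↦ f y - g y) fun _ ↦ 0 :=
  (Agree.sub hT hf hg hg hg h (Agree.refl T k g)).congr hT (fun _ _ ↦ rfl) fun _ _ ↦ by ring

theorem Agree.of_sub_zero (hT : RelOpen T) (hf : Sm T f) (hg : Sm T g)
    (h : Agree T k (fun y ↦ f y - g y) fun _ ↦ 0) : Agree T k f g :=
  (Agree.add hT (hf.sub hg) hg (Sm.const 0) hg h (Agree.refl T k g)).congr hT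
    (fun _ _ ↦ by ring) fun _ _ ↦ by ring

theorem agree_succ_zero : Agree T (k + 1) f (fun _ ↦ 0) ↔
    (∀ y ∈ T, y 0 = 0 → f y = 0) ∧ Agree T k (SurfaceBVP.partialDeriv 0 f) fun _ ↦ 0 := by
  have : SurfaceBVP.partialDeriv 0 (fun _ ↦ (0 : ℝ)) = fun _ ↦ 0 := by
    funext y; simp
  rw [Agree, this]

theorem Agree.mul_zero (hT : RelOpen T) (hf : Sm T f) (hg : Sm T g)
    (h : Agree T k g fun _ ↦ 0) : Agree T k (fun y ↦ f y * g y) fun _ ↦ 0 :=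
  (Agree.mul hT hf hg hf (Sm.const 0) (Agree.refl T k f) h).congr hT (fun _ _ ↦ rfl)
    fun _ _ ↦ by ring

theorem Agree.add_zero (hT : RelOpen T) (hf : Sm T f) (hg : Sm T g)
    (h : Agree T k f fun _ ↦ 0) (h' : Agree T k g fun _ ↦ 0) :
    Agree T k (fun y ↦ f y + g y) fun _ ↦ 0 :=
  (Agree.add hT hf hg (Sm.const 0) (Sm.const 0) h h').congr hT (fun _ _ ↦ rfl)
    fun _ _ ↦ by ring

/-- The product of functions that vanish at the boundary to the orders `k` and `l` vanishes there
to the order `k + l`. -/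
theorem Agree.mul_zero_zero (hT : RelOpen T) : ∀ (n k l : ℕ), n = k + l → ∀ {f g : Plane → ℝ},
    Sm T f → Sm T g → Agree T k f (fun _ ↦ 0) → Agree T l g (fun _ ↦ 0) →
    Agree T n (fun y ↦ f y * g y) fun _ ↦ 0
  | 0, _, _, _, _, _, _, _, _, _ => trivial
  | n + 1, 0, l, hn, f, g, hf, hg, _, h' => by
    obtain rfl : n + 1 = l := by omega
    exact Agree.mul_zero hT hf hg h'
  | n + 1, k + 1, 0, hn, f, g, hf, hg, h, _ => by
    obtain rfl : n = k := by omega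
    exact (Agree.mul_zero hT hg hf h).congr hT (fun _ _ ↦ mul_comm _ _) fun _ _ ↦ rfl
  | n + 1, k + 1, l + 1, hn, f, g, hf, hg, h, h' => by
    refine agree_succ_zero.2 ⟨fun y hy h0 ↦ by rw [h.1 y hy h0, zero_mul], ?_⟩
    have hDf := hf.partialDeriv hT 0
    have hDg := hg.partialDeriv hT 0
    refine Agree.congr hT (Agree.add_zero hT (hf.mul hDg) (hg.mul hDf)
      (Agree.mul_zero_zero hT n (k + 1) l (by omega) hf hDg h (agree_succ_zero.1 h').2)
      (Agree.mul_zero_zero hT n (l + 1) k (by omega) hg hDf h' (agree_succ_zero.1 h).2))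
      (fun y hy ↦ (partialDeriv_mul hT hf hg 0 hy).symm) fun _ _ ↦ rfl

/-- No order is lost: agreement holds along the whole boundary part of T and so passes to tangential
derivatives, which commute with normal ones. -/
theorem Agree.partialDeriv_one (hT : RelOpen T) : ∀ {k : ℕ} {f g : Plane → ℝ}, Sm T f → Sm T g →
    Agree T k f g → Agree T k (partialDeriv 1 f) (partialDeriv 1 g)
  | 0, _, _, _, _, _ => trivial
  | _ + 1, _, _, hf, hg, h => ⟨fun _ hy h0 ↦ partialDeriv_one_congr hT hf hg h.1 hy h0,
      (Agree.partialDeriv_one hT (hf.partialDeriv hT 0) (hg.partialDeriv hT 0) h.2).congr hT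
        (fun _ hy ↦ partialDeriv_comm hT hf 1 0 hy) fun _ hy ↦ partialDeriv_comm hT hg 1 0 hy⟩

theorem Agree.succ_of_iterate : ∀ {k : ℕ} {f : Plane → ℝ}, Agree T k f (fun _ ↦ 0) →
    (∀ y ∈ T, y 0 = 0 → (partialDeriv 0)^[k] f y = 0) → Agree T (k + 1) f fun _ ↦ 0
  | 0, _, _, h => ⟨h, trivial⟩
  | _ + 1, _, h, h' => agree_succ_zero.2 ⟨h.1, Agree.succ_of_iterate (agree_succ_zero.1 h).2 h'⟩

theorem Agree.cancel (hT : RelOpen T) (hf : Sm T f) (hg : Sm T g) (hf' : Sm T f')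
    (h0 : ∀ y ∈ T, f' y ≠ 0)
    (h : Agree T k (fun y ↦ f' y * f y) fun y ↦ f' y * g y) : Agree T k f g :=
  (Agree.mul hT (hf'.inv h0) (hf'.mul hf) (hf'.inv h0) (hf'.mul hg) (Agree.refl T k _) h).congr hT
    (fun y hy ↦ by have := h0 y hy; field_simp) fun y hy ↦ by have := h0 y hy; field_simp

end


/-! ### Composition with a map close to the identity, and boundary jets of solutions -/

section

variable {T T' : Set Plane} {F : Plane → Plane}

/-- If `F` is the identity to order `k` at the boundary, then so is the composition with `F`. -/
theorem agree_comp (hT : RelOpen T) (hT' : RelOpen T') (hTT' : T ⊆ T') (hF : Sm T F)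
    (hm : MapsTo F T T') : ∀ {k : ℕ}, (∀ j, Agree T k (fun y ↦ F y j) fun y ↦ y j) →
    ∀ {U : Plane → ℝ}, Sm T' U → Agree T k (fun y ↦ U (F y)) U
  | 0, _, _, _ => trivial
  | k + 1, h, U, hU => by
    refine ⟨fun y hy h0 ↦ ?_, ?_⟩
    · have : F y = y := by ext j; exact (h j).1 y hy h0
      simp only [this]
    have s0 := hF.apply 0
    have s1 := hF.apply 1
    have d0 := (hU.partialDeriv hT' 0)
    have d1 := (hU.partialDeriv hT' 1)
    have c0 := d0.comp hT hT'.subset hF hm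
    have c1 := d1.comp hT hT'.subset hF hm
    have a0 := agree_comp hT hT' hTT' hF hm (fun j ↦ (h j).of_succ) d0
    have a1 := agree_comp hT hT' hTT' hF hm (fun j ↦ (h j).of_succ) d1
    refine (Agree.add hT (c0.mul (s0.partialDeriv hT 0)) (c1.mul (s1.partialDeriv hT 0))
      ((d0.mono hTT').mul ((Sm.coord 0).partialDeriv hT 0))
      ((d1.mono hTT').mul ((Sm.coord 1).partialDeriv hT 0))
      (Agree.mul hT c0 (s0.partialDeriv hT 0) (d0.mono hTT') ((Sm.coord 0).partialDeriv hT 0)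
        a0 (h 0).2)
      (Agree.mul hT c1 (s1.partialDeriv hT 0) (d1.mono hTT') ((Sm.coord 1).partialDeriv hT 0)
        a1 (h 1).2)).congr hT
      (fun y hy ↦ (partialDeriv_comp hT hT'.subset hU hF hm 0 hy).symm) fun y hy ↦ ?_
    rw [partialDeriv_coord hT 0 0 hy, partialDeriv_coord hT 0 1 hy]
    simp

/-- First order expansion of the composition with a map `F` that is the identity to order `k` at
the boundary. The remainder vanishes to order `2 k`. -/
theorem agree_comp_linear (hT : RelOpen T) (hT' : RelOpen T') (hTT' : T ⊆ T') (hF : Sm T F)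
    (hm : MapsTo F T T') {k : ℕ} (hk : 1 ≤ k)
    (h : ∀ j, Agree T k (fun y ↦ F y j - y j) fun _ ↦ 0) :
    ∀ {m : ℕ}, m ≤ 2 * k → ∀ {U : Plane → ℝ}, Sm T' U → Agree T m (fun y ↦ U (F y)) fun y ↦
      U y + ((F y 0 - y 0) * partialDeriv 0 U y + (F y 1 - y 1) * partialDeriv 1 U y)
  | 0, _, _, _ => trivial
  | m + 1, hmk, U, hU => by
    have hr : ∀ j, Sm T fun y ↦ F y j - y j := fun j ↦ (hF.apply j).sub (Sm.coord j)
    have hd : ∀ j, Sm T' (partialDeriv j U) := fun j ↦ hU.partialDeriv hT' j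
    have hdT : ∀ j, Sm T (partialDeriv j U) := fun j ↦ (hd j).mono hTT'
    have hddT : ∀ i j, Sm T (partialDeriv i (partialDeriv j U)) := fun i j ↦
      ((hd j).partialDeriv hT' i).mono hTT'
    have hUT := hU.mono hTT'
    have hrd : ∀ j, Sm T (partialDeriv 0 fun y ↦ F y j - y j) := fun j ↦ (hr j).partialDeriv hT 0
    have hc : ∀ j, Sm T fun y ↦ partialDeriv j U (F y) := fun j ↦
      (hd j).comp hT hT'.subset hF hm
    obtain ⟨k', rfl⟩ : ∃ k', k = k' + 1 := ⟨k - 1, by omega⟩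
    refine ⟨fun y hy h0 ↦ ?_, ?_⟩
    · have h1 : ∀ j, F y j - y j = 0 := fun j ↦ (h j).1 y hy h0
      have : F y = y := by ext j; linarith [h1 j]
      simp only [this]
      ring
    have hF' : ∀ j, Agree T (k' + 1) (fun y ↦ F y j) fun y ↦ y j := fun j ↦
      Agree.of_sub_zero hT (hF.apply j) (Sm.coord j) (h j)
    have ih := agree_comp_linear hT hT' hTT' hF hm hk h (by omega : m ≤ 2 * (k' + 1)) (hd 0)
    -- The error of replacing ∂ⱼU ∘ F by ∂ⱼU in the chain rule. With k = k' + 1, the factor ∂₀(Fⱼ -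
    -- yⱼ) vanishes to order k - 1 and the difference to order k, so the product vanishes to order
    -- 2k - 1 ≥ m.
    have q : ∀ j, Agree T m (fun y ↦ partialDeriv 0 (fun y ↦ F y j - y j) y *
        (partialDeriv j U (F y) - partialDeriv j U y)) fun _ ↦ 0 := fun j ↦
      (Agree.mul_zero_zero hT (k' + (k' + 1)) k' (k' + 1) rfl (hrd j) ((hc j).sub (hdT j))
        (agree_succ_zero.1 (h j)).2
        ((agree_comp hT hT' hTT' hF hm hF' (hd j)).sub_zero hT (hc j) (hdT j))).of_le (by omega)
    have hR : Sm T fun y ↦ partialDeriv 0 U y + ((F y 0 - y 0) * partialDeriv 0 (partialDeriv 0 U) y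
        + (F y 1 - y 1) * partialDeriv 1 (partialDeriv 0 U) y) :=
      (hdT 0).add (((hr 0).mul (hddT 0 0)).add ((hr 1).mul (hddT 1 0)))
    have hP : Sm T fun y ↦ partialDeriv 0 (fun y ↦ F y 0 - y 0) y * partialDeriv 0 U y +
        partialDeriv 0 (fun y ↦ F y 1 - y 1) y * partialDeriv 1 U y :=
      ((hrd 0).mul (hdT 0)).add ((hrd 1).mul (hdT 1))
    have q' := Agree.add_zero hT ((hrd 0).mul ((hc 0).sub (hdT 0)))
      ((hrd 1).mul ((hc 1).sub (hdT 1))) (q 0) (q 1)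
    have s1 := Agree.add hT (hc 0) hP hR hP ih (Agree.refl T m _)
    have s2 := Agree.add hT ((hc 0).add hP) (((hrd 0).mul ((hc 0).sub (hdT 0))).add
      ((hrd 1).mul ((hc 1).sub (hdT 1)))) (hR.add hP) (Sm.const 0) s1 q'
    refine s2.congr hT (fun y hy ↦ ?_) fun y hy ↦ ?_
    · rw [partialDeriv_comp hT hT'.subset hU hF hm 0 hy,
        partialDeriv_sub hT (hF.apply 0) (Sm.coord 0) 0 hy,
        partialDeriv_sub hT (hF.apply 1) (Sm.coord 1) 0 hy,
        partialDeriv_coord hT 0 0 hy, partialDeriv_coord hT 0 1 hy]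
      simp
      ring
    · rw [partialDeriv_add hT hUT (((hr 0).mul (hdT 0)).add ((hr 1).mul (hdT 1))) 0 hy,
        partialDeriv_add hT ((hr 0).mul (hdT 0)) ((hr 1).mul (hdT 1)) 0 hy,
        partialDeriv_mul hT (hr 0) (hdT 0) 0 hy, partialDeriv_mul hT (hr 1) (hdT 1) 0 hy,
        partialDeriv_comm hT hUT 1 0 hy]
      ring

/-- The equation `(Δ + q) u = 0` in boundary normal coordinates, where the metric is
`dy₀² + h dy₁²`. -/
def NormalFormEq (h q u : Plane → ℝ) (y : Plane) : Prop :=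
  -- Multiplication by 2h² clears the denominators, so that only sums and products of jets have to
  -- be compared.
  2 * h y * h y * partialDeriv 0 (partialDeriv 0 u) y =
    -(h y * partialDeriv 0 h y * partialDeriv 0 u y) - 2 * h y * partialDeriv 1 (partialDeriv 1 u) y
      + partialDeriv 1 h y * partialDeriv 1 u y + 2 * h y * h y * q y * u y

/-- Solutions with the same Cauchy data at the boundary agree there to infinite order if this holds
for the coefficients of the equations. -/
theorem agree_of_normalFormEq (hT : RelOpen T) {h₁ h₂ q₁ q₂ u₁ u₂ : Plane → ℝ}
    (hh₁ : Sm T h₁) (hh₂ : Sm T h₂) (hq₁ : Sm T q₁) (hq₂ : Sm T q₂) (hu₁ : Sm T u₁)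
    (hu₂ : Sm T u₂) (hpos : ∀ y ∈ T, 0 < h₁ y) (hh : ∀ k, Agree T k h₁ h₂)
    (hq : ∀ k, Agree T k q₁ q₂) (he₁ : ∀ y ∈ T, NormalFormEq h₁ q₁ u₁ y)
    (he₂ : ∀ y ∈ T, NormalFormEq h₂ q₂ u₂ y) (h2 : Agree T 2 u₁ u₂) (k : ℕ) :
    Agree T k u₁ u₂ := by
  suffices H : ∀ k, Agree T (k + 2) u₁ u₂ from (H k).of_succ.of_succ
  intro k
  induction k with
  | zero => exact h2
  | succ k ih =>
    -- The right side of the equation contains at most one normal derivative of u. Agreement of u to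
    -- order k + 2 thus gives agreement of the right side, and of ∂₀²u, to order k + 1, which is one
    -- order more for u.
    refine ⟨ih.1, ih.2.1, ?_⟩
    have D : ∀ {f : Plane → ℝ} (i), Sm T f → Sm T (partialDeriv i f) :=
      fun i hf ↦ hf.partialDeriv hT i
    have a0 : Agree T (k + 1) (partialDeriv 0 u₁) (partialDeriv 0 u₂) := ih.2
    have a1 := (ih.of_succ).partialDeriv_one hT hu₁ hu₂
    have a11 := a1.partialDeriv_one hT (D 1 hu₁) (D 1 hu₂)
    have b0 : Agree T (k + 1) (partialDeriv 0 h₁) (partialDeriv 0 h₂) := (hh (k + 2)).2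
    have b1 := (hh (k + 1)).partialDeriv_one hT hh₁ hh₂
    have hh2 := Agree.mul hT (Sm.const 2) hh₁ (Sm.const 2) hh₂ (Agree.refl T _ _) (hh (k + 1))
    have hhh := Agree.mul hT ((Sm.const 2).mul hh₁) hh₁ ((Sm.const 2).mul hh₂) hh₂ hh2 (hh (k + 1))
    have s2h₁ := (Sm.const 2).mul hh₁
    have s2h₂ := (Sm.const 2).mul hh₂
    have t1 := Agree.mul hT (hh₁.mul (D 0 hh₁)) (D 0 hu₁) (hh₂.mul (D 0 hh₂)) (D 0 hu₂)
      (Agree.mul hT hh₁ (D 0 hh₁) hh₂ (D 0 hh₂) (hh _) b0) a0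
    have t2 := Agree.mul hT s2h₁ (D 1 (D 1 hu₁)) s2h₂ (D 1 (D 1 hu₂)) hh2 a11
    have t3 := Agree.mul hT (D 1 hh₁) (D 1 hu₁) (D 1 hh₂) (D 1 hu₂) b1 a1
    have t4 := Agree.mul hT ((s2h₁.mul hh₁).mul hq₁) hu₁ ((s2h₂.mul hh₂).mul hq₂) hu₂
      (Agree.mul hT (s2h₁.mul hh₁) hq₁ (s2h₂.mul hh₂) hq₂ hhh (hq _)) ih.of_succ
    have n1₁ := (hh₁.mul (D 0 hh₁)).mul (D 0 hu₁)
    have n1₂ := (hh₂.mul (D 0 hh₂)).mul (D 0 hu₂)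
    have n2₁ := s2h₁.mul (D 1 (D 1 hu₁))
    have n2₂ := s2h₂.mul (D 1 (D 1 hu₂))
    have n3₁ := (D 1 hh₁).mul (D 1 hu₁)
    have n3₂ := (D 1 hh₂).mul (D 1 hu₂)
    have n4₁ := ((s2h₁.mul hh₁).mul hq₁).mul hu₁
    have n4₂ := ((s2h₂.mul hh₂).mul hq₂).mul hu₂
    have s := Agree.sub hT (n3₁.add n4₁) (n1₁.add n2₁) (n3₂.add n4₂) (n1₂.add n2₂)
      (Agree.add hT n3₁ n4₁ n3₂ n4₂ t3 t4) (Agree.add hT n1₁ n2₁ n1₂ n2₂ t1 t2)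
    refine Agree.cancel hT (D 0 (D 0 hu₁)) (D 0 (D 0 hu₂)) (s2h₁.mul hh₁)
      (fun y hy ↦ by have := hpos y hy; positivity) ?_
    have r : Agree T (k + 1) (fun y ↦ 2 * h₁ y * h₁ y * partialDeriv 0 (partialDeriv 0 u₁) y)
        fun y ↦ 2 * h₂ y * h₂ y * partialDeriv 0 (partialDeriv 0 u₂) y :=
      s.congr hT (fun y hy ↦ by have := he₁ y hy; rw [NormalFormEq] at this; rw [this]; ring)
        (fun y hy ↦ by have := he₂ y hy; rw [NormalFormEq] at this; rw [this]; ring)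
    exact r.trans (Agree.mul hT (s2h₂.mul hh₂) (D 0 (D 0 hu₂)) (s2h₁.mul hh₁) (D 0 (D 0 hu₂))
      hhh.symm (Agree.refl T _ _))

end


/-! ### Determination of the boundary jet of the map -/

section

variable {T T' : Set Plane}

theorem iterate_partialDeriv_congr (hT : RelOpen T) : ∀ (k : ℕ) {f g : Plane → ℝ},
    (∀ y ∈ T, f y = g y) → ∀ y ∈ T, (partialDeriv 0)^[k] f y = (partialDeriv 0)^[k] g y
  | 0, _, _, h => h
  | k + 1, _, _, h => iterate_partialDeriv_congr hT k (partialDeriv_congr hT h 0)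

theorem Sm.iterate (hT : RelOpen T) : ∀ (k : ℕ) {f : Plane → ℝ}, Sm T f →
    Sm T ((SurfaceBVP.partialDeriv 0)^[k] f)
  | 0, _, h => h
  | k + 1, _, h => Sm.iterate hT k (h.partialDeriv hT 0)

theorem iterate_partialDeriv_add (hT : RelOpen T) : ∀ (k : ℕ) {f g : Plane → ℝ},
    Sm T f → Sm T g → ∀ y ∈ T, (partialDeriv 0)^[k] (fun y ↦ f y + g y) y =
      (partialDeriv 0)^[k] f y + (partialDeriv 0)^[k] g y
  | 0, _, _, _, _ => fun _ _ ↦ rfl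
  | k + 1, _, _, hf, hg => fun y hy ↦
    (iterate_partialDeriv_congr hT k (fun _ hy ↦ partialDeriv_add hT hf hg 0 hy) y hy).trans
      (iterate_partialDeriv_add hT k (hf.partialDeriv hT 0) (hg.partialDeriv hT 0) y hy)

/-- The two leading normal Taylor coefficients of `r₀ w₀ + r₁ w₁ + p₀ ∂₀w₀ + p₁ ∂₀w₁` for functions
`r` that vanish to order `k` and functions `p` that vanish to order `k + 1`. -/
theorem leading_coefficients (hT : RelOpen T) {w : Fin 2 → Plane → ℝ} (hw : ∀ j, Sm T (w j)) :
    ∀ (k : ℕ) {r p : Fin 2 → Plane → ℝ}, (∀ j, Sm T (r j)) → (∀ j, Sm T (p j)) →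
    (∀ j, Agree T k (r j) fun _ ↦ 0) → (∀ j, Agree T (k + 1) (p j) fun _ ↦ 0) →
    (Agree T (k + 2) (fun y ↦ (r 0 y * w 0 y + r 1 y * w 1 y) +
      (p 0 y * partialDeriv 0 (w 0) y + p 1 y * partialDeriv 0 (w 1) y)) fun _ ↦ 0) →
    ∀ y ∈ T, y 0 = 0 →
      (partialDeriv 0)^[k] (r 0) y * w 0 y + (partialDeriv 0)^[k] (r 1) y * w 1 y = 0 ∧
      (partialDeriv 0)^[k + 1] (r 0) y * w 0 y + (partialDeriv 0)^[k + 1] (r 1) y * w 1 y +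
      (((k + 1) * (partialDeriv 0)^[k] (r 0) y + (partialDeriv 0)^[k + 1] (p 0) y) *
          partialDeriv 0 (w 0) y +
        ((k + 1) * (partialDeriv 0)^[k] (r 1) y + (partialDeriv 0)^[k + 1] (p 1) y) *
          partialDeriv 0 (w 1) y) = 0 := by
  have D : ∀ {f : Plane → ℝ}, Sm T f → Sm T (partialDeriv 0 f) := fun hf ↦ hf.partialDeriv hT 0
  -- A normal derivative preserves the shape of the expression: r becomes ∂₀r and p becomes r + ∂₀p,
  -- up to the term p · ∂₀²w, which vanishes to the same order as p and can be dropped. The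
  -- functions p are there only to make the induction close.
  have key : ∀ {r p : Fin 2 → Plane → ℝ}, (∀ j, Sm T (r j)) → (∀ j, Sm T (p j)) → ∀ y ∈ T,
      partialDeriv 0 (fun y ↦ (r 0 y * w 0 y + r 1 y * w 1 y) +
        (p 0 y * partialDeriv 0 (w 0) y + p 1 y * partialDeriv 0 (w 1) y)) y =
      ((partialDeriv 0 (r 0) y * w 0 y + partialDeriv 0 (r 1) y * w 1 y) +
        ((r 0 y + partialDeriv 0 (p 0) y) * partialDeriv 0 (w 0) y +
          (r 1 y + partialDeriv 0 (p 1) y) * partialDeriv 0 (w 1) y)) +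
      (partialDeriv 0 (partialDeriv 0 (w 0)) y * p 0 y +
        partialDeriv 0 (partialDeriv 0 (w 1)) y * p 1 y) := by
    intro r p hr hp y hy
    have n1 : ∀ j, Sm T fun y ↦ r j y * w j y := fun j ↦ (hr j).mul (hw j)
    have n2 : ∀ j, Sm T fun y ↦ p j y * partialDeriv 0 (w j) y := fun j ↦ (hp j).mul (D (hw j))
    rw [partialDeriv_add hT ((n1 0).add (n1 1)) ((n2 0).add (n2 1)) 0 hy,
      partialDeriv_add hT (n1 0) (n1 1) 0 hy, partialDeriv_add hT (n2 0) (n2 1) 0 hy,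
      partialDeriv_mul hT (hr 0) (hw 0) 0 hy, partialDeriv_mul hT (hr 1) (hw 1) 0 hy,
      partialDeriv_mul hT (hp 0) (D (hw 0)) 0 hy, partialDeriv_mul hT (hp 1) (D (hw 1)) 0 hy]
    ring
  intro k
  induction k with
  | zero =>
    intro r p hr hp _ hp0 h y hy h0
    have e1 := h.1 y hy h0
    have e2 := (agree_succ_zero.1 h).2.1 y hy h0
    have e3 : ∀ j, p j y = 0 := fun j ↦ (hp0 j).1 y hy h0
    rw [key hr hp y hy] at e2
    simp only [e3] at e1 e2
    constructor
    · simpa using e1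
    · simp only [Function.iterate_zero, Function.iterate_succ, Function.comp, id]
      push_cast
      linarith
  | succ k ih =>
    intro r p hr hp hr0 hp0 h y hy h0
    have hDr : ∀ j, Sm T (partialDeriv 0 (r j)) := fun j ↦ D (hr j)
    have hDp : ∀ j, Sm T fun y ↦ r j y + partialDeriv 0 (p j) y := fun j ↦ (hr j).add (D (hp j))
    have hA : Agree T (k + 2) (fun y ↦ (partialDeriv 0 (r 0) y * w 0 y +
        partialDeriv 0 (r 1) y * w 1 y) + ((r 0 y + partialDeriv 0 (p 0) y) * partialDeriv 0 (w 0) y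
        + (r 1 y + partialDeriv 0 (p 1) y) * partialDeriv 0 (w 1) y)) fun _ ↦ 0 := by
      have n1 := ((hDr 0).mul (hw 0)).add ((hDr 1).mul (hw 1))
      have n2 := ((hDp 0).mul (D (hw 0))).add ((hDp 1).mul (D (hw 1)))
      have n3 := (D (D (hw 0))).mul (hp 0)
      have n4 := (D (D (hw 1))).mul (hp 1)
      have a1 := (agree_succ_zero.1 h).2.congr hT (key hr hp) fun _ _ ↦ rfl
      have a2 := Agree.add_zero hT n3 n4 ((hp0 0).mul_zero hT (D (D (hw 0))) (hp 0))
        ((hp0 1).mul_zero hT (D (D (hw 1))) (hp 1))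
      exact (Agree.sub hT ((n1.add n2).add (n3.add n4)) (n3.add n4) (Sm.const 0) (Sm.const 0)
        a1 a2).congr hT (fun y _ ↦ by ring) fun _ _ ↦ by ring
    have h1 := ih (r := fun j ↦ partialDeriv 0 (r j))
      (p := fun j y ↦ r j y + partialDeriv 0 (p j) y) hDr hDp
      (fun j ↦ (agree_succ_zero.1 (hr0 j)).2)
      (fun j ↦ Agree.add_zero hT (hr j) (D (hp j)) (hr0 j) (agree_succ_zero.1 (hp0 j)).2)
      hA y hy h0
    refine ⟨h1.1, ?_⟩
    have h2 := h1.2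
    rw [iterate_partialDeriv_add hT (k + 1) (hr 0) (D (hp 0)) y hy,
      iterate_partialDeriv_add hT (k + 1) (hr 1) (D (hp 1)) y hy] at h2
    simp only [Function.iterate_succ, Function.comp] at h2 ⊢
    push_cast
    linarith

/-- A pair of solutions on the two surfaces in boundary normal coordinates: `u₁ = u₂ ∘ F`, and the
normal derivatives of `u₁` and `u₂` at the boundary agree. -/
structure IsSolutionPair (T T' : Set Plane) (F : Plane → Plane) (h q u₁ u₂ : Plane → ℝ) :
    Prop where
  smooth₁ : Sm T u₁
  smooth₂ : Sm T' u₂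
  comp_eq : ∀ y ∈ T, u₁ y = u₂ (F y)
  agree : ∀ k, Agree T k u₁ u₂
  eqn : ∀ y ∈ T, NormalFormEq h q u₂ y

variable {F : Plane → Plane} {h q : Plane → ℝ}

theorem agree_succ_of_solutionPairs (hT : RelOpen T) (hT' : RelOpen T') (hTT' : T ⊆ T')
    (hF : Sm T F) (hm : MapsTo F T T') (hpos : ∀ y ∈ T, 0 < h y) {k : ℕ} (hk : 2 ≤ k)
    (hr : ∀ j, Agree T k (fun y ↦ F y j - y j) fun _ ↦ 0)
    (hjet : ∀ y ∈ T, y 0 = 0 → ∀ c d : ℝ, ∃ u₁ u₂, IsSolutionPair T T' F h q u₁ u₂ ∧ u₂ y = 0 ∧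
      partialDeriv 1 u₂ y = c ∧ partialDeriv 1 (partialDeriv 1 u₂) y = d) (j : Fin 2) :
    Agree T (k + 1) (fun y ↦ F y j - y j) fun _ ↦ 0 := by
  have hrs : ∀ j, Sm T fun y ↦ F y j - y j := fun j ↦ (hF.apply j).sub (Sm.coord j)
  set s : Fin 2 → Plane → ℝ := fun j ↦ (partialDeriv 0)^[k] fun y ↦ F y j - y j with hs
  have hss : ∀ j, Sm T (s j) := fun j ↦ (hrs j).iterate hT k
  have key : ∀ {u₁ u₂ : Plane → ℝ}, IsSolutionPair T T' F h q u₁ u₂ → ∀ y ∈ T, y 0 = 0 →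
      s 0 y * partialDeriv 0 u₂ y + s 1 y * partialDeriv 1 u₂ y = 0 ∧
      partialDeriv 0 (s 0) y * partialDeriv 0 u₂ y + partialDeriv 0 (s 1) y * partialDeriv 1 u₂ y +
      (k + 1) * (s 0 y * partialDeriv 0 (partialDeriv 0 u₂) y +
        s 1 y * partialDeriv 0 (partialDeriv 1 u₂) y) = 0 := by
    intro u₁ u₂ hu
    have hw : ∀ j, Sm T (partialDeriv j u₂) := fun j ↦ (hu.smooth₂.partialDeriv hT' j).mono hTT'
    have hG := ((hrs 0).mul (hw 0)).add ((hrs 1).mul (hw 1))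
    have hU := hu.smooth₂.mono hTT'
    -- The remainder of the linearization vanishes to order 2k, and order k + 2 is needed: this is
    -- where k ≥ 2 is used.
    have a1 := agree_comp_linear hT hT' hTT' hF hm (by omega) hr (by omega : k + 2 ≤ 2 * k)
      hu.smooth₂
    have a2 := ((hu.agree (k + 2)).symm.congr hT (fun _ _ ↦ rfl) hu.comp_eq).trans a1
    have a3 := Agree.sub hT hU hU (hU.add hG) hU a2 (Agree.refl T _ _)
    have a4 : Agree T (k + 2) (fun y ↦ ((F y 0 - y 0) * partialDeriv 0 u₂ y +
        (F y 1 - y 1) * partialDeriv 1 u₂ y) + (0 * partialDeriv 0 (partialDeriv 0 u₂) y +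
        0 * partialDeriv 0 (partialDeriv 1 u₂) y)) fun _ ↦ 0 :=
      a3.symm.congr hT (fun y _ ↦ by ring) fun y _ ↦ by ring
    intro y hy h0
    have := leading_coefficients hT (w := fun j ↦ partialDeriv j u₂) hw k
      (r := fun j y ↦ F y j - y j) (p := fun _ _ ↦ 0) hrs (fun _ ↦ Sm.const 0) hr
      (fun _ ↦ Agree.refl T _ _) a4 y hy h0
    have z : ∀ (m : ℕ), (partialDeriv 0)^[m] (fun _ ↦ (0 : ℝ)) = fun _ ↦ 0 := by
      intro m
      refine Function.iterate_fixed ?_ m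
      funext y; simp
    simp only [z, Function.iterate_succ_apply'] at this
    refine ⟨this.1, ?_⟩
    have h2 := this.2
    simp only [hs]
    linarith
  -- The tangential derivative of s · ∇u₂ = 0, a relation that holds along the boundary.
  have key1 : ∀ {u₁ u₂ : Plane → ℝ}, IsSolutionPair T T' F h q u₁ u₂ → ∀ y ∈ T, y 0 = 0 →
      (s 0 y * partialDeriv 1 (partialDeriv 0 u₂) y + partialDeriv 0 u₂ y * partialDeriv 1 (s 0) y) +
      (s 1 y * partialDeriv 1 (partialDeriv 1 u₂) y + partialDeriv 1 u₂ y * partialDeriv 1 (s 1) y)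
        = 0 := by
    intro u₁ u₂ hu y hy h0
    have hw : ∀ j, Sm T (partialDeriv j u₂) := fun j ↦ (hu.smooth₂.partialDeriv hT' j).mono hTT'
    have := partialDeriv_one_congr hT (((hss 0).mul (hw 0)).add ((hss 1).mul (hw 1))) (Sm.const 0)
      (fun y hy h0 ↦ (key hu y hy h0).1) hy h0
    rwa [partialDeriv_add hT ((hss 0).mul (hw 0)) ((hss 1).mul (hw 1)) 1 hy,
      partialDeriv_mul hT (hss 0) (hw 0) 1 hy, partialDeriv_mul hT (hss 1) (hw 1) 1 hy,
      partialDeriv_const] at this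
  have hs0 : ∀ y ∈ T, y 0 = 0 → s 0 y = 0 := by
    intro y hy h0
    by_contra hne
    -- Value 0, slope 0, second derivative 1. As s₀ ≠ 0, the relation s · ∇u₂ = 0 then forces the
    -- uncontrolled derivative ∂₀u₂ to vanish too, so only second derivatives remain in the other
    -- relations.
    obtain ⟨u₁, u₂, hu, v0, v1, v2⟩ := hjet y hy h0 0 1
    obtain ⟨e1, e3⟩ := key hu y hy h0
    have e2 := key1 hu y hy h0
    have e4 := hu.eqn y hy
    have hh := hpos y hy
    have hc := partialDeriv_comm hT (hu.smooth₂.mono hTT') 1 0 hy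
    rw [NormalFormEq] at e4
    have va : partialDeriv 0 u₂ y = 0 := by
      rw [v1] at e1
      simpa [hne] using e1
    rw [hc] at e2
    simp only [v0, v1, v2, va] at e2 e3 e4
    generalize partialDeriv 0 (partialDeriv 0 u₂) y = U00 at *
    generalize partialDeriv 0 (partialDeriv 1 u₂) y = U01 at *
    have e5 : h y * U00 = -1 := by
      have : (2 * h y) * (h y * U00) = (2 * h y) * (-1) := by linarith
      exact mul_left_cancel₀ (by positivity) this
    have e6 : s 0 y * U00 + s 1 y * U01 = 0 := by
      have : ((k : ℝ) + 1) * (s 0 y * U00 + s 1 y * U01) = 0 := by linarith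
      rcases mul_eq_zero.1 this with h' | h'
      · exfalso
        have : (0 : ℝ) ≤ k := Nat.cast_nonneg k
        linarith
      · exact h'
    have e7 : s 1 y = -(s 0 y * U01) := by linarith
    rw [e7] at e6
    have e8 : s 0 y * (U00 - U01 ^ 2) = 0 := by linarith
    have e9 : U00 = U01 ^ 2 := by
      rcases mul_eq_zero.1 e8 with h' | h'
      · exact absurd h' hne
      · linarith
    -- The contradiction: ∂₀²u₂ is a square, while the equation gives h ∂₀²u₂ = -1.
    rw [e9] at e5
    have : 0 ≤ h y * U01 ^ 2 := by positivity
    linarith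
  have hs1 : ∀ y ∈ T, y 0 = 0 → s 1 y = 0 := by
    intro y hy h0
    obtain ⟨u₁, u₂, hu, v0, v1, v2⟩ := hjet y hy h0 1 0
    have e1 := (key hu y hy h0).1
    rw [hs0 y hy h0, v1] at e1
    linarith
  refine Agree.succ_of_iterate (hr j) ?_
  fin_cases j
  exacts [hs0, hs1]

/-- First derivatives of F enter nonlinearly. Let A = ∂₀F₀, B = ∂₀F₁ and Uᵢⱼ = ∂ᵢ∂ⱼu₂ at a boundary
point, with boundary values of slope 0 and second derivative 1. If A ≠ 1, then ∇u₂ = 0, B = (1 - A)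
U₀₁ and U₀₀ = A² U₀₀ + 2AB U₀₁ + B². Together these give (1 - A)(1 + A)(U₀₀ - U₀₁²) = 0, and U₀₀ =
U₀₁² contradicts the equation as before. -/
theorem agree_two_of_solutionPairs (hT : RelOpen T) (hT' : RelOpen T') (hTT' : T ⊆ T')
    (hF : Sm T F) (hm : MapsTo F T T') (hpos : ∀ y ∈ T, 0 < h y)
    (hr : ∀ y ∈ T, y 0 = 0 → F y = y)
    (hjet : ∀ y ∈ T, y 0 = 0 → ∀ c d : ℝ, ∃ u₁ u₂, IsSolutionPair T T' F h q u₁ u₂ ∧ u₂ y = 0 ∧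
      partialDeriv 1 u₂ y = c ∧ partialDeriv 1 (partialDeriv 1 u₂) y = d) (j : Fin 2) :
    Agree T 2 (fun y ↦ F y j - y j) fun _ ↦ 0 := by
  have hFj : ∀ j, Sm T fun y ↦ F y j := fun j ↦ hF.apply j
  set α : Plane → ℝ := partialDeriv 0 fun y ↦ F y 0 with hα
  set β : Plane → ℝ := partialDeriv 0 fun y ↦ F y 1 with hβ
  have hαs : Sm T α := (hFj 0).partialDeriv hT 0
  have hβs : Sm T β := (hFj 1).partialDeriv hT 0
  have first : ∀ {u₁ u₂ : Plane → ℝ}, IsSolutionPair T T' F h q u₁ u₂ → ∀ y ∈ T,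
      partialDeriv 0 u₁ y = partialDeriv 0 u₂ (F y) * α y + partialDeriv 1 u₂ (F y) * β y := by
    intro u₁ u₂ hu y hy
    rw [partialDeriv_congr hT hu.comp_eq 0 y hy,
      partialDeriv_comp hT hT'.subset hu.smooth₂ hF hm 0 hy]
  have key : ∀ {u₁ u₂ : Plane → ℝ}, IsSolutionPair T T' F h q u₁ u₂ → ∀ y ∈ T, y 0 = 0 →
      partialDeriv 0 u₂ y = partialDeriv 0 u₂ y * α y + partialDeriv 1 u₂ y * β y := by
    intro u₁ u₂ hu y hy h0
    have := first hu y hy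
    rwa [hr y hy h0, (hu.agree 2).2.1 y hy h0] at this
  have hα1 : ∀ y ∈ T, y 0 = 0 → α y = 1 := by
    intro y hy h0
    by_contra hne
    obtain ⟨u₁, u₂, hu, v0, v1, v2⟩ := hjet y hy h0 0 1
    have e1 := key hu y hy h0
    have hw' : ∀ j, Sm T' (partialDeriv j u₂) := fun j ↦ hu.smooth₂.partialDeriv hT' j
    have hw : ∀ j, Sm T (partialDeriv j u₂) := fun j ↦ (hw' j).mono hTT'
    have hc := partialDeriv_comm hT (hu.smooth₂.mono hTT') 1 0 hy
    have va : partialDeriv 0 u₂ y = 0 := by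
      rw [v1] at e1
      have : partialDeriv 0 u₂ y * (1 - α y) = 0 := by linarith
      rcases mul_eq_zero.1 this with h' | h'
      · exact h'
      · exact absurd (by linarith : α y = 1) hne
    have e2 := partialDeriv_one_congr hT (hw 0)
      (((hw 0).mul hαs).add ((hw 1).mul hβs)) (fun y hy h0 ↦ key hu y hy h0) hy h0
    rw [partialDeriv_add hT ((hw 0).mul hαs) ((hw 1).mul hβs) 1 hy,
      partialDeriv_mul hT (hw 0) hαs 1 hy, partialDeriv_mul hT (hw 1) hβs 1 hy, va, v1, v2, hc]
      at e2
    have hcs : ∀ j, Sm T fun y ↦ partialDeriv j u₂ (F y) := fun j ↦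
      (hw' j).comp hT hT'.subset hF hm
    have e3 := partialDeriv_congr hT (first hu) 0 y hy
    rw [partialDeriv_add hT ((hcs 0).mul hαs) ((hcs 1).mul hβs) 0 hy,
      partialDeriv_mul hT (hcs 0) hαs 0 hy, partialDeriv_mul hT (hcs 1) hβs 0 hy,
      partialDeriv_comp hT hT'.subset (hw' 0) hF hm 0 hy,
      partialDeriv_comp hT hT'.subset (hw' 1) hF hm 0 hy, hr y hy h0,
      (hu.agree 3).2.2.1 y hy h0, va, v1, v2, hc, ← hα, ← hβ] at e3
    have e4 := hu.eqn y hy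
    have hh := hpos y hy
    rw [NormalFormEq] at e4
    simp only [v0, v1, v2, va] at e4
    -- F maps T into the half plane and fixes y, so F₀ has a minimum there. This sign makes 1 + A
    -- positive and rules out A = -1.
    have hα0 : 0 ≤ α y := partialDeriv_zero_nonneg hT (hFj 0)
      (fun z hz ↦ mem_halfPlane.1 (hT'.subset (hm hz))) hy (by rw [hr y hy h0, h0])
    generalize partialDeriv 0 (partialDeriv 0 u₂) y = U00 at *
    generalize partialDeriv 0 (partialDeriv 1 u₂) y = U01 at *
    generalize α y = A at *
    generalize β y = B at *
    have e5 : h y * U00 = -1 := by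
      have : (2 * h y) * (h y * U00) = (2 * h y) * (-1) := by linarith
      exact mul_left_cancel₀ (by positivity) this
    have e6 : B = (1 - A) * U01 := by linarith
    have e7 : (1 - A) * ((1 + A) * (U00 - U01 ^ 2)) = 0 := by
      rw [e6] at e3
      linear_combination e3
    have e8 : U00 = U01 ^ 2 := by
      rcases mul_eq_zero.1 e7 with h' | h'
      · exact absurd (by linarith : A = 1) hne
      · rcases mul_eq_zero.1 h' with h' | h'
        · linarith
        · linarith
    rw [e8] at e5
    have : 0 ≤ h y * U01 ^ 2 := by positivity
    linarith
  have hβ0 : ∀ y ∈ T, y 0 = 0 → β y = 0 := by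
    intro y hy h0
    obtain ⟨u₁, u₂, hu, v0, v1, v2⟩ := hjet y hy h0 1 0
    have e1 := key hu y hy h0
    rw [hα1 y hy h0, v1] at e1
    linarith
  refine ⟨fun y hy h0 ↦ by simp only [hr y hy h0, sub_self], fun y hy h0 ↦ ?_, trivial⟩
  rw [partialDeriv_sub hT (hFj j) (Sm.coord j) 0 hy, partialDeriv_coord hT 0 j hy,
    partialDeriv_const]
  fin_cases j
  · simpa [hα, sub_eq_zero] using hα1 y hy h0
  · simpa [hβ] using hβ0 y hy h0

/-- A map that intertwines the solutions of two boundary value problems and is the identity on the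
boundary is the identity to infinite order at the boundary. -/
theorem agree_of_solutionPairs (hT : RelOpen T) (hT' : RelOpen T') (hTT' : T ⊆ T')
    (hF : Sm T F) (hm : MapsTo F T T') (hpos : ∀ y ∈ T, 0 < h y)
    (hr : ∀ y ∈ T, y 0 = 0 → F y = y)
    (hjet : ∀ y ∈ T, y 0 = 0 → ∀ c d : ℝ, ∃ u₁ u₂, IsSolutionPair T T' F h q u₁ u₂ ∧ u₂ y = 0 ∧
      partialDeriv 1 u₂ y = c ∧ partialDeriv 1 (partialDeriv 1 u₂) y = d) (k : ℕ) (j : Fin 2) :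
    Agree T k (fun y ↦ F y j - y j) fun _ ↦ 0 := by
  suffices H : ∀ k, ∀ j, Agree T (k + 2) (fun y ↦ F y j - y j) fun _ ↦ 0 from
    (H k j).of_succ.of_succ
  intro k
  induction k with
  | zero => exact fun j ↦ agree_two_of_solutionPairs hT hT' hTT' hF hm hpos hr hjet j
  | succ k ih =>
    exact fun j ↦ agree_succ_of_solutionPairs hT hT' hTT' hF hm hpos (by omega) ih hjet j

end


/-! ### From normal derivatives to Taylor series and remainder bounds -/

theorem fderivWithin_eq_sum_partialDeriv (f : Plane → ℝ) : fderivWithin ℝ f halfPlane =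
    (ContinuousLinearMap.smulRight (1 : ℝ →L[ℝ] ℝ) (EuclideanSpace.proj (𝕜 := ℝ) (0 : Fin 2) :
      Plane →L[ℝ] ℝ) ∘ partialDeriv 0 f) +
    (ContinuousLinearMap.smulRight (1 : ℝ →L[ℝ] ℝ) (EuclideanSpace.proj (𝕜 := ℝ) (1 : Fin 2) :
      Plane →L[ℝ] ℝ) ∘ partialDeriv 1 f) := by
  funext y
  ext v
  rw [fderivWithin_apply_eq]
  simp [mul_comm]

section

variable {T : Set Plane}

/-- Functions whose normal derivatives of all orders agree at the boundary have the same Taylor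
series there. -/
theorem sameTaylorSeriesAt_of_agree (hT : RelOpen T) {f g : Plane → ℝ} (hf : Sm T f) (hg : Sm T g)
    (h : ∀ k, Agree T k f g) {y : Plane} (hy : y ∈ T) (h0 : y 0 = 0) :
    SameTaylorSeriesAt f g y := by
  intro n
  have hyH := hT.subset hy
  induction n generalizing f g with
  | zero =>
    ext m
    simp only [iteratedFDerivWithin_zero_apply]
    exact (h 1).1 y hy h0
  | succ n ih =>
    rw [iteratedFDerivWithin_succ_eq_comp_right uniqueDiffOn_halfPlane hyH,
      iteratedFDerivWithin_succ_eq_comp_right uniqueDiffOn_halfPlane hyH]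
    simp only [Function.comp]
    congr 1
    have a0 := ih (hf.partialDeriv hT 0) (hg.partialDeriv hT 0) fun k ↦ (h (k + 1)).2
    have a1 := ih (hf.partialDeriv hT 1) (hg.partialDeriv hT 1)
      fun k ↦ (h k).partialDeriv_one hT hf hg
    have hs : ∀ {k : Plane → ℝ} (i), Sm T k → ContDiffWithinAt ℝ n (partialDeriv i k) halfPlane y :=
      fun i hk ↦ (hk.partialDeriv hT i y hy).of_le (by exact_mod_cast le_top)
    have key : ∀ {k : Plane → ℝ}, Sm T k →
        iteratedFDerivWithin ℝ n (fderivWithin ℝ k halfPlane) halfPlane y =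
        (ContinuousLinearMap.smulRight (1 : ℝ →L[ℝ] ℝ) (EuclideanSpace.proj (𝕜 := ℝ) (0 : Fin 2) :
          Plane →L[ℝ] ℝ)).compContinuousMultilinearMap
            (iteratedFDerivWithin ℝ n (partialDeriv 0 k) halfPlane y) +
        (ContinuousLinearMap.smulRight (1 : ℝ →L[ℝ] ℝ) (EuclideanSpace.proj (𝕜 := ℝ) (1 : Fin 2) :
          Plane →L[ℝ] ℝ)).compContinuousMultilinearMap
            (iteratedFDerivWithin ℝ n (partialDeriv 1 k) halfPlane y) := by
      intro k hk
      rw [fderivWithin_eq_sum_partialDeriv, iteratedFDerivWithin_add_apply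
        ((ContinuousLinearMap.contDiff _).contDiffAt.comp_contDiffWithinAt y (hs 0 hk))
        ((ContinuousLinearMap.contDiff _).contDiffAt.comp_contDiffWithinAt y (hs 1 hk))
        uniqueDiffOn_halfPlane hyH,
        ContinuousLinearMap.iteratedFDerivWithin_comp_left _ (hs 0 hk) uniqueDiffOn_halfPlane hyH
          le_rfl,
        ContinuousLinearMap.iteratedFDerivWithin_comp_left _ (hs 1 hk) uniqueDiffOn_halfPlane hyH
          le_rfl]
    rw [key hf, key hg, a0, a1]

theorem SameTaylorSeriesAt.partialDeriv (hT : RelOpen T) {f g : Plane → ℝ} (hf : Sm T f)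
    (hg : Sm T g) {y : Plane} (hy : y ∈ T) (h : SameTaylorSeriesAt f g y) (i : Fin 2) :
    SameTaylorSeriesAt (partialDeriv i f) (partialDeriv i g) y := by
  intro n
  have hyH := hT.subset hy
  have h1 := h (n + 1)
  rw [iteratedFDerivWithin_succ_eq_comp_right uniqueDiffOn_halfPlane hyH,
    iteratedFDerivWithin_succ_eq_comp_right uniqueDiffOn_halfPlane hyH] at h1
  have h2 := LinearIsometryEquiv.injective _ h1
  have key : ∀ {k : Plane → ℝ}, Sm T k → iteratedFDerivWithin ℝ n (SurfaceBVP.partialDeriv i k)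
      halfPlane y = (ContinuousLinearMap.apply ℝ ℝ (e i)).compContinuousMultilinearMap
        (iteratedFDerivWithin ℝ n (fderivWithin ℝ k halfPlane) halfPlane y) := by
    intro k hk
    have hd : ContDiffWithinAt ℝ n (fderivWithin ℝ k halfPlane) halfPlane y :=
      ((hk y hy).fderivWithin_right uniqueDiffOn_halfPlane (m := ∞) (by simp) hyH).of_le
        (by exact_mod_cast le_top)
    rw [← ContinuousLinearMap.iteratedFDerivWithin_comp_left _ hd uniqueDiffOn_halfPlane hyH le_rfl]
    rfl
  rw [key hf, key hg, h2]

theorem agree_of_sameTaylorSeriesAt (hT : RelOpen T) : ∀ (k : ℕ) {f g : Plane → ℝ}, Sm T f →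
    Sm T g → (∀ y ∈ T, y 0 = 0 → SameTaylorSeriesAt f g y) → Agree T k f g
  | 0, _, _, _, _, _ => trivial
  | k + 1, f, g, hf, hg, h => by
    refine ⟨fun y hy h0 ↦ ?_, agree_of_sameTaylorSeriesAt hT k (hf.partialDeriv hT 0)
      (hg.partialDeriv hT 0) fun y hy h0 ↦ (h y hy h0).partialDeriv hT hf hg hy 0⟩
    have := h y hy h0 0
    simpa using congr($this 0)

/-- The Taylor series of maps into the plane agree if this holds for the coordinates. -/
theorem sameTaylorSeriesAt_plane (hT : RelOpen T) {F G : Plane → Plane} (hF : Sm T F)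
    (hG : Sm T G) {y : Plane} (hy : y ∈ T)
    (h : ∀ j, SameTaylorSeriesAt (fun y ↦ F y j) (fun y ↦ G y j) y) : SameTaylorSeriesAt F G y := by
  intro n
  have hyH := hT.subset hy
  have key : ∀ {k : Plane → Plane} (j : Fin 2), Sm T k →
      iteratedFDerivWithin ℝ n (fun y ↦ k y j) halfPlane y =
      (EuclideanSpace.proj (𝕜 := ℝ) j : Plane →L[ℝ] ℝ).compContinuousMultilinearMap
        (iteratedFDerivWithin ℝ n k halfPlane y) := by
    intro k j hk
    rw [← ContinuousLinearMap.iteratedFDerivWithin_comp_left _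
      ((hk y hy).of_le (by exact_mod_cast le_top : (n : WithTop ℕ∞) ≤ ∞)) uniqueDiffOn_halfPlane
      hyH le_rfl]
    rfl
  ext m j
  have := h j n
  rw [key j hF, key j hG] at this
  exact congr($this m)

/-- By the mean value inequality along the normal segment from the boundary to z, the bound for ∂₀f
gains one power of z₀. Moving towards the boundary decreases the distance to a boundary point x, so
the segment stays in the ball, and the same δ and C serve for f as for ∂₀f. -/
theorem abs_le_of_agree_zero (hT : RelOpen T) : ∀ (N : ℕ) {f : Plane → ℝ}, Sm T f →
    Agree T N f (fun _ ↦ 0) → ∀ x ∈ T, x 0 = 0 → ∃ δ > 0, ∃ C, 0 ≤ C ∧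
      ∀ z ∈ Metric.ball x δ ∩ halfPlane, z ∈ T ∧ |f z| ≤ C * z 0 ^ N
  | 0, f, hf, _, x, hx, _ => by
    have hc : ContinuousWithinAt f halfPlane x := (hf x hx).continuousWithinAt
    have h1 : ∀ᶠ z in 𝓝[halfPlane] x, |f z| < |f x| + 1 :=
      hc.abs.eventually_lt continuousWithinAt_const (by simp)
    obtain ⟨δ, hδ, hs⟩ := Metric.mem_nhdsWithin_iff.1 (h1.and (hT.mem_nhdsWithin x hx))
    refine ⟨δ, hδ, |f x| + 1, by positivity, fun z hz ↦ ?_⟩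
    have := hs hz
    exact ⟨this.2, by simpa using this.1.le⟩
  | N + 1, f, hf, h, x, hx, hx0 => by
    obtain ⟨h1, h2⟩ := agree_succ_zero.1 h
    obtain ⟨δ, hδ, C, hC, hs⟩ := abs_le_of_agree_zero hT N (hf.partialDeriv hT 0) h2 x hx hx0
    refine ⟨δ, hδ, C, hC, fun z hz ↦ ⟨(hs z hz).1, ?_⟩⟩
    have hz0 : 0 ≤ z 0 := mem_halfPlane.1 hz.2
    set l : ℝ → Plane := fun t ↦ z + (t - z 0) • e 0 with hl
    have hl0 : ∀ t, l t 0 = t := fun t ↦ by simp [hl]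
    have hl1 : ∀ t, l t 1 = z 1 := fun t ↦ by simp [hl]
    have hlz : l (z 0) = z := by simp [hl]
    have hlmem : ∀ t ∈ Icc 0 (z 0), l t ∈ Metric.ball x δ ∩ halfPlane := by
      intro t ht
      refine ⟨?_, mem_halfPlane.2 (by rw [hl0]; exact ht.1)⟩
      refine lt_of_le_of_lt ?_ (show dist z x < δ from hz.1)
      rw [EuclideanSpace.dist_eq, EuclideanSpace.dist_eq]
      refine Real.sqrt_le_sqrt ?_
      simp only [Fin.sum_univ_two, hl0, hl1, hx0, Real.dist_eq, sub_zero, sq_abs]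
      have := pow_le_pow_left₀ ht.1 ht.2 2
      linarith
    have hld : ∀ t, HasDerivAt l (e 0) t := fun t ↦ by
      have := (((hasDerivAt_id t).sub_const (z 0)).smul_const (e 0)).const_add z
      rwa [one_smul] at this
    have hd : ∀ t ∈ Icc 0 (z 0),
        HasDerivWithinAt (f ∘ l) (partialDeriv 0 f (l t)) (Icc 0 (z 0)) t := by
      intro t ht
      have h3 : HasFDerivWithinAt f (fderivWithin ℝ f halfPlane (l t)) halfPlane (l t) :=
        (hf.differentiableWithinAt (hs _ (hlmem t ht)).1).hasFDerivWithinAt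
      exact h3.comp_hasDerivWithinAt t (hld t).hasDerivWithinAt fun s hs ↦ (hlmem s hs).2
    have hb : ∀ t ∈ Ico 0 (z 0), ‖partialDeriv 0 f (l t)‖ ≤ C * z 0 ^ N := by
      intro t ht
      have := (hs _ (hlmem t ⟨ht.1, ht.2.le⟩)).2
      rw [hl0] at this
      exact this.trans (mul_le_mul_of_nonneg_left (pow_le_pow_left₀ ht.1 ht.2.le N) hC)
    have := norm_image_sub_le_of_norm_deriv_le_segment' hd hb (z 0) ⟨hz0, le_rfl⟩
    have hf0 : f (l 0) = 0 := h1 _ (hs _ (hlmem 0 ⟨le_rfl, hz0⟩)).1 (hl0 0)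
    simp only [Function.comp, hlz, hf0, sub_zero, Real.norm_eq_abs] at this
    rw [pow_succ, ← mul_assoc]
    exact this

theorem isBigO_of_agree_zero (hT : RelOpen T) {N : ℕ} {F : Plane → Plane} (hF : Sm T F)
    (h : ∀ j, Agree T N (fun y ↦ F y j - y j) fun _ ↦ 0) {x : Plane} (hx : x ∈ T) (h0 : x 0 = 0) :
    (fun y ↦ F y - y) =O[𝓝[halfPlane] x] fun y ↦ y 0 ^ N := by
  have h1 : ∀ j, (fun y ↦ F y j - y j) =O[𝓝[halfPlane] x] fun y ↦ y 0 ^ N := by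
    intro j
    obtain ⟨δ, hδ, C, hC, hs⟩ := abs_le_of_agree_zero hT N ((hF.apply j).sub (Sm.coord j)) (h j)
      x hx h0
    refine Asymptotics.IsBigO.of_bound C ?_
    filter_upwards [inter_mem (mem_nhdsWithin_of_mem_nhds (Metric.ball_mem_nhds x hδ))
      self_mem_nhdsWithin] with z hz
    rw [Real.norm_eq_abs, Real.norm_eq_abs, abs_of_nonneg (pow_nonneg (mem_halfPlane.1 hz.2) N)]
    exact (hs z hz).2
  have h2 : (fun y ↦ F y - y) = fun y ↦ (F y 0 - y 0) • e 0 + (F y 1 - y 1) • e 1 := by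
    funext y
    ext i; fin_cases i <;> simp
  rw [h2]
  have h3 : ∀ j, (fun y ↦ (F y j - y j) • e j) =O[𝓝[halfPlane] x] fun y ↦ y 0 ^ N := fun j ↦ by
    refine Asymptotics.IsBigO.trans (Asymptotics.IsBigO.of_bound 1 ?_) (h1 j)
    refine Eventually.of_forall fun y ↦ ?_
    rw [norm_smul]
    simp
  exact (h3 0).add (h3 1)

end


/-! ### The metric and the equation in charts -/

section Chart

variable {M : Type*} [TopologicalSpace M] {φ : OpenPartialHomeomorph M (EuclideanHalfSpace 2)}

theorem relOpen_extend_target (φ : OpenPartialHomeomorph M (EuclideanHalfSpace 2)) :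
    RelOpen (φ.extend (𝓡∂ 2)).target where
  subset := φ.extend_target_subset_range
  mem_nhdsWithin y hy := by
    have hs : (φ.extend (𝓡∂ 2)).symm y ∈ φ.source := by
      simpa using (φ.extend (𝓡∂ 2)).map_target hy
    simpa only [(φ.extend (𝓡∂ 2)).right_inv hy] using
      φ.extend_target_mem_nhdsWithin (I := 𝓡∂ 2) hs

theorem uniqueDiffOn_extend_target (φ : OpenPartialHomeomorph M (EuclideanHalfSpace 2)) :
    UniqueDiffOn ℝ (φ.extend (𝓡∂ 2)).target :=
  fun y hy ↦ (uniqueDiffOn_halfPlane y ((relOpen_extend_target φ).subset hy)).mono_nhds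
    (nhdsWithin_le_of_mem ((relOpen_extend_target φ).mem_nhdsWithin y hy))

variable [ChartedSpace (EuclideanHalfSpace 2) M]

theorem contMDiffOn_extend_target_symm (hφ : φ ∈ IsManifold.maximalAtlas (𝓡∂ 2) ∞ M) :
    ContMDiffOn 𝓘(ℝ, Plane) (𝓡∂ 2) ∞ (φ.extend (𝓡∂ 2)).symm (φ.extend (𝓡∂ 2)).target := by
  rw [φ.extend_target']
  exact contMDiffOn_extend_symm hφ

theorem contMDiffWithinAt_extend_symm (hφ : φ ∈ IsManifold.maximalAtlas (𝓡∂ 2) ∞ M) {y : Plane}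
    (hy : y ∈ (φ.extend (𝓡∂ 2)).target) :
    ContMDiffWithinAt 𝓘(ℝ, Plane) (𝓡∂ 2) ∞ (φ.extend (𝓡∂ 2)).symm halfPlane y :=
  (contMDiffOn_extend_target_symm hφ y hy).mono_of_mem_nhdsWithin
    ((relOpen_extend_target φ).mem_nhdsWithin y hy)

theorem Sm.localRep (hφ : φ ∈ IsManifold.maximalAtlas (𝓡∂ 2) ∞ M) (u : C^∞⟮𝓡∂ 2, M; ℝ⟯) :
    Sm (φ.extend (𝓡∂ 2)).target (localRep φ u) := fun y hy ↦
  contMDiffWithinAt_iff_contDiffWithinAt.1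
    (u.contMDiff.contMDiffAt.comp_contMDiffWithinAt y (contMDiffWithinAt_extend_symm hφ hy))

theorem hasMFDerivWithinAt_extend_symm (hφ : φ ∈ IsManifold.maximalAtlas (𝓡∂ 2) ∞ M) {y : Plane}
    (hy : y ∈ (φ.extend (𝓡∂ 2)).target) :
    HasMFDerivWithinAt 𝓘(ℝ, Plane) (𝓡∂ 2) (φ.extend (𝓡∂ 2)).symm halfPlane y
      (mfderivWithin 𝓘(ℝ, Plane) (𝓡∂ 2) (φ.extend (𝓡∂ 2)).symm halfPlane y) :=
  ((contMDiffWithinAt_extend_symm hφ hy).mdifferentiableWithinAt (by simp)).hasMFDerivWithinAt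

theorem mfderiv_coordVec (hφ : φ ∈ IsManifold.maximalAtlas (𝓡∂ 2) ∞ M) {y : Plane}
    (hy : y ∈ (φ.extend (𝓡∂ 2)).target) {u : M → ℝ}
    (hu : MDifferentiableAt (𝓡∂ 2) 𝓘(ℝ, ℝ) u ((φ.extend (𝓡∂ 2)).symm y)) (i : Fin 2) :
    mfderiv (𝓡∂ 2) 𝓘(ℝ, ℝ) u ((φ.extend (𝓡∂ 2)).symm y) (coordVec φ i y) =
      partialDeriv i (SurfaceBVP.localRep φ u) y := by
  have h := hu.hasMFDerivAt.comp_hasMFDerivWithinAt y (hasMFDerivWithinAt_extend_symm hφ hy)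
  obtain ⟨A, hA, hd⟩ : ∃ A : Plane →L[ℝ] ℝ, A (e i) =
      mfderiv (𝓡∂ 2) 𝓘(ℝ, ℝ) u ((φ.extend (𝓡∂ 2)).symm y) (coordVec φ i y) ∧
      HasFDerivWithinAt (SurfaceBVP.localRep φ u) A halfPlane y :=
    ⟨_, rfl, hasMFDerivWithinAt_iff_hasFDerivWithinAt.1 h⟩
  rw [← hA, partialDeriv,
    hd.fderivWithin (uniqueDiffOn_halfPlane y ((relOpen_extend_target φ).subset hy))]

/-- The derivative of the coordinates along the inverse of the coordinates. -/
theorem mfderiv_extend_mfderivWithin_symm (hφ : φ ∈ IsManifold.maximalAtlas (𝓡∂ 2) ∞ M)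
    {y : Plane} (hy : y ∈ (φ.extend (𝓡∂ 2)).target) (w : Plane) :
    mfderiv (𝓡∂ 2) 𝓘(ℝ, Plane) (φ.extend (𝓡∂ 2)) ((φ.extend (𝓡∂ 2)).symm y)
      (mfderivWithin 𝓘(ℝ, Plane) (𝓡∂ 2) (φ.extend (𝓡∂ 2)).symm halfPlane y w) = w := by
  have hs : (φ.extend (𝓡∂ 2)).symm y ∈ φ.source := by
    simpa using (φ.extend (𝓡∂ 2)).map_target hy
  have h1 : MDifferentiableAt (𝓡∂ 2) 𝓘(ℝ, Plane) (φ.extend (𝓡∂ 2)) ((φ.extend (𝓡∂ 2)).symm y) :=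
    (φ.contMDiffAt_extend hφ hs).mdifferentiableAt (by simp)
  have h := h1.hasMFDerivAt.comp_hasMFDerivWithinAt y (hasMFDerivWithinAt_extend_symm hφ hy)
  obtain ⟨A, hA, hd⟩ : ∃ A : Plane →L[ℝ] Plane, A w =
      mfderiv (𝓡∂ 2) 𝓘(ℝ, Plane) (φ.extend (𝓡∂ 2)) ((φ.extend (𝓡∂ 2)).symm y)
        (mfderivWithin 𝓘(ℝ, Plane) (𝓡∂ 2) (φ.extend (𝓡∂ 2)).symm halfPlane y w) ∧
      HasFDerivWithinAt (φ.extend (𝓡∂ 2) ∘ (φ.extend (𝓡∂ 2)).symm) A halfPlane y :=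
    ⟨_, rfl, hasMFDerivWithinAt_iff_hasFDerivWithinAt.1 h⟩
  have hid : HasFDerivWithinAt (φ.extend (𝓡∂ 2) ∘ (φ.extend (𝓡∂ 2)).symm)
      (ContinuousLinearMap.id ℝ Plane) halfPlane y :=
    (hasFDerivWithinAt_id y halfPlane).congr_of_eventuallyEq
      (by filter_upwards [(relOpen_extend_target φ).mem_nhdsWithin y hy] with z hz
          exact (φ.extend (𝓡∂ 2)).right_inv hz)
      ((φ.extend (𝓡∂ 2)).right_inv hy)
  have hAid : A = ContinuousLinearMap.id ℝ Plane :=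
    (uniqueDiffOn_halfPlane y ((relOpen_extend_target φ).subset hy)).eq hd hid
  rw [← hA, hAid, ContinuousLinearMap.id_apply]

variable [IsManifold (𝓡∂ 2) ∞ M]

/-- The coordinate fields are images of constant fields under the tangent map of the inverse chart,
hence smooth sections along it; the smooth metric is contracted with two of them. -/
theorem Sm.metricCoeff (hφ : φ ∈ IsManifold.maximalAtlas (𝓡∂ 2) ∞ M) (g : Metric M) (i j : Fin 2) :
    Sm (φ.extend (𝓡∂ 2)).target fun y ↦ metricCoeff g φ y i j := by
  set T := (φ.extend (𝓡∂ 2)).target with hT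
  have huT : UniqueMDiffOn 𝓘(ℝ, Plane) T := (uniqueDiffOn_extend_target φ).uniqueMDiffOn
  have hder : ∀ y ∈ T, mfderivWithin 𝓘(ℝ, Plane) (𝓡∂ 2) (φ.extend (𝓡∂ 2)).symm halfPlane y =
      mfderivWithin 𝓘(ℝ, Plane) (𝓡∂ 2) (φ.extend (𝓡∂ 2)).symm T y := fun y hy ↦
    ((contMDiffOn_extend_target_symm hφ y hy).mdifferentiableWithinAt
      (by simp)).mfderivWithin_mono_of_mem_nhdsWithin
      (uniqueDiffOn_halfPlane y ((relOpen_extend_target φ).subset hy)).uniqueMDiffWithinAt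
      ((relOpen_extend_target φ).mem_nhdsWithin y hy)
  have hsec : ∀ k, ∀ y ∈ T, ContMDiffWithinAt 𝓘(ℝ, Plane) (𝓡∂ 2).tangent ∞
      (fun z ↦ (⟨(φ.extend (𝓡∂ 2)).symm z, coordVec φ k z⟩ : TangentBundle (𝓡∂ 2) M)) T y := by
    intro k y hy
    have h1 := (contMDiffOn_extend_target_symm hφ).contMDiffOn_tangentMapWithin (m := ∞) (by simp) huT
    have h2 : ContMDiffWithinAt 𝓘(ℝ, Plane) 𝓘(ℝ, Plane).tangent ∞
        (fun z ↦ (⟨z, e k⟩ : TangentBundle 𝓘(ℝ, Plane) Plane)) T y :=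
      contMDiffWithinAt_vectorSpace_iff_contDiffWithinAt.2 contDiffWithinAt_const
    have h3 := (h1 ⟨y, e k⟩ hy).comp y h2 (fun z hz ↦ hz)
    refine h3.congr (fun z hz ↦ ?_) ?_
    · simp only [coordVec, hder z hz]; rfl
    · simp only [coordVec, hder y hy]; rfl
  intro y hy
  refine ContDiffWithinAt.mono_of_mem_nhdsWithin ?_ ((relOpen_extend_target φ).mem_nhdsWithin y hy)
  rw [← contMDiffWithinAt_iff_contDiffWithinAt]
  have hg : ContMDiffWithinAt 𝓘(ℝ, Plane) ((𝓡∂ 2).prod 𝓘(ℝ, Plane →L[ℝ] Plane →L[ℝ] ℝ)) ∞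
      (fun z ↦ Bundle.TotalSpace.mk' (Plane →L[ℝ] Plane →L[ℝ] ℝ)
        (E := fun p : M ↦ (TangentSpace (𝓡∂ 2) p →L[ℝ] (TangentSpace (𝓡∂ 2) p →L[ℝ] ℝ)))
        ((φ.extend (𝓡∂ 2)).symm z) (g.inner ((φ.extend (𝓡∂ 2)).symm z))) T y :=
    g.contMDiff.contMDiffAt.comp_contMDiffWithinAt y (contMDiffOn_extend_target_symm hφ y hy)
  have := ContMDiffWithinAt.clm_bundle_apply₂ (F₁ := Plane) (F₂ := Plane) (F₃ := ℝ)
    (E₁ := fun p : M ↦ TangentSpace (𝓡∂ 2) p) (E₂ := fun p : M ↦ TangentSpace (𝓡∂ 2) p)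
    (E₃ := Bundle.Trivial M ℝ) (ψ := fun z ↦ g.inner ((φ.extend (𝓡∂ 2)).symm z)) hg (hsec i y hy) (hsec j y hy)
  simp only [Bundle.contMDiffWithinAt_totalSpace] at this
  exact this.2

end Chart

section Chart

variable {M : Type*} [TopologicalSpace M] [ChartedSpace (EuclideanHalfSpace 2) M]
  {φ : OpenPartialHomeomorph M (EuclideanHalfSpace 2)}

/-- The derivative of the inverse chart is injective, since the derivative of the chart is a left
inverse, and therefore surjective by equality of dimensions. -/
theorem exists_eq_coordVec (hφ : φ ∈ IsManifold.maximalAtlas (𝓡∂ 2) ∞ M) {y : Plane}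
    (hy : y ∈ (φ.extend (𝓡∂ 2)).target)
    (v : TangentSpace (𝓡∂ 2) ((φ.extend (𝓡∂ 2)).symm y)) :
    ∃ c : Fin 2 → ℝ, v = c 0 • coordVec φ 0 y + c 1 • coordVec φ 1 y := by
  obtain ⟨A, hA⟩ : ∃ A : Plane →ₗ[ℝ] Plane, ∀ w, A w =
    mfderivWithin 𝓘(ℝ, Plane) (𝓡∂ 2) (φ.extend (𝓡∂ 2)).symm halfPlane y w := 
    ⟨(mfderivWithin 𝓘(ℝ, Plane) (𝓡∂ 2) (φ.extend (𝓡∂ 2)).symm halfPlane y).toLinearMap, fun _ ↦ rfl⟩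
  have hinj : Function.Injective A := fun w w' h ↦ by
    rw [← mfderiv_extend_mfderivWithin_symm hφ hy w, ← mfderiv_extend_mfderivWithin_symm hφ hy w',
      ← hA, ← hA, h]
  obtain ⟨w, rfl⟩ := LinearMap.surjective_of_injective hinj v
  refine ⟨fun i ↦ w i, ?_⟩
  have hw : w = w 0 • e 0 + w 1 • e 1 := by
    ext i; fin_cases i <;> simp [e]
  conv_lhs => rw [hw, map_add, map_smul, map_smul, hA, hA]
  rfl

theorem extend_coordVec (hφ : φ ∈ IsManifold.maximalAtlas (𝓡∂ 2) ∞ M) {y : Plane}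
    (hy : y ∈ (φ.extend (𝓡∂ 2)).target) (c : Fin 2 → ℝ)
    (h : c 0 • coordVec φ 0 y + c 1 • coordVec φ 1 y = 0) : c = 0 := by
  obtain ⟨A, hA⟩ : ∃ A : Plane →ₗ[ℝ] Plane, ∀ w, A w =
    mfderivWithin 𝓘(ℝ, Plane) (𝓡∂ 2) (φ.extend (𝓡∂ 2)).symm halfPlane y w :=
    ⟨(mfderivWithin 𝓘(ℝ, Plane) (𝓡∂ 2) (φ.extend (𝓡∂ 2)).symm halfPlane y).toLinearMap, fun _ ↦ rfl⟩
  have hinj : Function.Injective A := fun w w' h ↦ by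
    rw [← mfderiv_extend_mfderivWithin_symm hφ hy w, ← mfderiv_extend_mfderivWithin_symm hφ hy w',
      ← hA, ← hA, h]
  have h2 : A (c 0 • e 0 + c 1 • e 1) = A 0 := by
    rw [map_add, map_smul, map_smul, map_zero, hA, hA]
    exact h
  have h3 := hinj h2
  ext i
  have h4 := congrArg (fun w : Plane ↦ w i) h3
  fin_cases i <;> simpa using h4

variable [IsManifold (𝓡∂ 2) ∞ M]

theorem metricCoeff_symm (g : Metric M) (y : Plane) (i j : Fin 2) :
    metricCoeff g φ y i j = metricCoeff g φ y j i := by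
  simp only [metricCoeff, Matrix.of_apply]
  exact g.symm _ _ _

theorem metricCoeff_quadratic_pos (hφ : φ ∈ IsManifold.maximalAtlas (𝓡∂ 2) ∞ M) (g : Metric M)
    {y : Plane} (hy : y ∈ (φ.extend (𝓡∂ 2)).target) {c : Fin 2 → ℝ} (hc : c ≠ 0) :
    0 < c 0 * c 0 * metricCoeff g φ y 0 0 + 2 * (c 0 * c 1) * metricCoeff g φ y 0 1 +
      c 1 * c 1 * metricCoeff g φ y 1 1 := by
  have h := g.pos ((φ.extend (𝓡∂ 2)).symm y) (c 0 • coordVec φ 0 y + c 1 • coordVec φ 1 y)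
    fun h ↦ hc (extend_coordVec hφ hy c h)
  have hs := metricCoeff_symm (φ := φ) g y 0 1
  simp only [metricCoeff, Matrix.of_apply] at hs ⊢
  simp only [map_add, map_smul, add_apply, smul_apply,
    smul_eq_mul] at h
  rw [← hs] at h
  linarith

theorem metricCoeff_diag_pos (hφ : φ ∈ IsManifold.maximalAtlas (𝓡∂ 2) ∞ M) (g : Metric M)
    {y : Plane} (hy : y ∈ (φ.extend (𝓡∂ 2)).target) (i : Fin 2) : 0 < metricCoeff g φ y i i := by
  have h := metricCoeff_quadratic_pos hφ g hy (c := Pi.single i 1) (by simp)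
  fin_cases i <;> simpa using h

/-- The quadratic form of the metric at the vector (-g₀₁, g₀₀) equals g₀₀ det g. -/
theorem metricCoeff_det_pos (hφ : φ ∈ IsManifold.maximalAtlas (𝓡∂ 2) ∞ M) (g : Metric M)
    {y : Plane} (hy : y ∈ (φ.extend (𝓡∂ 2)).target) : 0 < (metricCoeff g φ y).det := by
  have h0 := metricCoeff_diag_pos hφ g hy 0
  have h := metricCoeff_quadratic_pos hφ g hy
    (c := ![-metricCoeff g φ y 0 1, metricCoeff g φ y 0 0])
    (fun h ↦ h0.ne' (congrFun h 1))
  simp only [Matrix.cons_val_zero, Matrix.cons_val_one] at h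
  rw [Matrix.det_fin_two, metricCoeff_symm g y 1 0]
  refine pos_of_mul_pos_right (a := metricCoeff g φ y 0 0) ?_ h0.le
  nlinarith

theorem metricCoeff_inv_eq (g : Metric M) (y : Plane) :
    (metricCoeff g φ y)⁻¹ = (metricCoeff g φ y).det⁻¹ • !![metricCoeff g φ y 1 1,
      -metricCoeff g φ y 0 1; -metricCoeff g φ y 1 0, metricCoeff g φ y 0 0] := by
  rw [Matrix.inv_def, Matrix.adjugate_fin_two, Ring.inverse_eq_inv']

end Chart

section Divergence

variable {T : Set Plane}

theorem Sm.sqrt {f : Plane → ℝ} (hf : Sm T f) (h0 : ∀ y ∈ T, f y ≠ 0) : Sm T fun y ↦ √(f y) :=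
  fun y hy ↦ (hf y hy).sqrt (h0 y hy)

/-- The divergence of a vector field of the form `s A ∇u`, written out. -/
theorem sum_partialDeriv_mul_sum (hT : RelOpen T) {s u : Plane → ℝ}
    {A : Fin 2 → Fin 2 → Plane → ℝ} (hs : Sm T s) (hA : ∀ i j, Sm T (A i j)) (hu : Sm T u)
    {y : Plane} (hy : y ∈ T) :
    ∑ i, partialDeriv i (fun z ↦ s z * ∑ j, A i j z * partialDeriv j u z) y =
      (∑ j, (∑ i, partialDeriv i (fun z ↦ s z * A i j z) y) * partialDeriv j u y) +
        s y * ∑ i, ∑ j, A i j y * partialDeriv i (partialDeriv j u) y := by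
  have h : ∀ i, partialDeriv i (fun z ↦ s z * ∑ j, A i j z * partialDeriv j u z) y =
      ∑ j, (s y * A i j y * partialDeriv i (partialDeriv j u) y +
        partialDeriv j u y * partialDeriv i (fun z ↦ s z * A i j z) y) := by
    intro i
    have h1 : partialDeriv i (fun z ↦ s z * ∑ j, A i j z * partialDeriv j u z) y =
        partialDeriv i (fun z ↦ (s z * A i 0 z) * partialDeriv 0 u z +
          (s z * A i 1 z) * partialDeriv 1 u z) y :=
      partialDeriv_congr hT (fun z _ ↦ by rw [Fin.sum_univ_two]; ring) i y hy
    rw [h1, partialDeriv_add hT ((hs.mul (hA i 0)).mul (hu.partialDeriv hT 0))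
      ((hs.mul (hA i 1)).mul (hu.partialDeriv hT 1)) i hy,
      Fin.sum_univ_two]
    exact congrArg₂ (· + ·) (partialDeriv_mul hT (hs.mul (hA i 0)) (hu.partialDeriv hT 0) i hy)
      (partialDeriv_mul hT (hs.mul (hA i 1)) (hu.partialDeriv hT 1) i hy)
  rw [Finset.sum_congr rfl fun i _ ↦ h i]
  simp only [Fin.sum_univ_two]
  ring

end Divergence

section Equation

variable {M : Type*} [TopologicalSpace M] [ChartedSpace (EuclideanHalfSpace 2) M]
  [IsManifold (𝓡∂ 2) ∞ M] {φ : OpenPartialHomeomorph M (EuclideanHalfSpace 2)}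

theorem Sm.det_metricCoeff (hφ : φ ∈ IsManifold.maximalAtlas (𝓡∂ 2) ∞ M) (g : Metric M) :
    Sm (φ.extend (𝓡∂ 2)).target fun y ↦ (SurfaceBVP.metricCoeff g φ y).det := by
  simp only [Matrix.det_fin_two]
  exact ((Sm.metricCoeff hφ g 0 0).mul (Sm.metricCoeff hφ g 1 1)).sub
    ((Sm.metricCoeff hφ g 0 1).mul (Sm.metricCoeff hφ g 1 0))

theorem Sm.metricCoeff_inv (hφ : φ ∈ IsManifold.maximalAtlas (𝓡∂ 2) ∞ M) (g : Metric M)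
    (i j : Fin 2) : Sm (φ.extend (𝓡∂ 2)).target fun y ↦ (SurfaceBVP.metricCoeff g φ y)⁻¹ i j := by
  have hd := (Sm.det_metricCoeff hφ g).inv fun y hy ↦ (metricCoeff_det_pos hφ g hy).ne'
  simp only [metricCoeff_inv_eq]
  fin_cases i <;> fin_cases j
  · exact hd.mul (Sm.metricCoeff hφ g 1 1)
  · exact hd.mul (Sm.metricCoeff hφ g 0 1).neg
  · exact hd.mul (Sm.metricCoeff hφ g 1 0).neg
  · exact hd.mul (Sm.metricCoeff hφ g 0 0)

/-- The equation `(Δ_g + q) u = 0` in a chart, in nondivergence form. -/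
theorem Solves.eqn_in_chart {g : Metric M} {q u : C^∞⟮𝓡∂ 2, M; ℝ⟯} (h : Solves g q u)
    (hφ : φ ∈ IsManifold.maximalAtlas (𝓡∂ 2) ∞ M) {y : Plane}
    (hy : y ∈ (φ.extend (𝓡∂ 2)).target) :
    ∑ i, ∑ j, (metricCoeff g φ y)⁻¹ i j * partialDeriv i (partialDeriv j (localRep φ u)) y =
      ∑ j, (-(√(metricCoeff g φ y).det)⁻¹ * ∑ i, partialDeriv i
        (fun z ↦ √(metricCoeff g φ z).det * (metricCoeff g φ z)⁻¹ i j) y) *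
          partialDeriv j (localRep φ u) y + localRep φ q y * localRep φ u y := by
  have hs : (φ.extend (𝓡∂ 2)).symm y ∈ φ.source := by
    simpa using (φ.extend (𝓡∂ 2)).map_target hy
  have h1 := h φ hφ _ hs
  rw [(φ.extend (𝓡∂ 2)).right_inv hy, laplacianInChart,
    sum_partialDeriv_mul_sum (A := fun i j z ↦ (metricCoeff g φ z)⁻¹ i j)
      (relOpen_extend_target φ)
      ((Sm.det_metricCoeff hφ g).sqrt fun z hz ↦ (metricCoeff_det_pos hφ g hz).ne')
      (Sm.metricCoeff_inv hφ g) (Sm.localRep hφ u) hy] at h1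
  have hd : √(metricCoeff g φ y).det ≠ 0 := (Real.sqrt_pos.2 (metricCoeff_det_pos hφ g hy)).ne'
  have h2 : ∀ S P : ℝ, -(√(metricCoeff g φ y).det)⁻¹ * (S + √(metricCoeff g φ y).det * P) =
      -(√(metricCoeff g φ y).det)⁻¹ * S - P := fun S P ↦ by
    field_simp
    ring
  rw [h2, Finset.mul_sum] at h1
  simp only [← mul_assoc] at h1
  have h3 : q ((φ.extend (𝓡∂ 2)).symm y) * u ((φ.extend (𝓡∂ 2)).symm y) =
    localRep φ q y * localRep φ u y := rfl
  linarith

variable {B : Type*} [TopologicalSpace B] [ChartedSpace (EuclideanSpace ℝ (Fin 1)) B]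

/-- The equation `(Δ_g + q) u = 0` in boundary normal coordinates. -/
theorem Solves.normalFormEq {g : Metric M} {q u : C^∞⟮𝓡∂ 2, M; ℝ⟯} (h : Solves g q u) {ι : B → M}
    {χ : OpenPartialHomeomorph B (EuclideanSpace ℝ (Fin 1))}
    (hφ : IsBoundaryNormalChart g ι χ φ) {y : Plane} (hy : y ∈ (φ.extend (𝓡∂ 2)).target) :
    NormalFormEq (fun z ↦ metricCoeff g φ z 1 1) (localRep φ q) (localRep φ u) y := by
  have hT := relOpen_extend_target φ
  have hm := hφ.mem_maximalAtlas
  have hdet : ∀ z ∈ (φ.extend (𝓡∂ 2)).target, (metricCoeff g φ z).det = metricCoeff g φ z 1 1 := by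
    intro z hz
    rw [Matrix.det_fin_two, hφ.metric_normal z hz, hφ.metric_mixed z hz]
    ring
  have hpos := fun z hz ↦ metricCoeff_diag_pos hm g (y := z) hz 1
  set H : Plane → ℝ := fun z ↦ metricCoeff g φ z 1 1 with hH
  -- The density √(det g) is √H here. The relations s² = H and 2s ∂ᵢs = ∂ᵢH replace any
  -- differentiation of the square root.
  set s : Plane → ℝ := fun z ↦ √(H z) with hsdef
  have hHs : Sm (φ.extend (𝓡∂ 2)).target H := Sm.metricCoeff hm g 1 1
  have hs : Sm (φ.extend (𝓡∂ 2)).target s := hHs.sqrt fun z hz ↦ (hpos z hz).ne'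
  have hs0 : ∀ z ∈ (φ.extend (𝓡∂ 2)).target, s z ≠ 0 := fun z hz ↦ (Real.sqrt_pos.2 (hpos z hz)).ne'
  have hss : ∀ z ∈ (φ.extend (𝓡∂ 2)).target, s z * s z = H z := fun z hz ↦
    Real.mul_self_sqrt (hpos z hz).le
  have hinv : ∀ z ∈ (φ.extend (𝓡∂ 2)).target, (metricCoeff g φ z)⁻¹ = !![1, 0; 0, (H z)⁻¹] := by
    intro z hz
    have h0 : metricCoeff g φ z 1 1 ≠ 0 := (hpos z hz).ne'
    rw [metricCoeff_inv_eq, hdet z hz, hφ.metric_normal z hz, metricCoeff_symm g z 1 0,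
      hφ.metric_mixed z hz]
    ext i j
    fin_cases i <;> fin_cases j <;> simp [h0, hH]
  have hds : ∀ i, 2 * s y * partialDeriv i s y = partialDeriv i H y := by
    intro i
    rw [← partialDeriv_congr hT hss i y hy, partialDeriv_mul hT hs hs i hy]
    ring
  have hsi := hs.inv hs0
  have hdsi : partialDeriv 1 (fun z ↦ (s z)⁻¹) y = -(partialDeriv 1 s y) * (s y)⁻¹ * (s y)⁻¹ := by
    have h1 := partialDeriv_congr hT (fun z hz ↦ mul_inv_cancel₀ (hs0 z hz)) 1 y hy
    rw [partialDeriv_mul hT hs hsi 1 hy, partialDeriv_const] at h1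
    have := hs0 y hy
    field_simp at h1 ⊢
    linarith
  have key := h.eqn_in_chart hm hy
  have hc : ∀ i j, partialDeriv i
      (fun z ↦ √(metricCoeff g φ z).det * (metricCoeff g φ z)⁻¹ i j) y =
      partialDeriv i (fun z ↦ s z * (!![1, 0; 0, (H z)⁻¹] : Matrix (Fin 2) (Fin 2) ℝ) i j) y :=
    fun i j ↦ partialDeriv_congr hT (fun z hz ↦ by rw [hdet z hz, hinv z hz]) i y hy
  have hc11 : partialDeriv 1 (fun z ↦ s z * (H z)⁻¹) y = partialDeriv 1 (fun z ↦ (s z)⁻¹) y :=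
    partialDeriv_congr hT (fun z hz ↦ by
      have := hs0 z hz
      rw [← hss z hz]; field_simp) 1 y hy
  simp only [hc, hinv y hy, hdet y hy, Fin.sum_univ_two, Matrix.of_apply, Matrix.cons_val_zero,
    Matrix.cons_val_one, Matrix.cons_val', mul_one, mul_zero, hc11, hdsi,
    partialDeriv_const] at key
  have h0 := hds 0
  have h1 := hds 1
  have hsy : √(metricCoeff g φ y 1 1) = s y := rfl
  have hHy : metricCoeff g φ y 1 1 = s y * s y := (hss y hy).symm
  have := hs0 y hy
  rw [hsy] at key
  simp only [NormalFormEq]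
  rw [← h0, ← h1, ← hss y hy]
  rw [← hss y hy] at key
  field_simp at key ⊢
  linear_combination key

end Equation

theorem partialDeriv_eq_pd {y : Plane} (hy : halfPlane ∈ 𝓝 y) (i : Fin 2) (f : Plane → ℝ) :
    partialDeriv i f y = pd i f y := by
  rw [partialDeriv, pd, fderivWithin_of_mem_nhds hy]

theorem partialDeriv_partialDeriv_eq_pd {y : Plane} (hy : halfPlane ∈ 𝓝 y) (i j : Fin 2)
    (f : Plane → ℝ) : partialDeriv i (partialDeriv j f) y = pd i (pd j f) y := by
  rw [partialDeriv_eq_pd hy]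
  have : partialDeriv j f =ᶠ[𝓝 y] pd j f := by
    filter_upwards [eventually_mem_nhds_iff.2 hy] with z hz using partialDeriv_eq_pd hz j f
  rw [pd, pd, this.fderiv_eq]

variable {M : Type*} [TopologicalSpace M] [ChartedSpace (EuclideanHalfSpace 2) M]
  [IsManifold (𝓡∂ 2) ∞ M] {φ : OpenPartialHomeomorph M (EuclideanHalfSpace 2)}

theorem isEllipticAt_metricCoeff_inv (hφ : φ ∈ IsManifold.maximalAtlas (𝓡∂ 2) ∞ M) (g : Metric M)
    {y : Plane} (hy : y ∈ (φ.extend (𝓡∂ 2)).target) :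
    IsEllipticAt (fun i j z ↦ (metricCoeff g φ z)⁻¹ i j) y := by
  have hd := metricCoeff_det_pos hφ g hy
  have h1 := metricCoeff_diag_pos hφ g hy 1
  have hs := metricCoeff_symm (φ := φ) g y 1 0
  have hd' := Matrix.det_fin_two (metricCoeff g φ y)
  constructor
  · simp [metricCoeff_inv_eq, hs]
  · simp only [metricCoeff_inv_eq]
    simpa using mul_pos (inv_pos.2 hd) h1
  · simp only [metricCoeff_inv_eq]
    have : (metricCoeff g φ y).det⁻¹ * metricCoeff g φ y 1 1 *
        ((metricCoeff g φ y).det⁻¹ * metricCoeff g φ y 0 0) -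
        ((metricCoeff g φ y).det⁻¹ * -metricCoeff g φ y 0 1) *
        ((metricCoeff g φ y).det⁻¹ * -metricCoeff g φ y 0 1) = (metricCoeff g φ y).det⁻¹ := by
      field_simp
      rw [hd', hs]
      ring
    have hp := inv_pos.2 hd
    rw [← this] at hp
    simpa using hp

theorem Sm.contDiffOn {T S : Set Plane} {f : Plane → ℝ} (hf : Sm T f) (hS : S ⊆ T)
    (hS' : S ⊆ interior halfPlane) : ContDiffOn ℝ ∞ f S := fun y hy ↦
  ((hf y (hS hy)).contDiffAt (mem_interior_iff_mem_nhds.1 (hS' hy))).contDiffWithinAt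

/-- The restrictions of the solutions of the equation to a smooth curve through an interior point
do not realize all smooth functions. -/
theorem exists_contDiff_ne_solution_on_curve [CompactSpace M]
    (hφ : φ ∈ IsManifold.maximalAtlas (𝓡∂ 2) ∞ M) (g : Metric M)
    (q : C^∞⟮𝓡∂ 2, M; ℝ⟯) {γ : ℝ → Plane} {V : Set ℝ} {s₀ : ℝ} (hV : IsOpen V) (hs₀ : s₀ ∈ V)
    (hγ : ContDiffOn ℝ ∞ γ V) (hint : γ s₀ ∈ interior (φ.extend (𝓡∂ 2)).target) :
    ∃ h : ℝ → ℝ, ContDiff ℝ ∞ h ∧ ∀ u : C^∞⟮𝓡∂ 2, M; ℝ⟯, Solves g q u →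
      ¬ localRep φ u ∘ γ =ᶠ[𝓝 s₀] h := by
  obtain ⟨R, hR, hball⟩ := Metric.isOpen_iff.1 isOpen_interior _ hint
  have hbT : Metric.ball (γ s₀) R ⊆ (φ.extend (𝓡∂ 2)).target := hball.trans interior_subset
  have hbH : Metric.ball (γ s₀) R ⊆ interior halfPlane :=
    hball.trans (interior_mono (relOpen_extend_target φ).subset)
  have hT := relOpen_extend_target φ
  have hsq := (Sm.det_metricCoeff hφ g).sqrt fun z hz ↦ (metricCoeff_det_pos hφ g hz).ne'
  have hsi := hsq.inv fun z hz ↦ (Real.sqrt_pos.2 (metricCoeff_det_pos hφ g hz)).ne'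
  have hb : ∀ j, Sm (φ.extend (𝓡∂ 2)).target fun y ↦ -(√(metricCoeff g φ y).det)⁻¹ *
      ∑ i, partialDeriv i (fun z ↦ √(metricCoeff g φ z).det * (metricCoeff g φ z)⁻¹ i j) y := by
    intro j
    simp only [Fin.sum_univ_two]
    exact hsi.neg.mul (((hsq.mul (Sm.metricCoeff_inv hφ g 0 j)).partialDeriv hT 0).add
      ((hsq.mul (Sm.metricCoeff_inv hφ g 1 j)).partialDeriv hT 1))
  obtain ⟨h, hh, hne⟩ := exists_contDiff_ne_solution_comp hR
    (fun i j ↦ (Sm.metricCoeff_inv hφ g i j).contDiffOn hbT hbH)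
    (fun j ↦ (hb j).contDiffOn hbT hbH) ((Sm.localRep hφ q).contDiffOn hbT hbH)
    (fun y hy ↦ isEllipticAt_metricCoeff_inv hφ g (hbT hy)) hV hs₀ hγ rfl
  refine ⟨h, hh, fun u hu ↦ hne _ ((Sm.localRep hφ u).contDiffOn hbT hbH) (fun y hy ↦ ?_) ?_⟩
  · have hn := mem_interior_iff_mem_nhds.1 (hbH hy)
    have := hu.eqn_in_chart hφ (hbT hy)
    simp only [partialDeriv_partialDeriv_eq_pd hn] at this
    rw [principal, this]
    simp only [← partialDeriv_eq_pd hn]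
  -- The supremum may depend on u; that it is finite follows from compactness of the surface.
  · obtain ⟨S, hS⟩ := isCompact_univ.exists_bound_of_continuousOn u.contMDiff.continuous.continuousOn
    exact ⟨S, fun y _ ↦ hS _ (mem_univ _)⟩


/-! ### The map preserves the boundary pointwise -/

section Curve

variable {B : Type*} [TopologicalSpace B] [ChartedSpace (EuclideanSpace ℝ (Fin 1)) B]

theorem contMDiffOn_coord {χ : OpenPartialHomeomorph B (EuclideanSpace ℝ (Fin 1))}
    (hχ : χ ∈ IsManifold.maximalAtlas (𝓡 1) ∞ B) :
    ContMDiffOn (𝓡 1) 𝓘(ℝ, ℝ) ∞ (fun b ↦ χ b 0) χ.source := fun b hb ↦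
  (EuclideanSpace.proj (𝕜 := ℝ) (0 : Fin 1)).contMDiff.contMDiffAt.comp_contMDiffWithinAt b
    (contMDiffOn_of_mem_maximalAtlas hχ b hb)

variable [IsManifold (𝓡 1) ∞ B] [T2Space B]

/-- Every smooth function of a coordinate of the curve coincides near a given point with a smooth
function on the whole curve. -/
theorem exists_contMDiffMap_eventuallyEq {χ : OpenPartialHomeomorph B (EuclideanSpace ℝ (Fin 1))}
    (hχ : χ ∈ IsManifold.maximalAtlas (𝓡 1) ∞ B) {b : B} (hb : b ∈ χ.source) {h : ℝ → ℝ}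
    (hh : ContDiff ℝ ∞ h) : ∃ f : C^∞⟮𝓡 1, B; ℝ⟯, f =ᶠ[𝓝 b] fun b' ↦ h (χ b' 0) := by
  obtain ⟨ρ, -, hρ⟩ := (SmoothBumpFunction.nhds_basis_tsupport (I := 𝓡 1) b).mem_iff.1
    (χ.open_source.mem_nhds hb)
  have hg : ContMDiff (𝓡 1) 𝓘(ℝ, ℝ) ∞ fun b' ↦ ρ b' * h (χ b' 0) := by
    refine contMDiff_of_tsupport fun x hx ↦ ?_
    have hx' : x ∈ χ.source := hρ (closure_mono (Function.support_mul_subset_left _ _) hx)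
    exact ρ.contMDiff.contMDiffAt.mul (hh.contMDiff.contMDiffAt.comp x
      ((contMDiffOn_coord hχ).contMDiffAt (χ.open_source.mem_nhds hx')))
  refine ⟨⟨_, hg⟩, ?_⟩
  filter_upwards [ρ.eventuallyEq_one] with x hx
  simp [hx]

theorem exists_contMDiffMap_ne {b b' : B} (hbb' : b ≠ b') :
    ∃ f : C^∞⟮𝓡 1, B; ℝ⟯, f b ≠ f b' := by
  have hs : {b'}ᶜ ∈ 𝓝 b := isClosed_singleton.isOpen_compl.mem_nhds hbb'
  obtain ⟨ρ, -, hρ⟩ := (SmoothBumpFunction.nhds_basis_tsupport (I := 𝓡 1) b).mem_iff.1 hs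
  refine ⟨⟨ρ, ρ.contMDiff⟩, ?_⟩
  have : ρ b' = 0 := by
    by_contra h
    exact hρ (subset_tsupport _ h) rfl
  change ρ b ≠ ρ b'
  rw [this, ρ.eq_one]
  exact one_ne_zero

end Curve

section Boundary

variable {M : Type*} [TopologicalSpace M] [ChartedSpace (EuclideanHalfSpace 2) M]
  {B : Type*} [TopologicalSpace B] [ChartedSpace (EuclideanSpace ℝ (Fin 1)) B]

theorem IsBoundaryInclusion.t2Space [T2Space M] {ι : B → M} (h : IsBoundaryInclusion ι) :
    T2Space B := h.isSmoothEmbedding.isEmbedding.t2Space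

theorem IsBoundaryInclusion.contMDiff {ι : B → M} (h : IsBoundaryInclusion ι) :
    ContMDiff (𝓡 1) (𝓡∂ 2) ∞ ι := h.isSmoothEmbedding.contMDiff

variable [IsManifold (𝓡∂ 2) ∞ M]

theorem DNMapDefined.dirichletSolution {g : Metric M} {q : C^∞⟮𝓡∂ 2, M; ℝ⟯} {ι : B → M}
    (h : DNMapDefined g q ι) (f : C^∞⟮𝓡 1, B; ℝ⟯) :
    IsDirichletSolution g q ι f (SurfaceBVP.dirichletSolution g q ι f) :=
  Classical.epsilon_spec (h f).exists

theorem contDiff_vec1 : ContDiff ℝ ∞ fun s : ℝ ↦ (!₂[s] : EuclideanSpace ℝ (Fin 1)) :=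
  contDiff_euclidean.2 fun i ↦ by fin_cases i; exact contDiff_id

theorem vec1_apply_zero (v : EuclideanSpace ℝ (Fin 1)) :
    (!₂[v 0] : EuclideanSpace ℝ (Fin 1)) = v := by
  ext i; fin_cases i; rfl

/-- A smooth map from a curve to a surface such that every smooth function on the curve is the
pullback of a solution does not meet the interior of the surface. -/
theorem mem_boundary_of_forall_exists_solution [T2Space B] [IsManifold (𝓡 1) ∞ B] [CompactSpace M]
    (g : Metric M) (q : C^∞⟮𝓡∂ 2, M; ℝ⟯) {c : B → M} (hc : ContMDiff (𝓡 1) (𝓡∂ 2) ∞ c)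
    (h : ∀ f : C^∞⟮𝓡 1, B; ℝ⟯, ∃ u, Solves g q u ∧ ∀ b, u (c b) = f b) (b : B) :
    c b ∈ (𝓡∂ 2).boundary M := by
  by_contra hb
  have hint : (𝓡∂ 2).IsInteriorPoint (c b) :=
    ((𝓡∂ 2).isInteriorPoint_iff_not_isBoundaryPoint _).2 hb
  rw [(𝓡∂ 2).isInteriorPoint_iff] at hint
  set φ := chartAt (EuclideanHalfSpace 2) (c b) with hφ
  have hφm : φ ∈ IsManifold.maximalAtlas (𝓡∂ 2) ∞ M := IsManifold.chart_mem_maximalAtlas _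
  set χ := chartAt (EuclideanSpace ℝ (Fin 1)) b with hχ
  have hχm : χ ∈ IsManifold.maximalAtlas (𝓡 1) ∞ B := IsManifold.chart_mem_maximalAtlas _
  have hbχ : b ∈ χ.source := mem_chart_source _ b
  set β : ℝ → B := fun s ↦ χ.symm !₂[s] with hβ
  have hβ₀ : β (χ b 0) = b := by rw [hβ]; simp only [vec1_apply_zero]; exact χ.left_inv hbχ
  set W : Set ℝ := (fun s : ℝ ↦ (!₂[s] : EuclideanSpace ℝ (Fin 1))) ⁻¹' χ.target with hW
  have hWo : IsOpen W := χ.open_target.preimage contDiff_vec1.continuous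
  have hβW : ContMDiffOn 𝓘(ℝ, ℝ) (𝓡 1) ∞ β W :=
    (contMDiffOn_symm_of_mem_maximalAtlas hχm).comp contDiff_vec1.contMDiff.contMDiffOn
      fun s hs ↦ hs
  have hcβ : ContMDiffOn 𝓘(ℝ, ℝ) (𝓡∂ 2) ∞ (c ∘ β) W := hc.comp_contMDiffOn hβW
  set V : Set ℝ := W ∩ (c ∘ β) ⁻¹' φ.source with hV
  have hVo : IsOpen V := hcβ.continuousOn.isOpen_inter_preimage hWo φ.open_source
  have hγ : ContDiffOn ℝ ∞ (φ.extend (𝓡∂ 2) ∘ c ∘ β) V := by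
    rw [← contMDiffOn_iff_contDiffOn]
    exact (φ.contMDiffOn_extend hφm).comp (hcβ.mono inter_subset_left) fun s hs ↦ hs.2
  have hs₀ : χ b 0 ∈ V := by
    refine ⟨?_, ?_⟩
    · change (!₂[χ b 0] : EuclideanSpace ℝ (Fin 1)) ∈ χ.target
      rw [vec1_apply_zero]
      exact χ.map_source hbχ
    · change c (β (χ b 0)) ∈ φ.source
      rw [hβ₀]
      exact mem_chart_source _ _
  have hint' : (φ.extend (𝓡∂ 2) ∘ c ∘ β) (χ b 0) ∈ interior (φ.extend (𝓡∂ 2)).target := by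
    simp only [Function.comp_apply, hβ₀]
    exact hint
  -- h₀ is not the germ of any solution along the curve. Cut off and extended to all of B, it
  -- becomes a function that the hypothesis claims to be the pullback of a solution.
  obtain ⟨h₀, hh₀, hne⟩ := exists_contDiff_ne_solution_on_curve hφm g q hVo hs₀ hγ hint'
  obtain ⟨f, hf⟩ := exists_contMDiffMap_eventuallyEq hχm hbχ hh₀
  obtain ⟨u, hu, huf⟩ := h f
  refine hne u hu ?_
  have hβc : Tendsto β (𝓝 (χ b 0)) (𝓝 b) := by
    have := (hβW.continuousOn.continuousAt (hWo.mem_nhds hs₀.1)).tendsto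
    rwa [hβ₀] at this
  filter_upwards [hVo.mem_nhds hs₀, hβc.eventually hf] with s hs hfs
  have h1 : (φ.extend (𝓡∂ 2)).symm (φ.extend (𝓡∂ 2) (c (β s))) = c (β s) :=
    (φ.extend (𝓡∂ 2)).left_inv (by simpa using hs.2)
  have h2 : χ (β s) = !₂[s] := χ.right_inv hs.1
  simp only [localRep, Function.comp_apply, h1, huf, hfs, h2]
  simp

end Boundary

section Morphism

variable {M₁ : Type*} [TopologicalSpace M₁] [T2Space M₁]
  [ChartedSpace (EuclideanHalfSpace 2) M₁] [IsManifold (𝓡∂ 2) ∞ M₁]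
  {M₂ : Type*} [TopologicalSpace M₂] [CompactSpace M₂]
  [ChartedSpace (EuclideanHalfSpace 2) M₂] [IsManifold (𝓡∂ 2) ∞ M₂]
  {B : Type*} [TopologicalSpace B] [ChartedSpace (EuclideanSpace ℝ (Fin 1)) B]
  [IsManifold (𝓡 1) ∞ B] {ι₁ : B → M₁} {ι₂ : B → M₂} {g₁ : Metric M₁} {q₁ : C^∞⟮𝓡∂ 2, M₁; ℝ⟯}
  {g₂ : Metric M₂} {q₂ : C^∞⟮𝓡∂ 2, M₂; ℝ⟯}

/-- A morphism of solutions is the identity on the common boundary. -/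
theorem apply_boundary_of_morphism (hι₁ : IsBoundaryInclusion ι₁) (hι₂ : IsBoundaryInclusion ι₂)
    (hdef₁ : DNMapDefined g₁ q₁ ι₁) (hdef₂ : DNMapDefined g₂ q₂ ι₂) (F : C^∞⟮𝓡∂ 2, M₁; 𝓡∂ 2, M₂⟯)
    (hF : ∀ (f : C^∞⟮𝓡 1, B; ℝ⟯) (u₁ : C^∞⟮𝓡∂ 2, M₁; ℝ⟯) (u₂ : C^∞⟮𝓡∂ 2, M₂; ℝ⟯),
      IsDirichletSolution g₁ q₁ ι₁ f u₁ → IsDirichletSolution g₂ q₂ ι₂ f u₂ →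
      ∀ p, u₂ (F p) = u₁ p) (b : B) : F (ι₁ b) = ι₂ b := by
  have := hι₁.t2Space
  have hex : ∀ f : C^∞⟮𝓡 1, B; ℝ⟯, ∃ u, IsDirichletSolution g₂ q₂ ι₂ f u ∧
      ∀ b, u (F (ι₁ b)) = f b := fun f ↦
    ⟨_, hdef₂.dirichletSolution f, fun b ↦ by
      rw [hF f _ _ (hdef₁.dirichletSolution f) (hdef₂.dirichletSolution f),
        (hdef₁.dirichletSolution f).2]⟩
  have hmem := mem_boundary_of_forall_exists_solution g₂ q₂ (F.contMDiff.comp hι₁.contMDiff)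
    (fun f ↦ (hex f).imp fun u hu ↦ ⟨hu.1.1, hu.2⟩) b
  rw [← hι₂.range_eq] at hmem
  obtain ⟨b', hb'⟩ := hmem
  -- The point F(ι₁ b) = ι₂ b' is evaluated in two ways: u has the value f b there because it pulls
  -- back to a solution with boundary value f, and f b' because its own boundary value is f.
  by_contra hne
  have hbb' : b ≠ b' := by
    rintro rfl
    exact hne hb'.symm
  obtain ⟨f, hf⟩ := exists_contMDiffMap_ne hbb'
  obtain ⟨u, hu, huf⟩ := hex f
  apply hf
  rw [← huf b, ← hu.2 b', hb']
  rfl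

end Morphism

/-! ### Tangent vectors in charts and the exterior normal -/

theorem partialDeriv_one_eq_zero_of_nonneg {T : Set Plane} {f : Plane → ℝ} (hT : RelOpen T)
    (hf : Sm T f) (h0 : ∀ y ∈ T, 0 ≤ f y) {y : Plane} (hy : y ∈ T) (hfy : f y = 0) :
    partialDeriv 1 f y = 0 := by
  have hmin : IsLocalMinOn f halfPlane y := by
    filter_upwards [hT.mem_nhdsWithin y hy] with z hz
    rw [hfy]
    exact h0 z hz
  have hcone : ∀ w : Plane, w 0 = 0 → w ∈ posTangentConeAt halfPlane y := by
    intro w hw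
    refine mem_posTangentConeAt_of_segment_subset ?_
    intro z hz
    rw [segment_eq_image'] at hz
    obtain ⟨t, ht, rfl⟩ := hz
    have := mem_halfPlane.1 (hT.subset hy)
    rw [mem_halfPlane]
    simp [hw, this]
  exact hmin.hasFDerivWithinAt_eq_zero (hf.differentiableWithinAt hy).hasFDerivWithinAt
    (hcone _ (by simp)) (hcone _ (by simp))

section Chart

variable {M : Type*} [TopologicalSpace M] {φ : OpenPartialHomeomorph M (EuclideanHalfSpace 2)}
  {p : M}

theorem exists_eq_extend_symm (hp : p ∈ φ.source) :
    ∃ y ∈ (φ.extend (𝓡∂ 2)).target, p = (φ.extend (𝓡∂ 2)).symm y ∧ φ.extend (𝓡∂ 2) p = y := by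
  have hp' : p ∈ (φ.extend (𝓡∂ 2)).source := by simpa using hp
  exact ⟨_, (φ.extend (𝓡∂ 2)).map_source hp', ((φ.extend (𝓡∂ 2)).left_inv hp').symm, rfl⟩

variable [ChartedSpace (EuclideanHalfSpace 2) M]

/-- The components of a tangent vector in a chart. -/
noncomputable def chartComponent (φ : OpenPartialHomeomorph M (EuclideanHalfSpace 2)) {p : M}
    (v : TangentSpace (𝓡∂ 2) p) (i : Fin 2) : ℝ :=
  let w : Plane := mfderiv (𝓡∂ 2) 𝓘(ℝ, Plane) (φ.extend (𝓡∂ 2)) p v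
  w i

theorem chartComponent_sum_coordVec (hφ : φ ∈ IsManifold.maximalAtlas (𝓡∂ 2) ∞ M) {y : Plane}
    (hy : y ∈ (φ.extend (𝓡∂ 2)).target) (c : Fin 2 → ℝ) (i : Fin 2) :
    chartComponent φ (c 0 • coordVec φ 0 y + c 1 • coordVec φ 1 y) i = c i := by
  have h : ∀ k, mfderiv (𝓡∂ 2) 𝓘(ℝ, Plane) (φ.extend (𝓡∂ 2)) ((φ.extend (𝓡∂ 2)).symm y)
      (coordVec φ k y) = e k := fun k ↦ mfderiv_extend_mfderivWithin_symm hφ hy (e k)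
  have h2 : mfderiv (𝓡∂ 2) 𝓘(ℝ, Plane) (φ.extend (𝓡∂ 2)) ((φ.extend (𝓡∂ 2)).symm y)
      (c 0 • coordVec φ 0 y + c 1 • coordVec φ 1 y) = (c 0 • e 0 + c 1 • e 1 : Plane) := by
    rw [map_add, map_smul, map_smul, h, h]
    rfl
  rw [chartComponent, h2]
  fin_cases i <;> simp

theorem exists_chartComponent_eq (hφ : φ ∈ IsManifold.maximalAtlas (𝓡∂ 2) ∞ M) (hp : p ∈ φ.source)
    (c : Fin 2 → ℝ) : ∃ v : TangentSpace (𝓡∂ 2) p, ∀ i, chartComponent φ v i = c i := by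
  obtain ⟨y, hy, rfl, -⟩ := exists_eq_extend_symm hp
  exact ⟨_, chartComponent_sum_coordVec hφ hy c⟩

theorem mfderiv_eq_sum_partialDeriv (hφ : φ ∈ IsManifold.maximalAtlas (𝓡∂ 2) ∞ M)
    (hp : p ∈ φ.source) {u : M → ℝ} (hu : MDifferentiableAt (𝓡∂ 2) 𝓘(ℝ, ℝ) u p)
    (v : TangentSpace (𝓡∂ 2) p) :
    mfderiv (𝓡∂ 2) 𝓘(ℝ, ℝ) u p v =
      chartComponent φ v 0 * partialDeriv 0 (localRep φ u) (φ.extend (𝓡∂ 2) p) +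
      chartComponent φ v 1 * partialDeriv 1 (localRep φ u) (φ.extend (𝓡∂ 2) p) := by
  obtain ⟨y, hy, rfl, hpy⟩ := exists_eq_extend_symm hp
  obtain ⟨c, rfl⟩ := exists_eq_coordVec hφ hy v
  rw [chartComponent_sum_coordVec hφ hy, chartComponent_sum_coordVec hφ hy, map_add, map_smul,
    map_smul, mfderiv_coordVec hφ hy hu, mfderiv_coordVec hφ hy hu, hpy]
  rfl

theorem extend_apply_zero_of_mem_boundary (hp : p ∈ (𝓡∂ 2).boundary M) :
    extChartAt (𝓡∂ 2) p p 0 = 0 := by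
  have h : extChartAt (𝓡∂ 2) p p ∈ frontier (range (𝓡∂ 2)) := hp
  rw [frontier_range_modelWithCornersEuclideanHalfSpace] at h
  exact h.symm

variable [IsManifold (𝓡∂ 2) ∞ M]

/-- Pointing outwards does not depend on the chart. The normal coordinate of the preferred chart is
nonnegative and vanishes at p, so in the chart φ it has a minimum: its tangential derivative is zero
and its normal derivative κ is nonnegative. As some tangent vector has normal component 1, κ is not
zero. -/
theorem normalComponent_eq (hφ : φ ∈ IsManifold.maximalAtlas (𝓡∂ 2) ∞ M) (hp : p ∈ φ.source)
    (hpb : p ∈ (𝓡∂ 2).boundary M) :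
    ∃ κ : ℝ, 0 < κ ∧ ∀ v, normalComponent p v = κ * chartComponent φ v 0 := by
  obtain ⟨y, hy, hpy, hyp⟩ := exists_eq_extend_symm hp
  set E := extChartAt (𝓡∂ 2) p with hE
  set r : M → ℝ := fun m ↦ E m 0 with hr
  have hEp : ContMDiffAt (𝓡∂ 2) 𝓘(ℝ, Plane) ∞ E p := contMDiffAt_extChartAt
  have hprojp : ∀ m ∈ (chartAt (EuclideanHalfSpace 2) p).source,
      ContMDiffAt (𝓡∂ 2) 𝓘(ℝ, ℝ) ∞ r m := fun m hm ↦
    (EuclideanSpace.proj (𝕜 := ℝ) (0 : Fin 2)).contMDiff.contMDiffAt.comp m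
      (contMDiffAt_extChartAt' hm)
  have hrp := hprojp p (mem_chart_source _ p)
  have hn : ∀ v, normalComponent p v = mfderiv (𝓡∂ 2) 𝓘(ℝ, ℝ) r p v := by
    intro v
    have h1 : HasMFDerivAt (𝓡∂ 2) 𝓘(ℝ, ℝ) r p _ :=
      (EuclideanSpace.proj (𝕜 := ℝ) (0 : Fin 2)).hasMFDerivAt.comp p
        (hEp.mdifferentiableAt (by simp)).hasMFDerivAt
    rw [h1.mfderiv]
    rfl
  set T := (φ.extend (𝓡∂ 2)).target ∩
    (φ.extend (𝓡∂ 2)).symm ⁻¹' (chartAt (EuclideanHalfSpace 2) p).source with hTdef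
  have hT : RelOpen T := by
    refine ⟨fun z hz ↦ (relOpen_extend_target φ).subset hz.1, fun z hz ↦ ?_⟩
    exact inter_mem ((relOpen_extend_target φ).mem_nhdsWithin z hz.1)
      ((contMDiffWithinAt_extend_symm hφ hz.1).continuousWithinAt
        ((chartAt _ p).open_source.mem_nhds hz.2))
  have hyT : y ∈ T := ⟨hy, by rw [mem_preimage, ← hpy]; exact mem_chart_source _ p⟩
  have hrs : Sm T (localRep φ r) := fun z hz ↦
    contMDiffWithinAt_iff_contDiffWithinAt.1
      ((hprojp _ hz.2).comp_contMDiffWithinAt z (contMDiffWithinAt_extend_symm hφ hz.1))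
  have hr0 : ∀ z ∈ T, 0 ≤ localRep φ r z := by
    intro z hz
    have : E ((φ.extend (𝓡∂ 2)).symm z) ∈ halfPlane := mem_range_self _
    exact mem_halfPlane.1 this
  have hry : localRep φ r y = 0 := by
    change E ((φ.extend (𝓡∂ 2)).symm y) 0 = 0
    rw [← hpy]
    exact extend_apply_zero_of_mem_boundary hpb
  have hd1 := partialDeriv_one_eq_zero_of_nonneg hT hrs hr0 hyT hry
  have hd0 := partialDeriv_zero_nonneg hT hrs hr0 hyT hry
  have hv : ∀ v, normalComponent p v =
      partialDeriv 0 (localRep φ r) y * chartComponent φ v 0 := by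
    intro v
    rw [hn, mfderiv_eq_sum_partialDeriv hφ hp (hrp.mdifferentiableAt (by simp)), hyp, hd1]
    ring
  refine ⟨_, lt_of_le_of_ne hd0 fun h ↦ ?_, hv⟩
  obtain ⟨v, hv1⟩ := exists_chartComponent_eq (IsManifold.chart_mem_maximalAtlas p)
    (mem_chart_source _ p) fun _ ↦ 1
  have h1 : normalComponent p v = 1 := hv1 0
  rw [hv, ← h, zero_mul] at h1
  exact zero_ne_one h1

theorem inner_eq_chartComponent (hφ : φ ∈ IsManifold.maximalAtlas (𝓡∂ 2) ∞ M) (hp : p ∈ φ.source)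
    (g : Metric M) (v w : TangentSpace (𝓡∂ 2) p) :
    g.inner p v w = chartComponent φ v 0 * chartComponent φ w 0 *
        metricCoeff g φ (φ.extend (𝓡∂ 2) p) 0 0 +
      (chartComponent φ v 0 * chartComponent φ w 1 + chartComponent φ v 1 * chartComponent φ w 0) *
        metricCoeff g φ (φ.extend (𝓡∂ 2) p) 0 1 +
      chartComponent φ v 1 * chartComponent φ w 1 *
        metricCoeff g φ (φ.extend (𝓡∂ 2) p) 1 1 := by
  obtain ⟨y, hy, rfl, hpy⟩ := exists_eq_extend_symm hp
  obtain ⟨c, rfl⟩ := exists_eq_coordVec hφ hy v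
  obtain ⟨d, rfl⟩ := exists_eq_coordVec hφ hy w
  have hs := metricCoeff_symm (φ := φ) g y 0 1
  simp only [chartComponent_sum_coordVec hφ hy, hpy]
  simp only [metricCoeff, Matrix.of_apply] at hs ⊢
  simp only [map_add, map_smul, add_apply, smul_apply, smul_eq_mul]
  rw [← hs]
  ring

end Chart

section Normal

variable {M : Type*} [TopologicalSpace M] [ChartedSpace (EuclideanHalfSpace 2) M]
  {φ : OpenPartialHomeomorph M (EuclideanHalfSpace 2)}
  {B : Type*} [TopologicalSpace B] [ChartedSpace (EuclideanSpace ℝ (Fin 1)) B]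
  {χ : OpenPartialHomeomorph B (EuclideanSpace ℝ (Fin 1))}

theorem chartComponent_mfderiv (hφ : φ ∈ IsManifold.maximalAtlas (𝓡∂ 2) ∞ M) {c : B → M} {b : B}
    (hc : MDifferentiableAt (𝓡 1) (𝓡∂ 2) c b) (hb : c b ∈ φ.source) (i : Fin 2)
    (τ : TangentSpace (𝓡 1) b) :
    chartComponent φ (mfderiv (𝓡 1) (𝓡∂ 2) c b τ) i =
      mfderiv (𝓡 1) 𝓘(ℝ, ℝ) (fun b' ↦ φ.extend (𝓡∂ 2) (c b') i) b τ := by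
  have h1 : HasMFDerivAt (𝓡 1) 𝓘(ℝ, ℝ) (fun b' ↦ φ.extend (𝓡∂ 2) (c b') i) b _ :=
    ((EuclideanSpace.proj (𝕜 := ℝ) i).hasMFDerivAt.comp (c b)
      ((φ.contMDiffAt_extend hφ hb).mdifferentiableAt (by simp)).hasMFDerivAt).comp b
        hc.hasMFDerivAt
  rw [h1.mfderiv]
  rfl

/-- Otherwise, by the chain rule, the coordinate composed with its local inverse, which is the
identity of ℝ, would have derivative zero. -/
theorem exists_mfderiv_coord_ne_zero (hχ : χ ∈ IsManifold.maximalAtlas (𝓡 1) ∞ B) {b : B}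
    (hb : b ∈ χ.source) :
    ∃ τ : TangentSpace (𝓡 1) b, mfderiv (𝓡 1) 𝓘(ℝ, ℝ) (fun b' ↦ χ b' 0) b τ ≠ 0 := by
  by_contra! h
  set β : ℝ → B := fun s ↦ χ.symm !₂[s] with hβ
  have hβ₀ : β (χ b 0) = b := by
    change χ.symm (!₂[χ b 0] : EuclideanSpace ℝ (Fin 1)) = b
    rw [vec1_apply_zero]
    exact χ.left_inv hb
  have hmem : (!₂[χ b 0] : EuclideanSpace ℝ (Fin 1)) ∈ χ.target := by
    rw [vec1_apply_zero]
    exact χ.map_source hb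
  have hk : HasMFDerivAt (𝓡 1) 𝓘(ℝ, ℝ) (fun b' ↦ χ b' 0) b
      (0 : EuclideanSpace ℝ (Fin 1) →L[ℝ] ℝ) := by
    have h1 := (((contMDiffOn_coord hχ).contMDiffAt (χ.open_source.mem_nhds hb)).mdifferentiableAt
      (by simp)).hasMFDerivAt
    have h2 : mfderiv (𝓡 1) 𝓘(ℝ, ℝ) (fun b' ↦ χ b' 0) b =
        (0 : EuclideanSpace ℝ (Fin 1) →L[ℝ] ℝ) := ContinuousLinearMap.ext h
    rwa [h2] at h1
  have hβd : MDifferentiableAt 𝓘(ℝ, ℝ) (𝓡 1) β (χ b 0) :=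
    ((contMDiffAt_symm_of_mem_maximalAtlas hχ hmem).comp (χ b 0)
      contDiff_vec1.contMDiff.contMDiffAt).mdifferentiableAt (by simp)
  rw [← hβ₀] at hk
  have hcomp := hasMFDerivAt_iff_hasFDerivAt.1 (hk.comp (χ b 0) hβd.hasMFDerivAt)
  obtain ⟨A, hA, hd⟩ : ∃ A : ℝ →L[ℝ] ℝ, A 1 = 0 ∧
      HasFDerivAt ((fun b' ↦ χ b' 0) ∘ β) A (χ b 0) := ⟨_, rfl, hcomp⟩
  have hev : ((fun b' ↦ χ b' 0) ∘ β) =ᶠ[𝓝 (χ b 0)] id := by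
    filter_upwards [(χ.open_target.preimage contDiff_vec1.continuous).mem_nhds hmem] with s hs
    have h2 : χ (β s) = !₂[s] := χ.right_inv hs
    simp [h2]
  have hAid := hd.unique ((hasFDerivAt_id (χ b 0)).congr_of_eventuallyEq hev)
  rw [hAid] at hA
  exact one_ne_zero hA

theorem IsBoundaryInclusion.mem_boundary {ι : B → M} (h : IsBoundaryInclusion ι) (b : B) :
    ι b ∈ (𝓡∂ 2).boundary M := h.range_eq ▸ mem_range_self b

variable [IsManifold (𝓡∂ 2) ∞ M]
variable {g : Metric M} {ι : B → M}

theorem IsBoundaryNormalChart.mem_source (hφ : IsBoundaryNormalChart g ι χ φ) {b : B}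
    (hb : b ∈ χ.source) : ι b ∈ φ.source := by
  rw [← hφ.preimage_source] at hb
  exact hb

theorem IsBoundaryNormalChart.mem_target (hφ : IsBoundaryNormalChart g ι χ φ) {b : B}
    (hb : b ∈ χ.source) : !₂[0, χ b 0] ∈ (φ.extend (𝓡∂ 2)).target := by
  rw [← hφ.apply_boundary b hb]
  exact (φ.extend (𝓡∂ 2)).map_source (by simpa using hφ.mem_source hb)

theorem IsBoundaryNormalChart.symm_apply (hφ : IsBoundaryNormalChart g ι χ φ) {b : B}
    (hb : b ∈ χ.source) : (φ.extend (𝓡∂ 2)).symm !₂[0, χ b 0] = ι b := by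
  rw [← hφ.apply_boundary b hb]
  exact (φ.extend (𝓡∂ 2)).left_inv (by simpa using hφ.mem_source hb)

theorem IsBoundaryNormalChart.chartComponent_tangent (hφ : IsBoundaryNormalChart g ι χ φ)
    (hι : IsBoundaryInclusion ι) {b : B} (hb : b ∈ χ.source) :
    (∀ τ : TangentSpace (𝓡 1) b, chartComponent φ (mfderiv (𝓡 1) (𝓡∂ 2) ι b τ) 0 = 0) ∧
    ∃ τ : TangentSpace (𝓡 1) b, chartComponent φ (mfderiv (𝓡 1) (𝓡∂ 2) ι b τ) 1 ≠ 0 := by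
  have hd := (hι.contMDiff b).mdifferentiableAt (by simp)
  have hev : ∀ᶠ b' in 𝓝 b, φ.extend (𝓡∂ 2) (ι b') = !₂[0, χ b' 0] := by
    filter_upwards [χ.open_source.mem_nhds hb] with b' hb' using hφ.apply_boundary b' hb'
  constructor
  · intro τ
    rw [chartComponent_mfderiv hφ.mem_maximalAtlas hd (hφ.mem_source hb)]
    have h1 : (fun b' ↦ φ.extend (𝓡∂ 2) (ι b') 0) =ᶠ[𝓝 b] fun _ ↦ (0 : ℝ) := by
      filter_upwards [hev] with b' h
      rw [h]
      rfl
    rw [h1.mfderiv_eq, mfderiv_const]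
    rfl
  · obtain ⟨τ, hτ⟩ := exists_mfderiv_coord_ne_zero hφ.boundary_mem_maximalAtlas hb
    refine ⟨τ, ?_⟩
    rw [chartComponent_mfderiv hφ.mem_maximalAtlas hd (hφ.mem_source hb)]
    have h1 : (fun b' ↦ φ.extend (𝓡∂ 2) (ι b') 1) =ᶠ[𝓝 b] fun b' ↦ χ b' 0 := by
      filter_upwards [hev] with b' h
      rw [h]
      rfl
    rwa [h1.mfderiv_eq]

/-- In boundary normal coordinates the exterior unit normal is `-∂ / ∂ y 0`. -/
theorem IsBoundaryNormalChart.isExteriorUnitNormal_iff (hφ : IsBoundaryNormalChart g ι χ φ)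
    (hι : IsBoundaryInclusion ι) {b : B} (hb : b ∈ χ.source) (ν : TangentSpace (𝓡∂ 2) (ι b)) :
    IsExteriorUnitNormal g ι b ν ↔ chartComponent φ ν 0 = -1 ∧ chartComponent φ ν 1 = 0 := by
  have hs := hφ.mem_source hb
  have ht := hφ.mem_target hb
  have hm := hφ.mem_maximalAtlas
  obtain ⟨κ, hκ, hn⟩ := normalComponent_eq hm hs (hι.mem_boundary b)
  obtain ⟨h0, τ, h1⟩ := hφ.chartComponent_tangent hι hb
  have hpos := metricCoeff_diag_pos hm g ht 1
  have hin : ∀ v w, g.inner (ι b) v w = chartComponent φ v 0 * chartComponent φ w 0 +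
      chartComponent φ v 1 * chartComponent φ w 1 * metricCoeff g φ !₂[0, χ b 0] 1 1 := by
    intro v w
    rw [inner_eq_chartComponent hm hs g v w, hφ.apply_boundary b hb, hφ.metric_normal _ ht,
      hφ.metric_mixed _ ht]
    ring
  constructor
  · intro h
    have h2 := h.orthogonal τ
    rw [hin, h0, mul_zero, zero_add] at h2
    have h3 : chartComponent φ ν 1 = 0 := by
      rcases mul_eq_zero.1 h2 with h2 | h2
      · exact (mul_eq_zero.1 h2).resolve_right h1
      · exact absurd h2 hpos.ne'
    have h4 := h.norm_one
    rw [hin, h3] at h4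
    have h5 := h.exterior
    rw [hn] at h5
    have h6 : chartComponent φ ν 0 < 0 := by
      by_contra! h6
      exact absurd h5 (mul_nonneg hκ.le h6).not_gt
    refine ⟨?_, h3⟩
    nlinarith
  · rintro ⟨h2, h3⟩
    refine ⟨?_, fun τ ↦ ?_, ?_⟩
    · rw [hin, h2, h3]; ring
    · rw [hin, h0, h3]; ring
    · rw [hn, h2]; linarith

/-- The normal is defined by choice, so its components are known only through the existence and
uniqueness contained in `isExteriorUnitNormal_iff`. This translates equality of the
Dirichlet-to-Neumann maps into equality of ∂₀u₁ and ∂₀u₂ on the boundary. -/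
theorem IsBoundaryNormalChart.mfderiv_exteriorUnitNormal (hφ : IsBoundaryNormalChart g ι χ φ)
    (hι : IsBoundaryInclusion ι) {b : B} (hb : b ∈ χ.source) (u : C^∞⟮𝓡∂ 2, M; ℝ⟯) :
    mfderiv (𝓡∂ 2) 𝓘(ℝ, ℝ) u (ι b) (exteriorUnitNormal g ι b) =
      -partialDeriv 0 (localRep φ u) !₂[0, χ b 0] := by
  have hs := hφ.mem_source hb
  obtain ⟨ν, hν⟩ := exists_chartComponent_eq hφ.mem_maximalAtlas hs ![-1, 0]
  have hex : IsExteriorUnitNormal g ι b (exteriorUnitNormal g ι b) := Classical.epsilon_spec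
    ⟨ν, (hφ.isExteriorUnitNormal_iff hι hb ν).2 ⟨hν 0, hν 1⟩⟩
  obtain ⟨h0, h1⟩ := (hφ.isExteriorUnitNormal_iff hι hb _).1 hex
  rw [mfderiv_eq_sum_partialDeriv hφ.mem_maximalAtlas hs
    ((u.contMDiff _).mdifferentiableAt (by simp)), h0, h1, hφ.apply_boundary b hb,
    neg_one_mul, zero_mul, add_zero]

end Normal

/-! ### Pairs of solutions in boundary normal coordinates and conclusion -/

/-- A function whose boundary values are a quadratic polynomial has the tangential derivatives of
this polynomial. -/
theorem partialDeriv_one_of_quadratic {S : Set Plane} (hS : RelOpen S) {u : Plane → ℝ}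
    (hu : Sm S u) {s c d : ℝ}
    (h : ∀ y ∈ S, y 0 = 0 → u y = c * (y 1 - s) + d / 2 * ((y 1 - s) * (y 1 - s)))
    {y : Plane} (hy : y ∈ S) (h0 : y 0 = 0) (h1 : y 1 = s) :
    u y = 0 ∧ partialDeriv 1 u y = c ∧ partialDeriv 1 (partialDeriv 1 u) y = d := by
  have hx : Sm S fun y : Plane ↦ y 1 - s := (Sm.coord 1).sub (Sm.const s)
  have hdx : ∀ z ∈ S, partialDeriv 1 (fun y : Plane ↦ y 1 - s) z = 1 := fun z hz ↦ by
    rw [partialDeriv_sub hS (Sm.coord 1) (Sm.const s) 1 hz, partialDeriv_coord hS 1 1 hz,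
      partialDeriv_const]
    simp
  have hl : ∀ a, ∀ z ∈ S, partialDeriv 1 (fun y : Plane ↦ a * (y 1 - s)) z = a := fun a z hz ↦ by
    rw [partialDeriv_mul hS (Sm.const a) hx 1 hz, hdx z hz, partialDeriv_const]
    ring
  have hq : ∀ z ∈ S, partialDeriv 1
      (fun y : Plane ↦ c * (y 1 - s) + d / 2 * ((y 1 - s) * (y 1 - s))) z = c + d * (z 1 - s) := by
    intro z hz
    rw [partialDeriv_add hS ((Sm.const c).mul hx) ((Sm.const (d / 2)).mul (hx.mul hx)) 1 hz,
      hl c z hz, partialDeriv_mul hS (Sm.const (d / 2)) (hx.mul hx) 1 hz,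
      partialDeriv_mul hS hx hx 1 hz, hdx z hz, partialDeriv_const]
    ring
  have hd1 : ∀ z ∈ S, z 0 = 0 → partialDeriv 1 u z = c + d * (z 1 - s) := fun z hz hz0 ↦ by
    rw [partialDeriv_one_congr hS hu
      (((Sm.const c).mul hx).add ((Sm.const (d / 2)).mul (hx.mul hx))) h hz hz0, hq z hz]
  refine ⟨?_, ?_, ?_⟩
  · rw [h y hy h0, h1]; ring
  · rw [hd1 y hy h0, h1]; ring
  · rw [partialDeriv_one_congr hS (hu.partialDeriv hS 1)
      ((Sm.const c).add ((Sm.const d).mul hx)) hd1 hy h0,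
      partialDeriv_add hS (Sm.const c) ((Sm.const d).mul hx) 1 hy, hl d y hy, partialDeriv_const,
      zero_add]

variable {M₁ : Type*} [TopologicalSpace M₁] {M₂ : Type*} [TopologicalSpace M₂]
  {B : Type*} [TopologicalSpace B]
  {χ : OpenPartialHomeomorph B (EuclideanSpace ℝ (Fin 1))}
  {φ₁ : OpenPartialHomeomorph M₁ (EuclideanHalfSpace 2)}
  {φ₂ : OpenPartialHomeomorph M₂ (EuclideanHalfSpace 2)}

/-- The points of the half plane that are coordinates of a point of either surface, whose tangential
coordinate belongs to the range of the coordinate of the boundary, and at which the coordinate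
representation of `F` is defined. -/
def commonDomain (χ : OpenPartialHomeomorph B (EuclideanSpace ℝ (Fin 1)))
    (φ₁ : OpenPartialHomeomorph M₁ (EuclideanHalfSpace 2))
    (φ₂ : OpenPartialHomeomorph M₂ (EuclideanHalfSpace 2)) (F : M₁ → M₂) : Set Plane :=
  {y | y ∈ (φ₁.extend (𝓡∂ 2)).target ∧ y ∈ (φ₂.extend (𝓡∂ 2)).target ∧
    F ((φ₁.extend (𝓡∂ 2)).symm y) ∈ φ₂.source ∧ (!₂[y 1] : EuclideanSpace ℝ (Fin 1)) ∈ χ.target}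

theorem relOpen_setOf_tangential {S : Set ℝ} {T : Set Plane} (hT : RelOpen T) (hS : IsOpen S) :
    RelOpen {y | y ∈ T ∧ y 1 ∈ S} where
  subset _ hy := hT.subset hy.1
  mem_nhdsWithin y hy := inter_mem (hT.mem_nhdsWithin y hy.1) (mem_nhdsWithin_of_mem_nhds
    ((hS.preimage (EuclideanSpace.proj (𝕜 := ℝ) (1 : Fin 2)).continuous).mem_nhds hy.2))

theorem mapsTo_mapInCharts (F : M₁ → M₂) :
    MapsTo (mapInCharts φ₁ φ₂ F) (commonDomain χ φ₁ φ₂ F) (φ₂.extend (𝓡∂ 2)).target :=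
  fun _ hy ↦ (φ₂.extend (𝓡∂ 2)).map_source (by simpa using hy.2.2.1)

/-- The reason for the tangential condition in `commonDomain`: the hypotheses on the boundary are
indexed by points b of the curve, and have to be available at every boundary point of the domain. -/
theorem exists_eq_of_mem_commonDomain {F : M₁ → M₂} {y : Plane}
    (hy : y ∈ commonDomain χ φ₁ φ₂ F) (h0 : y 0 = 0) : ∃ b ∈ χ.source, y = !₂[0, χ b 0] := by
  refine ⟨χ.symm !₂[y 1], χ.map_target hy.2.2.2, ?_⟩
  rw [χ.right_inv hy.2.2.2]
  ext i
  fin_cases i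
  · exact h0
  · rfl

variable [ChartedSpace (EuclideanHalfSpace 2) M₁]

theorem relOpen_commonDomain (hφ₁ : φ₁ ∈ IsManifold.maximalAtlas (𝓡∂ 2) ∞ M₁) {F : M₁ → M₂}
    (hF : Continuous F) : RelOpen (commonDomain χ φ₁ φ₂ F) where
  subset _ hy := (relOpen_extend_target φ₁).subset hy.1
  mem_nhdsWithin y hy := by
    filter_upwards [(relOpen_extend_target φ₁).mem_nhdsWithin y hy.1,
      (relOpen_extend_target φ₂).mem_nhdsWithin y hy.2.1,
      (hF.continuousAt.comp_continuousWithinAt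
        (contMDiffWithinAt_extend_symm hφ₁ hy.1).continuousWithinAt)
          (φ₂.open_source.mem_nhds hy.2.2.1),
      mem_nhdsWithin_of_mem_nhds ((χ.open_target.preimage (contDiff_vec1.continuous.comp
        (EuclideanSpace.proj (𝕜 := ℝ) (1 : Fin 2)).continuous)).mem_nhds hy.2.2.2)]
      with z h1 h2 h3 h4 using ⟨h1, h2, h3, h4⟩

variable [ChartedSpace (EuclideanHalfSpace 2) M₂]

theorem Sm.mapInCharts (hφ₁ : φ₁ ∈ IsManifold.maximalAtlas (𝓡∂ 2) ∞ M₁)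
    (hφ₂ : φ₂ ∈ IsManifold.maximalAtlas (𝓡∂ 2) ∞ M₂) (F : C^∞⟮𝓡∂ 2, M₁; 𝓡∂ 2, M₂⟯) :
    Sm (commonDomain χ φ₁ φ₂ F) (mapInCharts φ₁ φ₂ F) := fun y hy ↦
  contMDiffWithinAt_iff_contDiffWithinAt.1
    ((φ₂.contMDiffAt_extend hφ₂ hy.2.2.1).comp_contMDiffWithinAt y
      (F.contMDiff.contMDiffAt.comp_contMDiffWithinAt y
        (contMDiffWithinAt_extend_symm hφ₁ hy.1)))

variable [ChartedSpace (EuclideanSpace ℝ (Fin 1)) B] [IsManifold (𝓡∂ 2) ∞ M₁]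
  [IsManifold (𝓡∂ 2) ∞ M₂] {ι₁ : B → M₁} {ι₂ : B → M₂}
  {g₁ : Metric M₁} {q₁ : C^∞⟮𝓡∂ 2, M₁; ℝ⟯} {g₂ : Metric M₂} {q₂ : C^∞⟮𝓡∂ 2, M₂; ℝ⟯}

theorem mem_commonDomain (hφ₁ : IsBoundaryNormalChart g₁ ι₁ χ φ₁)
    (hφ₂ : IsBoundaryNormalChart g₂ ι₂ χ φ₂) {F : M₁ → M₂} (hFι : ∀ b, F (ι₁ b) = ι₂ b) {b : B}
    (hb : b ∈ χ.source) : !₂[0, χ b 0] ∈ commonDomain χ φ₁ φ₂ F := by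
  refine ⟨hφ₁.mem_target hb, hφ₂.mem_target hb, ?_, ?_⟩
  · rw [hφ₁.symm_apply hb, hFι]
    exact hφ₂.mem_source hb
  · change (!₂[χ b 0] : EuclideanSpace ℝ (Fin 1)) ∈ χ.target
    rw [vec1_apply_zero]
    exact χ.map_source hb

theorem mapInCharts_boundary (hφ₁ : IsBoundaryNormalChart g₁ ι₁ χ φ₁)
    (hφ₂ : IsBoundaryNormalChart g₂ ι₂ χ φ₂) {F : M₁ → M₂} (hFι : ∀ b, F (ι₁ b) = ι₂ b) {b : B}
    (hb : b ∈ χ.source) : mapInCharts φ₁ φ₂ F !₂[0, χ b 0] = !₂[0, χ b 0] := by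
  rw [mapInCharts, Function.comp_apply, Function.comp_apply, hφ₁.symm_apply hb, hFι,
    hφ₂.apply_boundary b hb]

/-- The solutions with the same boundary value form a pair of solutions in boundary normal
coordinates. -/
theorem isSolutionPair_dirichletSolution (hι₁ : IsBoundaryInclusion ι₁)
    (hι₂ : IsBoundaryInclusion ι₂) (hdef₁ : DNMapDefined g₁ q₁ ι₁) (hdef₂ : DNMapDefined g₂ q₂ ι₂)
    (hDN : dnMap g₁ q₁ ι₁ = dnMap g₂ q₂ ι₂) (F : C^∞⟮𝓡∂ 2, M₁; 𝓡∂ 2, M₂⟯)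
    (hcoeff : CoefficientsAgree g₁ q₁ ι₁ g₂ q₂ ι₂) (hφ₁ : IsBoundaryNormalChart g₁ ι₁ χ φ₁)
    (hφ₂ : IsBoundaryNormalChart g₂ ι₂ χ φ₂) (f : C^∞⟮𝓡 1, B; ℝ⟯)
    (hF : ∀ p, dirichletSolution g₂ q₂ ι₂ f (F p) = dirichletSolution g₁ q₁ ι₁ f p) :
    IsSolutionPair (commonDomain χ φ₁ φ₂ F) (φ₂.extend (𝓡∂ 2)).target (mapInCharts φ₁ φ₂ F)
      (fun y ↦ metricCoeff g₂ φ₂ y 1 1) (localRep φ₂ q₂)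
      (localRep φ₁ (dirichletSolution g₁ q₁ ι₁ f)) (localRep φ₂ (dirichletSolution g₂ q₂ ι₂ f)) := by
  have hm₁ := hφ₁.mem_maximalAtlas
  have hm₂ := hφ₂.mem_maximalAtlas
  have hT : RelOpen (commonDomain χ φ₁ φ₂ F) := relOpen_commonDomain hm₁ F.contMDiff.continuous
  have hs₁ : commonDomain χ φ₁ φ₂ F ⊆ (φ₁.extend (𝓡∂ 2)).target := fun y hy ↦ hy.1
  have hs₂ : commonDomain χ φ₁ φ₂ F ⊆ (φ₂.extend (𝓡∂ 2)).target := fun y hy ↦ hy.2.1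
  have hu₁ := hdef₁.dirichletSolution f
  have hu₂ := hdef₂.dirichletSolution f
  have h₁s := (Sm.metricCoeff hm₁ g₁ 1 1).mono hs₁
  have h₂s := (Sm.metricCoeff hm₂ g₂ 1 1).mono hs₂
  have q₁s := (Sm.localRep hm₁ q₁).mono hs₁
  have q₂s := (Sm.localRep hm₂ q₂).mono hs₂
  have u₁s := (Sm.localRep hm₁ (dirichletSolution g₁ q₁ ι₁ f)).mono hs₁
  have u₂s := (Sm.localRep hm₂ (dirichletSolution g₂ q₂ ι₂ f)).mono hs₂
  refine ⟨u₁s, Sm.localRep hm₂ _, fun y hy ↦ ?_, ?_, fun y hy ↦ hu₂.1.normalFormEq hφ₂ (hs₂ hy)⟩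
  · have h1 : (φ₂.extend (𝓡∂ 2)).symm (mapInCharts φ₁ φ₂ F y) =
        F ((φ₁.extend (𝓡∂ 2)).symm y) :=
      (φ₂.extend (𝓡∂ 2)).left_inv (by simpa using hy.2.2.1)
    simp only [localRep, Function.comp_apply, h1, hF]
  -- The Cauchy data coincide: the boundary values are both f, and the normal derivatives agree by
  -- equality of the Dirichlet-to-Neumann maps. The equations determine the remaining normal
  -- derivatives.
  · refine agree_of_normalFormEq hT h₁s h₂s q₁s q₂s u₁s u₂s
      (fun y hy ↦ metricCoeff_diag_pos hm₁ g₁ (hs₁ hy) 1) ?_ ?_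
      (fun y hy ↦ hu₁.1.normalFormEq hφ₁ (hs₁ hy)) (fun y hy ↦ hu₂.1.normalFormEq hφ₂ (hs₂ hy)) ?_
    · refine fun k ↦ agree_of_sameTaylorSeriesAt hT k h₁s h₂s fun y hy h0 ↦ ?_
      obtain ⟨b, hb, rfl⟩ := exists_eq_of_mem_commonDomain hy h0
      exact (hcoeff χ φ₁ φ₂ hφ₁ hφ₂ b hb).1 1 1
    · refine fun k ↦ agree_of_sameTaylorSeriesAt hT k q₁s q₂s fun y hy h0 ↦ ?_
      obtain ⟨b, hb, rfl⟩ := exists_eq_of_mem_commonDomain hy h0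
      exact (hcoeff χ φ₁ φ₂ hφ₁ hφ₂ b hb).2
    · refine ⟨fun y hy h0 ↦ ?_, fun y hy h0 ↦ ?_, trivial⟩
      · obtain ⟨b, hb, rfl⟩ := exists_eq_of_mem_commonDomain hy h0
        simp only [localRep, Function.comp_apply, hφ₁.symm_apply hb, hφ₂.symm_apply hb, hu₁.2,
          hu₂.2]
      · obtain ⟨b, hb, rfl⟩ := exists_eq_of_mem_commonDomain hy h0
        have := congrFun (congrFun hDN f) b
        rw [dnMap, dnMap, hφ₁.mfderiv_exteriorUnitNormal hι₁ hb,
          hφ₂.mfderiv_exteriorUnitNormal hι₂ hb] at this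
        exact neg_injective this

variable [IsManifold (𝓡 1) ∞ B]

/-- The jets of the pairs of solutions at a boundary point are arbitrary. -/
theorem exists_isSolutionPair [T2Space M₁] (hι₁ : IsBoundaryInclusion ι₁)
    (hι₂ : IsBoundaryInclusion ι₂) (hdef₁ : DNMapDefined g₁ q₁ ι₁) (hdef₂ : DNMapDefined g₂ q₂ ι₂)
    (hDN : dnMap g₁ q₁ ι₁ = dnMap g₂ q₂ ι₂) (F : C^∞⟮𝓡∂ 2, M₁; 𝓡∂ 2, M₂⟯)
    (hF : ∀ (f : C^∞⟮𝓡 1, B; ℝ⟯) (u₁ : C^∞⟮𝓡∂ 2, M₁; ℝ⟯) (u₂ : C^∞⟮𝓡∂ 2, M₂; ℝ⟯),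
      IsDirichletSolution g₁ q₁ ι₁ f u₁ → IsDirichletSolution g₂ q₂ ι₂ f u₂ →
      ∀ p, u₂ (F p) = u₁ p)
    (hcoeff : CoefficientsAgree g₁ q₁ ι₁ g₂ q₂ ι₂) (hφ₁ : IsBoundaryNormalChart g₁ ι₁ χ φ₁)
    (hφ₂ : IsBoundaryNormalChart g₂ ι₂ χ φ₂) {b : B} (hb : b ∈ χ.source) (c d : ℝ) :
    ∃ u₁ u₂, IsSolutionPair (commonDomain χ φ₁ φ₂ F) (φ₂.extend (𝓡∂ 2)).target
      (mapInCharts φ₁ φ₂ F) (fun y ↦ metricCoeff g₂ φ₂ y 1 1) (localRep φ₂ q₂) u₁ u₂ ∧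
      u₂ !₂[0, χ b 0] = 0 ∧ partialDeriv 1 u₂ !₂[0, χ b 0] = c ∧
      partialDeriv 1 (partialDeriv 1 u₂) !₂[0, χ b 0] = d := by
  have := hι₁.t2Space
  -- Near b the boundary value is the quadratic polynomial in the coordinate with value 0, slope c
  -- and second derivative d at b.
  obtain ⟨f, hf⟩ := exists_contMDiffMap_eventuallyEq hφ₁.boundary_mem_maximalAtlas hb
    (h := fun t ↦ c * (t - χ b 0) + d / 2 * ((t - χ b 0) * (t - χ b 0))) (by fun_prop)
  refine ⟨_, _, isSolutionPair_dirichletSolution hι₁ hι₂ hdef₁ hdef₂ hDN F hcoeff hφ₁ hφ₂ f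
    (hF f _ _ (hdef₁.dirichletSolution f) (hdef₂.dirichletSolution f)), ?_⟩
  have hmem : (!₂[χ b 0] : EuclideanSpace ℝ (Fin 1)) ∈ χ.target := by
    rw [vec1_apply_zero]
    exact χ.map_source hb
  have hcont : ContinuousAt (fun t : ℝ ↦ χ.symm !₂[t]) (χ b 0) :=
    ContinuousAt.comp (f := fun t : ℝ ↦ (!₂[t] : EuclideanSpace ℝ (Fin 1))) (g := χ.symm)
      (χ.continuousAt_symm hmem) contDiff_vec1.continuous.continuousAt
  have hval : χ.symm (!₂[χ b 0] : EuclideanSpace ℝ (Fin 1)) = b := by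
    rw [vec1_apply_zero]
    exact χ.left_inv hb
  have hev : ∀ᶠ t in 𝓝 (χ b 0), (!₂[t] : EuclideanSpace ℝ (Fin 1)) ∈ χ.target ∧
      f (χ.symm !₂[t]) = c * (t - χ b 0) + d / 2 * ((t - χ b 0) * (t - χ b 0)) := by
    have ht : Tendsto (fun t : ℝ ↦ χ.symm !₂[t]) (𝓝 (χ b 0)) (𝓝 b) := by
      have := hcont.tendsto
      rwa [hval] at this
    filter_upwards [ht.eventually hf,
      (χ.open_target.preimage contDiff_vec1.continuous).mem_nhds hmem] with t h1 h2
    refine ⟨h2, ?_⟩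
    rw [h1, χ.right_inv h2]
    rfl
  obtain ⟨N, hN, hNo, hbN⟩ := eventually_nhds_iff.1 hev
  have hS := relOpen_setOf_tangential (relOpen_extend_target φ₂) hNo
  refine partialDeriv_one_of_quadratic hS
    ((Sm.localRep hφ₂.mem_maximalAtlas _).mono fun y hy ↦ hy.1) (s := χ b 0) ?_
    (y := !₂[0, χ b 0]) ⟨hφ₂.mem_target hb, hbN⟩ rfl rfl
  intro y hy h0
  obtain ⟨h1, h2⟩ := hN _ hy.2
  have hsrc := χ.map_target h1
  have hyb : y = !₂[0, χ (χ.symm !₂[y 1]) 0] := by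
    rw [χ.right_inv h1]
    ext i
    fin_cases i
    · exact h0
    · rfl
  have h3 : (φ₂.extend (𝓡∂ 2)).symm y = ι₂ (χ.symm !₂[y 1]) := by
    conv_lhs => rw [hyb]
    exact hφ₂.symm_apply hsrc
  rw [localRep, Function.comp_apply, h3, (hdef₂.dirichletSolution f).2, h2]

/-- A morphism of solutions that is the identity on the boundary is the identity to infinite order
there. -/
theorem isIdToInfiniteOrder_of_morphism [T2Space M₁] (hι₁ : IsBoundaryInclusion ι₁)
    (hι₂ : IsBoundaryInclusion ι₂) (hdef₁ : DNMapDefined g₁ q₁ ι₁) (hdef₂ : DNMapDefined g₂ q₂ ι₂)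
    (hDN : dnMap g₁ q₁ ι₁ = dnMap g₂ q₂ ι₂) (F : C^∞⟮𝓡∂ 2, M₁; 𝓡∂ 2, M₂⟯)
    (hF : ∀ (f : C^∞⟮𝓡 1, B; ℝ⟯) (u₁ : C^∞⟮𝓡∂ 2, M₁; ℝ⟯) (u₂ : C^∞⟮𝓡∂ 2, M₂; ℝ⟯),
      IsDirichletSolution g₁ q₁ ι₁ f u₁ → IsDirichletSolution g₂ q₂ ι₂ f u₂ →
      ∀ p, u₂ (F p) = u₁ p)
    (hcoeff : CoefficientsAgree g₁ q₁ ι₁ g₂ q₂ ι₂) (hFι : ∀ b, F (ι₁ b) = ι₂ b) :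
    IsIdToInfiniteOrder g₁ ι₁ g₂ ι₂ F := by
  refine ⟨hFι, fun χ φ₁ φ₂ hφ₁ hφ₂ b hb ↦ ?_⟩
  have hT : RelOpen (commonDomain χ φ₁ φ₂ F) :=
    relOpen_commonDomain hφ₁.mem_maximalAtlas F.contMDiff.continuous
  have hFs : Sm (commonDomain χ φ₁ φ₂ F) (mapInCharts φ₁ φ₂ F) :=
    Sm.mapInCharts hφ₁.mem_maximalAtlas hφ₂.mem_maximalAtlas F
  have hy : !₂[0, χ b 0] ∈ commonDomain χ φ₁ φ₂ F := mem_commonDomain hφ₁ hφ₂ hFι hb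
  -- The coefficients are those of the second surface, because the argument for the jet of F uses
  -- the equation of u₂ only.
  have key := agree_of_solutionPairs (h := fun y ↦ metricCoeff g₂ φ₂ y 1 1) (q := localRep φ₂ q₂)
    hT (relOpen_extend_target φ₂) (fun y hy ↦ hy.2.1) hFs (mapsTo_mapInCharts F)
    (fun y hy ↦ metricCoeff_diag_pos hφ₂.mem_maximalAtlas g₂ hy.2.1 1)
    (fun y hy h0 ↦ by
      obtain ⟨b', hb', rfl⟩ := exists_eq_of_mem_commonDomain hy h0
      exact mapInCharts_boundary hφ₁ hφ₂ hFι hb')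
    (fun y hy h0 c d ↦ by
      obtain ⟨b', hb', rfl⟩ := exists_eq_of_mem_commonDomain hy h0
      exact exists_isSolutionPair hι₁ hι₂ hdef₁ hdef₂ hDN F hF hcoeff hφ₁ hφ₂ hb' c d)
  have hid : Sm (commonDomain χ φ₁ φ₂ F) (id : Plane → Plane) := fun z _ ↦ contDiffWithinAt_id
  exact ⟨sameTaylorSeriesAt_plane hT hFs hid hy fun j ↦
    sameTaylorSeriesAt_of_agree hT (hFs.apply j) (Sm.coord j)
      (fun k ↦ Agree.of_sub_zero hT (hFs.apply j) (Sm.coord j) (key k j)) hy rfl,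
    fun N ↦ isBigO_of_agree_zero hT hFs (key N) hy rfl⟩

end SurfaceBVP

open SurfaceBVP in
theorem lemma5p1
    {M₁ : Type*} [TopologicalSpace M₁] [T2Space M₁] [CompactSpace M₁]
    [ChartedSpace (EuclideanHalfSpace 2) M₁] [IsManifold (𝓡∂ 2) ∞ M₁]
    {M₂ : Type*} [TopologicalSpace M₂] [T2Space M₂] [CompactSpace M₂]
    [ChartedSpace (EuclideanHalfSpace 2) M₂] [IsManifold (𝓡∂ 2) ∞ M₂]
    {B : Type*} [TopologicalSpace B] [ChartedSpace (EuclideanSpace ℝ (Fin 1)) B]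
    [IsManifold (𝓡 1) ∞ B]
    (ι₁ : B → M₁) (hι₁ : IsBoundaryInclusion ι₁)
    (ι₂ : B → M₂) (hι₂ : IsBoundaryInclusion ι₂)
    (g₁ : SurfaceBVP.Metric M₁) (q₁ : C^∞⟮𝓡∂ 2, M₁; ℝ⟯)
    (g₂ : SurfaceBVP.Metric M₂) (q₂ : C^∞⟮𝓡∂ 2, M₂; ℝ⟯)
    (hdef₁ : DNMapDefined g₁ q₁ ι₁) (hdef₂ : DNMapDefined g₂ q₂ ι₂)
    (hDN : dnMap g₁ q₁ ι₁ = dnMap g₂ q₂ ι₂)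
    (F : C^∞⟮𝓡∂ 2, M₁; 𝓡∂ 2, M₂⟯)
    (hF : ∀ (f : C^∞⟮𝓡 1, B; ℝ⟯) (u₁ : C^∞⟮𝓡∂ 2, M₁; ℝ⟯) (u₂ : C^∞⟮𝓡∂ 2, M₂; ℝ⟯),
      IsDirichletSolution g₁ q₁ ι₁ f u₁ → IsDirichletSolution g₂ q₂ ι₂ f u₂ →
      ∀ p, u₂ (F p) = u₁ p)
    (hcoeff : CoefficientsAgree g₁ q₁ ι₁ g₂ q₂ ι₂) :
    IsIdToInfiniteOrder g₁ ι₁ g₂ ι₂ F :=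
  isIdToInfiniteOrder_of_morphism hι₁ hι₂ hdef₁ hdef₂ hDN F hF hcoeff
    (apply_boundary_of_morphism hι₁ hι₂ hdef₁ hdef₂ F hF)
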